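/- Write $\mathrm{e}(z)=e^{2\pi i z}$. Let $N\ge 2$ be an integer, let $\eta=\mathrm{e}(1/2N)$ and $w=(1-\eta)^{-1}$. (1) For every $k\in\mathbb{Z}$ with $k\equiv N \pmod{2N}$ the series $$S_k=\sum_{m=1}^\infty \frac{\mathrm{e}(-mw)}{\prod_{\ell=1}^{N-1}\big(1-\mathrm{e}(-m\eta^\ell)\big)}\,m^{k-1}$$ converges absolutely; $(2\pi i)^{k-1}S_k$ lies in $\mathbb{Q}(\eta)$ if $N$ is even and in $\mathbb{Q}$ if $N$ is odd; and $S_k=0$ if $k>N$. (2) If $N$ is odd, then for every $k\in 2N\mathbb{Z}$ the series $$\sum_{m\in\mathbb{Z},\,m\neq0}\frac{m^{k-1}}{\prod_{\ell=1}^{N-1}\big(1-\mathrm{e}(-m\eta^{2\ell})\big)}$$ converges absolutely and its sum is $0$. (3) Let $b=(\eta^{\lfloor N/2\rfloor+1-N},\eta^{\lfloor N/2\rfloor+2-N},\dots,\eta^{\lfloor N/2\rfloor})\in\mathbb{C}^N$ and $v=\frac12\sum_{j=1}^N b_j$. The Barnes multiple zeta function $\zeta_N(s,v,b)=\sum_{m\in\mathbb{N}^N}(v+m\cdot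 b)^{-s}$ (where $0\in\mathbb{N}$ and powers are principal; absolutely convergent for $\mathrm{Re}(s)>N$) has an analytic continuation in $s$ to $\mathbb{C}\smallsetminus\{1,\dots,N\}$, and the Barnes multiple gamma value $\Gamma_N(v,b)=\exp\big(\tfrac{d}{ds}\zeta_N(s,v,b)\big|_{s=0}\big)$ is $$\Gamma_N(v,b)=\prod_{n\in\mathbb{N}^{N-1}}\Big(1-\mathrm{e}(-w)\,\mathrm{e}\big((1+n_1)\eta+\dots+(1+n_{N-1})\eta^{N-1}\big)\Big)^{-1/2},$$ with principal square roots, the product converging unconditionally. -/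

import Mathlib

namespace Barnes

/-- The normalized exponential `e(z) = exp(2πiz)`. -/
noncomputable def e (z : ℂ) : ℂ := Complex.exp (2 * Real.pi * Complex.I * z)

/-- `Z` is the analytic continuation in `s` of the Barnes multiple zeta function
`ζ_N(s, w, a) = ∑_{m ∈ ℕ^N} (w + m ⬝ a)^{-s}` (principal branch of the powers): it is holomorphic
on `ℂ ∖ {1, …, N}`, and for `Re s > N` it is the sum of the (absolutely convergent) series. -/
def IsZeta {N : ℕ} (w : ℂ) (a : Fin N → ℂ) (Z : ℂ → ℂ) : Prop :=
  DifferentiableOn ℂ Z {s : ℂ | ∀ j ∈ Finset.Icc 1 N, s ≠ (j : ℂ)} ∧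
  ∀ s : ℂ, (N : ℝ) < s.re →
    HasSum (fun m : Fin N → ℕ => (w + ∑ l, (m l : ℂ) * a l) ^ (-s)) (Z s)

/-- The continuation is unique away from the possible poles `1, …, N`. -/
theorem IsZeta.eqOn {N : ℕ} {w : ℂ} {a : Fin N → ℂ} {Z₁ Z₂ : ℂ → ℂ}
    (h₁ : IsZeta w a Z₁) (h₂ : IsZeta w a Z₂) :
    Set.EqOn Z₁ Z₂ {s : ℂ | ∀ j ∈ Finset.Icc 1 N, s ≠ (j : ℂ)} := by
  set U : Set ℂ := {s : ℂ | ∀ j ∈ Finset.Icc 1 N, s ≠ (j : ℂ)} with hU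
  have hfin : ((fun j : ℕ => (j : ℂ)) '' (Finset.Icc 1 N : Set ℕ)).Finite :=
    (Finset.finite_toSet _).image _
  have hUc : U = ((fun j : ℕ => (j : ℂ)) '' (Finset.Icc 1 N : Set ℕ))ᶜ := by
    ext s
    simp only [hU, Set.mem_ofPred_eq, Set.mem_compl_iff, Set.mem_image, Finset.mem_coe, not_exists,
      not_and]
    exact forall₂_congr fun j _ => ⟨fun h h' => h h'.symm, fun h h' => h h'.symm⟩
  have hopen : IsOpen U := hUc ▸ hfin.isClosed.isOpen_compl
  have hconn : IsPreconnected U := by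
    rw [hUc]
    exact (hfin.countable.isConnected_compl_of_one_lt_rank
      (by rw [Complex.rank_real_complex]; norm_num)).isPreconnected
  have hhalf : IsOpen {s : ℂ | (N : ℝ) < s.re} := isOpen_lt continuous_const Complex.continuous_re
  have hz : ((N : ℂ) + 1) ∈ {s : ℂ | (N : ℝ) < s.re} := by simp
  have hzU : ((N : ℂ) + 1) ∈ U := by
    intro j hj h
    have : (N + 1 : ℕ) = j := by exact_mod_cast h
    have := (Finset.mem_Icc.1 hj).2
    omega
  refine (h₁.1.analyticOnNhd hopen).eqOn_of_preconnected_of_eventuallyEq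
    (h₂.1.analyticOnNhd hopen) hconn hzU ?_
  filter_upwards [hhalf.mem_nhds hz] with s hs
  exact (h₁.2 s hs).unique (h₂.2 s hs)

/-- The Barnes multiple zeta function `s ↦ ζ_N(s, w, a)`, continued in `s`: a function with
`IsZeta w a` (an arbitrary function if the continuation does not exist). -/
noncomputable def zeta {N : ℕ} (w : ℂ) (a : Fin N → ℂ) : ℂ → ℂ :=
  Classical.epsilon (IsZeta w a)

/-- The Barnes multiple gamma function `Γ_N(w, a) = exp (d/ds ζ_N(s, w, a) at s = 0)`. -/
noncomputable def Gamma {N : ℕ} (w : ℂ) (a : Fin N → ℂ) : ℂ :=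
  Complex.exp (deriv (zeta w a) 0)

end Barnes

namespace Barnes

open Complex Filter Topology

/-! ### Lower bounds for the complex sine -/

/-! Since `1 + η + ⋯ + η^(N-1) = 2w` and `1 - e(-z) = e(-z/2) · 2i sin(πz)`, the exponentials in the
summand cancel and leave `coef N m = (-1)^m / ∏_{1 ≤ l < N} 2i sin(π m η^l)`, which decays
exponentially because `η^l` is not real for `0 < l < N`.

Everything rests on one function, `G(z) = gen N z = ∏_{l < N} z / (2i sin(π z η^l))`. It is
invariant under `z ↦ ηz`, its only singularities are simple poles at `η^l n` with `n ≥ 1`, its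
residue at `n` is `n^N coef N n / 2πi`, and it decays exponentially on the circles `|z| = n + 1/2`.
So `G`, the products `z^j G` and the iterated difference quotients of `G` at `0` are the sums of
their principal parts (`HasSimplePoles.hasSum`).

Part (1): evaluate these expansions at `0` with `2N ∣ j`. The `2N` rotated poles contribute equally,
so `∑ coef N m · m^(N+j-1)` is a multiple of the value of `z^j G` at `0`, hence vanishes for `j >
0`, and `∑ coef N m · m^(N-j-1)` is a multiple of the `j`-th Taylor coefficient of `G`. Up to `G(0)`
and a power of `π` that coefficient is rational, because the logarithmic derivative of `∏ zη^l /
sin(zη^l)` has Taylor coefficients averaged over roots of unity (`hasCoeffsIn_sincInvProd`).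

Part (2): the summand is an odd function of `m`.

Part (3): after a rotation the lattice is spanned by `β_j = -i θ_j` in the right half-plane, and its
zeta function is `(2π)^s / Γ(s)` times the Mellin transform of `∏ 1 / (2 sinh(π β_j T))`, a constant
multiple of `T^(-N) G(θ_0 T)`. Integrating the partial fractions termwise gives `(-1)^N / 2 · ∑ coef
N m · m^(s-1) / sin(π(s - N)/2N)` (`mellin_kernel`). The series is entire in `s`, which provides the
continuation; at `s = 0` the simple zero of `1/Γ` turns the derivative into `(-1)^(N-1) / 2 · ∑ coef
N m / m`. Expanding the logarithm of the infinite product yields the same number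
(`hasProd_one_sub_cpow`). -/

theorem sinh_abs_im_le_norm_sin (z : ℂ) : Real.sinh |z.im| ≤ ‖sin z‖ := by
  have h1 : ‖exp (-z * I) - exp (z * I)‖ = 2 * ‖sin z‖ := by
    rw [Complex.sin]
    simp only [norm_div, norm_mul, norm_I, mul_one, Complex.norm_ofNat]
    ring
  have h2 := abs_norm_sub_norm_le (exp (-z * I)) (exp (z * I))
  rw [h1, norm_exp, norm_exp] at h2
  have h3 : Real.sinh |z.im| * 2 ≤ |Real.exp (-z * I).re - Real.exp (z * I).re| := by
    simp only [mul_re, neg_re, I_re, mul_zero, neg_im, I_im, mul_one, zero_sub, neg_neg]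
    rw [Real.sinh_eq]
    rcases abs_cases z.im with ⟨h, _⟩ | ⟨h, _⟩ <;> rw [h]
    · rw [div_mul_cancel₀ _ two_ne_zero]
      exact le_abs_self _
    · rw [neg_neg, div_mul_cancel₀ _ two_ne_zero, abs_sub_comm]
      exact le_abs_self _
  linarith

theorem abs_sin_re_le_norm_sin (z : ℂ) : |Real.sin z.re| ≤ ‖sin z‖ := by
  have h : (sin z).re = Real.sin z.re * Real.cosh z.im := by
    rw [sin_eq]
    simp [← ofReal_sin, ← ofReal_cos, ← ofReal_cosh, ← ofReal_sinh]
  calc |Real.sin z.re| ≤ |Real.sin z.re| * Real.cosh z.im :=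
        le_mul_of_one_le_right (abs_nonneg _) (Real.one_le_cosh _)
    _ = |(sin z).re| := by rw [h, abs_mul, abs_of_pos (Real.cosh_pos _)]
    _ ≤ ‖sin z‖ := abs_re_le_norm _

theorem exp_le_four_mul_sinh {y : ℝ} (hy : 1 / 2 ≤ y) : Real.exp y / 4 ≤ Real.sinh y := by
  rw [Real.sinh_eq]
  have h1 : 1 / 2 + 1 ≤ Real.exp (1 / 2) := Real.add_one_le_exp _
  have h2 := Real.exp_le_exp.2 hy
  have h3 : Real.exp y * Real.exp (-y) = 1 := by rw [← Real.exp_add]; simp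
  have h4 := Real.exp_pos (-y)
  nlinarith

/-- Away from the real axis `sinh` gives the bound. Near it, the distance to the integers must come
from the real part, and Jordan's inequality `|sin(πx)| ≥ 2|x|` for `|x| ≤ 1/2` applies. -/
theorem exp_abs_im_le_norm_sin_pi {z : ℂ} (hz : ∀ m : ℤ, 1 / 2 ≤ ‖z - m‖) :
    Real.exp (Real.pi * |z.im|) / 4 ≤ ‖sin (Real.pi * z)‖ := by
  have him : |(Real.pi * z : ℂ).im| = Real.pi * |z.im| := by
    simp [abs_mul, abs_of_pos Real.pi_pos]
  rcases le_or_gt (1 / 2) (Real.pi * |z.im|) with h | h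
  · refine (exp_le_four_mul_sinh h).trans ?_
    rw [← him]
    exact sinh_abs_im_le_norm_sin _
  · have hpi := Real.pi_gt_three
    have hi : |z.im| ≤ 1 / 6 := by nlinarith [abs_nonneg z.im]
    set m := round z.re with hm
    have hr : |z.re - m| ≤ 1 / 2 := abs_sub_round z.re
    have h1 : 1 / 4 ≤ |z.re - m| ^ 2 + |z.im| ^ 2 := by
      have := hz m
      have h2 : ‖z - m‖ ^ 2 = |z.re - m| ^ 2 + |z.im| ^ 2 := by
        rw [← normSq_eq_norm_sq, normSq_apply]
        simp [sq]
      nlinarith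
    have h2 : 9 / 20 ≤ |z.re - m| := by
      by_contra! hc
      nlinarith [abs_nonneg (z.re - m), abs_nonneg z.im]
    have h3 : |Real.sin (Real.pi * z.re)| = |Real.sin (Real.pi * (z.re - m))| := by
      rw [mul_sub, mul_comm Real.pi (m : ℝ), Real.sin_sub_int_mul_pi, abs_mul, abs_zpow]
      simp
    have h4 : 2 / Real.pi * |Real.pi * (z.re - m)| ≤ |Real.sin (Real.pi * (z.re - m))| := by
      apply Real.mul_abs_le_abs_sin
      rw [abs_mul, abs_of_pos Real.pi_pos]
      nlinarith
    rw [abs_mul, abs_of_pos Real.pi_pos, ← mul_assoc, div_mul_cancel₀ _ Real.pi_ne_zero] at h4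
    have h5 := abs_sin_re_le_norm_sin (Real.pi * z)
    have h6 : (Real.pi * z : ℂ).re = Real.pi * z.re := by simp
    rw [h6, h3] at h5
    have h7 : Real.exp (Real.pi * |z.im|) ≤ Real.exp 1 := Real.exp_le_exp.2 (by linarith)
    have := Real.exp_one_lt_d9
    linarith

/-- Exponential growth of `sin (π m x)` along the integers, off the real axis. -/
theorem exists_exp_le_norm_sin {x : ℂ} (hx : x.im ≠ 0) :
    ∃ c > 0, ∀ m : ℤ, m ≠ 0 →
      c * Real.exp (Real.pi * |x.im| * |(m : ℝ)|) ≤ ‖2 * I * sin (Real.pi * (m * x))‖ := by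
  set y := Real.pi * |x.im| with hy
  have hy0 : 0 < y := mul_pos Real.pi_pos (abs_pos.2 hx)
  -- The constant comes from `2 sinh(y|m|) = e^(y|m|) (1 - e^(-2y|m|))` with `|m| ≥ 1`.
  refine ⟨1 - Real.exp (-(2 * y)), by simpa using hy0, fun m hm => ?_⟩
  have h1 := sinh_abs_im_le_norm_sin (Real.pi * (m * x))
  have h2 : |(Real.pi * (m * x) : ℂ).im| = y * |(m : ℝ)| := by
    simp [abs_mul, abs_of_pos Real.pi_pos, hy]
    ring
  have hm1 : (1 : ℝ) ≤ |(m : ℝ)| := by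
    have := Int.one_le_abs hm
    exact_mod_cast this
  rw [h2, Real.sinh_eq] at h1
  have h3 : Real.exp (-(y * |(m : ℝ)|)) ≤
      Real.exp (-(2 * y)) * Real.exp (y * |(m : ℝ)|) := by
    rw [← Real.exp_add]
    apply Real.exp_le_exp.2
    nlinarith
  simp only [norm_mul, norm_I, Complex.norm_ofNat, mul_one]
  nlinarith

/-- One factor supplies the decay; every other factor is only bounded below by a positive constant.
The empty product would not decay. -/
theorem exists_norm_prod_sin_inv_le {ι : Type*} (s : Finset ι) (hs : s.Nonempty) (x : ι → ℂ)
    (hx : ∀ i ∈ s, (x i).im ≠ 0) :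
    ∃ K δ : ℝ, 0 < K ∧ 0 < δ ∧ ∀ m : ℤ, m ≠ 0 →
      ‖(∏ i ∈ s, 2 * I * sin (Real.pi * (m * x i)))⁻¹‖ ≤ K * Real.exp (-δ * |(m : ℝ)|) := by
  classical
  induction hs using Finset.Nonempty.cons_induction with
  | singleton a =>
    obtain ⟨c, hc, h⟩ := exists_exp_le_norm_sin (hx a (Finset.mem_singleton_self a))
    refine ⟨c⁻¹, Real.pi * |(x a).im|, inv_pos.2 hc,
      mul_pos Real.pi_pos (abs_pos.2 (hx a (Finset.mem_singleton_self a))), fun m hm => ?_⟩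
    rw [Finset.prod_singleton, norm_inv, neg_mul, Real.exp_neg, ← mul_inv]
    exact inv_anti₀ (by positivity) (h m hm)
  | cons a s ha hs ih =>
    obtain ⟨K, δ, hK, hδ, ih⟩ := ih fun i hi => hx i (Finset.mem_cons_of_mem hi)
    obtain ⟨c, hc, h⟩ := exists_exp_le_norm_sin (hx a (Finset.mem_cons_self a s))
    refine ⟨c⁻¹ * K, δ, by positivity, hδ, fun m hm => ?_⟩
    rw [Finset.prod_cons, mul_inv, norm_mul, mul_assoc c⁻¹]
    refine mul_le_mul ?_ (ih m hm) (norm_nonneg _) (by positivity)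
    rw [norm_inv]
    refine inv_anti₀ hc ((le_mul_of_one_le_right hc.le ?_).trans (h m hm))
    exact Real.one_le_exp (by positivity)

/-! ### The root of unity `e (1 / 2N)` -/

/-- The primitive `2N`-th root of unity `exp (π i / N)`. -/
noncomputable def eta (N : ℕ) : ℂ := exp (Real.pi * I / N)

theorem eta_pow (N l : ℕ) : eta N ^ l = exp ((Real.pi * l / N : ℝ) * I) := by
  rw [eta, ← exp_nat_mul]
  congr 1
  push_cast
  ring

theorem norm_eta_pow (N l : ℕ) : ‖eta N ^ l‖ = 1 := by
  rw [eta_pow, norm_exp_ofReal_mul_I]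

theorem norm_eta (N : ℕ) : ‖eta N‖ = 1 := by simpa using norm_eta_pow N 1

theorem eta_ne_zero (N : ℕ) : eta N ≠ 0 := exp_ne_zero _

theorem eta_pow_im (N l : ℕ) : (eta N ^ l).im = Real.sin (Real.pi * l / N) := by
  rw [eta_pow, exp_ofReal_mul_I_im]

theorem eta_pow_self {N : ℕ} (hN : N ≠ 0) : eta N ^ N = -1 := by
  have : (N : ℝ) ≠ 0 := by exact_mod_cast hN
  rw [eta_pow, mul_div_assoc, div_self this, mul_one, exp_pi_mul_I]

theorem isPrimitiveRoot_eta {N : ℕ} (hN : N ≠ 0) : IsPrimitiveRoot (eta N) (2 * N) := by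
  have h := isPrimitiveRoot_exp (2 * N) (by omega)
  have e : eta N = exp (2 * Real.pi * I / ((2 * N : ℕ) : ℂ)) := by
    rw [eta]
    congr 1
    have : (N : ℂ) ≠ 0 := by exact_mod_cast hN
    push_cast
    field_simp
  rwa [e]

theorem eta_pow_im_pos {N l : ℕ} (h1 : 1 ≤ l) (h2 : l < N) : 0 < (eta N ^ l).im := by
  have hN : (0 : ℝ) < N := by exact_mod_cast (by omega : 0 < N)
  have hl : (1 : ℝ) ≤ l := by exact_mod_cast h1
  have hl' : (l : ℝ) < N := by exact_mod_cast h2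
  rw [eta_pow_im]
  apply Real.sin_pos_of_pos_of_lt_pi
  · have := Real.pi_pos
    positivity
  · rw [mul_div_assoc]
    exact mul_lt_of_lt_one_right Real.pi_pos ((div_lt_one hN).2 hl')

theorem eta_ne_one {N : ℕ} (hN : N ≠ 0) : eta N ≠ 1 :=
  (isPrimitiveRoot_eta hN).ne_one (by omega)

theorem sum_eta_pow {N : ℕ} (hN : N ≠ 0) :
    ∑ l ∈ Finset.range N, eta N ^ l = 2 * (1 - eta N)⁻¹ := by
  have h := eta_ne_one hN
  have h1 : 1 - eta N ≠ 0 := sub_ne_zero.2 h.symm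
  rw [geom_sum_eq h, eta_pow_self hN, div_eq_iff (sub_ne_zero.2 h)]
  field_simp
  ring

theorem range_eq_cons_Icc {N : ℕ} (hN : N ≠ 0) (f : ℕ → ℂ) :
    ∏ l ∈ Finset.range N, f l = f 0 * ∏ l ∈ Finset.Icc 1 (N - 1), f l := by
  obtain ⟨M, rfl⟩ := Nat.exists_eq_succ_of_ne_zero hN
  rw [Finset.prod_range_succ', mul_comm]
  congr 1
  rw [Finset.range_eq_Ico, Finset.prod_Ico_add' f 0 M 1]
  congr 1

theorem one_sub_e_neg (z : ℂ) : 1 - e (-z) = e (-(z / 2)) * (2 * I * sin (Real.pi * z)) := by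
  have h1 : e (-z) = e (-(z / 2)) * e (-(z / 2)) := by
    rw [e, e, ← Complex.exp_add]
    congr 1
    ring
  have h2 : 2 * I * sin (Real.pi * z) = e (z / 2) - e (-(z / 2)) := by
    rw [Complex.sin, e, e, show (-(Real.pi * z) * I) = 2 * Real.pi * I * -(z / 2) by ring,
      show (Real.pi * z * I) = 2 * Real.pi * I * (z / 2) by ring]
    linear_combination (exp (2 * Real.pi * I * -(z / 2)) - exp (2 * Real.pi * I * (z / 2))) * I_mul_I
  have h3 : e (-(z / 2)) * e (z / 2) = 1 := by
    rw [e, e, ← Complex.exp_add]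
    simp
  rw [h2, h1, mul_sub, h3]

theorem e_add (x y : ℂ) : e (x + y) = e x * e y := by
  rw [e, e, e, ← Complex.exp_add, mul_add]

theorem e_sum {ι : Type*} (s : Finset ι) (f : ι → ℂ) : e (∑ i ∈ s, f i) = ∏ i ∈ s, e (f i) := by
  simp only [e, Finset.mul_sum, Complex.exp_sum]

theorem e_ne_zero (z : ℂ) : e z ≠ 0 := exp_ne_zero _

theorem norm_e (z : ℂ) : ‖e z‖ = Real.exp (-(2 * Real.pi * z.im)) := by
  rw [e, norm_exp]
  simp

theorem e_nat_mul (m : ℕ) (z : ℂ) : e (m * z) = e z ^ m := by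
  rw [e, e, ← exp_nat_mul]
  congr 1
  ring

theorem e_int_div_two (m : ℤ) : e (m / 2) = (-1) ^ m := by
  rw [e, ← exp_pi_mul_I, ← exp_int_mul]
  congr 1
  ring

/-- The coefficients `(-1)^m / ∏_{1 ≤ l < N} (2i sin (π m η^l))`. -/
noncomputable def coef (N : ℕ) (m : ℕ) : ℂ :=
  (-1) ^ m * (∏ l ∈ Finset.Icc 1 (N - 1), 2 * I * sin (Real.pi * (m * eta N ^ l)))⁻¹

/-- The geometric sum gives `w = 1/2 + ∑_{1 ≤ l < N} η^l / 2`, so `e(-mw)` is `(-1)^m` times exactly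
the exponential factors split off from the denominators. -/
theorem e_neg_div_prod_eq_coef {N : ℕ} (hN : N ≠ 0) (m : ℕ) :
    e (-(m * (1 - eta N)⁻¹)) / (∏ l ∈ Finset.Icc 1 (N - 1), (1 - e (-(m * eta N ^ l)))) =
      coef N m := by
  have hsum : (1 - eta N)⁻¹ = 1 / 2 + ∑ l ∈ Finset.Icc 1 (N - 1), eta N ^ l / 2 := by
    have h := sum_eta_pow hN
    obtain ⟨M, rfl⟩ := Nat.exists_eq_succ_of_ne_zero hN
    rw [Finset.sum_range_succ', pow_zero] at h
    rw [← Finset.sum_div]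
    have h2 : ∑ l ∈ Finset.Icc 1 (M + 1 - 1), eta (M + 1) ^ l =
        ∑ l ∈ Finset.range M, eta (M + 1) ^ (l + 1) := by
      rw [Finset.range_eq_Ico, Finset.sum_Ico_add' (fun l => eta (M + 1) ^ l) 0 M 1]
      congr 1
    rw [h2]
    simp only [Nat.succ_eq_add_one] at h
    linear_combination -(1 / 2) * h
  have hnum : e (-(m * (1 - eta N)⁻¹)) =
      (-1) ^ m * ∏ l ∈ Finset.Icc 1 (N - 1), e (-(m * eta N ^ l / 2)) := by
    rw [← e_sum, hsum, show (-(m * (1 / 2 + ∑ l ∈ Finset.Icc 1 (N - 1), eta N ^ l / 2)) : ℂ) =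
      ((-m : ℤ) : ℂ) / 2 + ∑ l ∈ Finset.Icc 1 (N - 1), -(m * eta N ^ l / 2) by
        rw [Finset.sum_neg_distrib, mul_add, Finset.mul_sum]
        push_cast
        simp only [mul_div_assoc]
        ring, e_add, e_int_div_two]
    congr 1
    simp [zpow_neg, ← inv_pow]
  have hne : ∏ l ∈ Finset.Icc 1 (N - 1), e (-(m * eta N ^ l / 2)) ≠ 0 :=
    Finset.prod_ne_zero_iff.2 fun l _ => e_ne_zero _
  simp only [one_sub_e_neg]
  rw [hnum, Finset.prod_mul_distrib, coef, mul_comm ((-1 : ℂ) ^ m), mul_div_mul_left _ _ hne,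
    div_eq_mul_inv]

theorem exists_norm_coef_le {N : ℕ} (hN : 2 ≤ N) :
    ∃ K δ : ℝ, 0 < K ∧ 0 < δ ∧ ∀ m : ℕ, m ≠ 0 → ‖coef N m‖ ≤ K * Real.exp (-δ * m) := by
  obtain ⟨K, δ, hK, hδ, h⟩ := exists_norm_prod_sin_inv_le (Finset.Icc 1 (N - 1))
    ⟨1, by simp; omega⟩ (fun l => eta N ^ l) fun l hl => by
      rw [Finset.mem_Icc] at hl
      exact (eta_pow_im_pos hl.1 (by omega)).ne'
  refine ⟨K, δ, hK, hδ, fun m hm => ?_⟩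
  have := h m (by exact_mod_cast hm)
  rw [coef, norm_mul, norm_pow, norm_neg, norm_one, one_pow, one_mul]
  simpa using this

theorem summable_pow_mul_of_norm_le_exp {f : ℕ → ℂ} {K δ : ℝ} (hδ : 0 < δ)
    (h : ∀ m : ℕ, m ≠ 0 → ‖f m‖ ≤ K * Real.exp (-δ * m)) (k : ℕ) :
    Summable fun m : ℕ => (m : ℝ) ^ k * ‖f m‖ := by
  refine (summable_nat_add_iff 1).1 ?_
  refine Summable.of_nonneg_of_le (fun m => by positivity) (fun m => ?_)
    ((summable_nat_add_iff 1).2 ((Real.summable_pow_mul_exp_neg_nat_mul k hδ).mul_left K))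
  have := h (m + 1) (by omega)
  calc _ ≤ (((m + 1 : ℕ) : ℝ)) ^ k * (K * Real.exp (-δ * (m + 1 : ℕ))) := by gcongr
    _ = _ := by ring

theorem summable_pow_mul_norm_coef {N : ℕ} (hN : 2 ≤ N) (k : ℕ) :
    Summable fun m : ℕ => (m : ℝ) ^ k * ‖coef N m‖ := by
  obtain ⟨K, δ, -, hδ, h⟩ := exists_norm_coef_le hN
  exact summable_pow_mul_of_norm_le_exp hδ h k

/-! ### Partial fractions -/

/-- The poles are removed one at a time: once the principal part at `p a` is subtracted, the
function is `o(1/(z - p a))` there, so the singularity is removable. -/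
theorem exists_holomorphic_add_principal_parts {ι : Type*} (S : Finset ι) (p r : ι → ℂ)
    (hp : Set.InjOn p S) {U : Set ℂ} (hU : IsOpen U) (hpU : ∀ i ∈ S, p i ∈ U) (F : ℂ → ℂ)
    (hF : DifferentiableOn ℂ F (U \ p '' S))
    (hr : ∀ i ∈ S, Tendsto (fun z => (z - p i) * F z) (𝓝[≠] (p i)) (𝓝 (r i))) :
    ∃ H : ℂ → ℂ, DifferentiableOn ℂ H U ∧
      ∀ z ∈ U, (∀ i ∈ S, z ≠ p i) → F z = H z + ∑ i ∈ S, r i / (z - p i) := by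
  classical
  induction S using Finset.induction_on generalizing F with
  | empty => exact ⟨F, by simpa using hF, fun z _ _ => by simp⟩
  | insert a S ha ih =>
    set f : ℂ → ℂ := fun z => F z - r a / (z - p a) with hf
    set L := limUnder (𝓝[≠] (p a)) f with hL
    have hclosed : IsClosed (p '' (S : Set ι)) := (S.finite_toSet.image p).isClosed
    have hpa : p a ∉ p '' (S : Set ι) := by
      rintro ⟨i, hi, h⟩
      have := hp (Finset.mem_insert_of_mem hi) (Finset.mem_insert_self a S) h
      exact ha (this ▸ hi)
    have hnhds : U \ p '' S ∈ 𝓝 (p a) :=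
      (hU.sdiff hclosed).mem_nhds ⟨hpU a (Finset.mem_insert_self a S), hpa⟩
    have hfd : DifferentiableOn ℂ f ((U \ p '' S) \ {p a}) := by
      refine DifferentiableOn.sub (hF.mono ?_) ?_
      · rintro z ⟨⟨h1, h2⟩, h3⟩
        refine ⟨h1, ?_⟩
        rw [Finset.coe_insert, Set.image_insert_eq]
        exact fun h => h.elim h3 h2
      · refine (differentiableOn_const _).div (differentiableOn_id.sub (differentiableOn_const _)) ?_
        rintro z ⟨_, h3⟩
        exact sub_ne_zero.2 h3
    have hlim : Tendsto (fun z => z - p a) (𝓝[≠] (p a)) (𝓝 0) := by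
      have : Tendsto (fun z => z - p a) (𝓝 (p a)) (𝓝 (p a - p a)) :=
        (continuous_id.sub continuous_const).tendsto _
      rw [sub_self] at this
      exact this.mono_left nhdsWithin_le_nhds
    -- The value `f (p a)` is meaningless but harmless, since it gets multiplied by `z - p a → 0`.
    have ho : (fun z => f z - f (p a)) =o[𝓝[≠] (p a)] fun z => (z - p a)⁻¹ := by
      rw [Asymptotics.isLittleO_iff_tendsto']
      · have h1 := ((hr a (Finset.mem_insert_self a S)).sub_const (r a)).sub
          (hlim.mul_const (f (p a)))
        rw [sub_self, zero_mul, sub_zero] at h1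
        refine h1.congr' ?_
        filter_upwards [self_mem_nhdsWithin] with z hz
        have : z - p a ≠ 0 := sub_ne_zero.2 hz
        simp only [hf]
        field_simp
      · filter_upwards [self_mem_nhdsWithin] with z hz h
        exact absurd (inv_eq_zero.1 h) (sub_ne_zero.2 hz)
    have hd := differentiableOn_update_limUnder_of_isLittleO hnhds hfd ho
    obtain ⟨H, hH, hH2⟩ := ih (hp.mono (by simp)) (fun i hi => hpU i (Finset.mem_insert_of_mem hi))
      _ hd (fun i hi => by
        have hne : p i ≠ p a := fun h => hpa ⟨i, hi, h⟩
        have h1 := hr i (Finset.mem_insert_of_mem hi)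
        have h2 : Tendsto (fun z => (z - p i) * (r a / (z - p a))) (𝓝[≠] (p i)) (𝓝 0) := by
          have : ContinuousAt (fun z => (z - p i) * (r a / (z - p a))) (p i) := by
            refine (continuousAt_id.sub continuousAt_const).mul
              (continuousAt_const.div (continuousAt_id.sub continuousAt_const) (sub_ne_zero.2 hne))
          have := this.tendsto
          rw [sub_self, zero_mul] at this
          exact this.mono_left nhdsWithin_le_nhds
        have h3 := h1.sub h2
        rw [sub_zero] at h3
        refine h3.congr' ?_
        have : ∀ᶠ z in 𝓝[≠] (p i), z ≠ p a :=
          nhdsWithin_le_nhds (isOpen_ne.mem_nhds hne)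
        filter_upwards [this] with z hz
        rw [Function.update_of_ne hz]
        simp only [hf]
        ring)
    refine ⟨H, hH, fun z hz hzp => ?_⟩
    have h1 := hH2 z hz fun i hi => hzp i (Finset.mem_insert_of_mem hi)
    rw [Function.update_of_ne (hzp a (Finset.mem_insert_self a S))] at h1
    rw [Finset.sum_insert ha]
    simp only [hf] at h1
    linear_combination h1

/-- The points `η^l (m + 1)`. -/
noncomputable def pole (N m l : ℕ) : ℂ := eta N ^ l * (m + 1)

theorem norm_pole (N m l : ℕ) : ‖pole N m l‖ = m + 1 := by
  rw [pole, norm_mul, norm_eta_pow, one_mul]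
  have : ((m : ℂ) + 1) = ((m + 1 : ℕ) : ℂ) := by push_cast; rfl
  rw [this, norm_natCast]
  push_cast
  rfl

theorem pole_ne_zero (N m l : ℕ) : pole N m l ≠ 0 := by
  rw [← norm_pos_iff, norm_pole]
  positivity

theorem pole_injOn {N : ℕ} (hN : N ≠ 0) (S : Finset ℕ) :
    Set.InjOn (fun i : ℕ × ℕ => pole N i.1 i.2) (S ×ˢ Finset.range (2 * N) : Finset (ℕ × ℕ)) := by
  rintro ⟨m, l⟩ h ⟨m', l'⟩ h' he
  simp only [Finset.coe_product, Set.mem_prod, Finset.mem_coe, Finset.mem_range] at h h' he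
  have h1 : m = m' := by
    have := congrArg norm he
    rw [norm_pole, norm_pole] at this
    exact_mod_cast add_right_cancel this
  subst h1
  have h2 : eta N ^ l = eta N ^ l' := by
    have : ((m : ℂ) + 1) ≠ 0 := by exact_mod_cast Nat.succ_ne_zero m
    exact mul_right_cancel₀ this he
  rw [(isPrimitiveRoot_eta hN).pow_inj h.2 h'.2 h2]

/-- `F` is holomorphic off the points `η^l (m + 1)`, has at most simple poles with residues `r m l`
there, and tends to zero along the circles `‖z‖ = n + 1 / 2`. -/
structure HasSimplePoles (N : ℕ) (F : ℂ → ℂ) (r : ℕ → ℕ → ℂ) : Prop where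
  differentiableAt : ∀ z, (∀ m, ∀ l < 2 * N, z ≠ pole N m l) → DifferentiableAt ℂ F z
  residue : ∀ m, ∀ l < 2 * N,
    Tendsto (fun z => (z - pole N m l) * F z) (𝓝[≠] (pole N m l)) (𝓝 (r m l))
  decay : ∃ ε : ℕ → ℝ, Tendsto ε atTop (𝓝 0) ∧
    ∀ (n : ℕ) (z : ℂ), ‖z‖ = n + 1 / 2 → ‖F z‖ ≤ ε n
  summable : ∀ l < 2 * N, Summable fun m => ‖r m l‖

/-- Controls the principal parts on `|z| = n + 1/2`: a pole of modulus `m + 1 ≤ n` is at distance at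
least `n - m - 1/2 ≥ 1/2`. Each term tends to `0` and is dominated by `2 R m`. -/
theorem tendsto_sum_div_sub_zero {R : ℕ → ℝ} (hR : Summable R) (hR0 : ∀ m, 0 ≤ R m) :
    Tendsto (fun n : ℕ => ∑ m ∈ Finset.range n, R m / (n - m - 1 / 2)) atTop (𝓝 0) := by
  have key : ∀ n m : ℕ, m < n → (1 / 2 : ℝ) ≤ n - m - 1 / 2 := fun n m h => by
    have : (m : ℝ) + 1 ≤ n := by exact_mod_cast h
    linarith
  have h := tendsto_tsum_of_dominated_convergence (𝓕 := atTop)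
    (f := fun n m : ℕ => if m < n then R m / ((n : ℝ) - m - 1 / 2) else 0) (g := fun _ => (0 : ℝ))
    (bound := fun m => 2 * R m) (hR.mul_left 2) (fun m => ?_) (Eventually.of_forall fun n m => ?_)
  · rw [tsum_zero] at h
    refine h.congr fun n => ?_
    rw [tsum_eq_sum (s := Finset.range n) (fun m hm => if_neg (by simpa using hm))]
    exact Finset.sum_congr rfl fun m hm => if_pos (Finset.mem_range.1 hm)
  · have h1 : Tendsto (fun n : ℕ => R m / ((n : ℝ) - m - 1 / 2)) atTop (𝓝 0) := by
      refine Tendsto.div_atTop tendsto_const_nhds ?_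
      have : Tendsto (fun n : ℕ => (n : ℝ) + (-m - 1 / 2)) atTop atTop :=
        tendsto_atTop_add_const_right _ _ tendsto_natCast_atTop_atTop
      exact this.congr fun n => by ring
    refine h1.congr' ?_
    filter_upwards [eventually_gt_atTop m] with n hn
    rw [if_pos hn]
  · split_ifs with hmn
    · have := key n m hmn
      rw [Real.norm_of_nonneg (div_nonneg (hR0 m) (by linarith)), div_le_iff₀ (by linarith)]
      nlinarith [hR0 m]
    · simpa using hR0 m

/-- Subtracting the principal parts at the poles of modulus at most `n` leaves a function
holomorphic on `|z| < n + 1`. It is small on `|z| = n + 1/2`, hence small at `z` by the maximum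
principle. -/
theorem HasSimplePoles.hasSum {N : ℕ} (hN : N ≠ 0) {F : ℂ → ℂ} {r : ℕ → ℕ → ℂ}
    (h : HasSimplePoles N F r) (z : ℂ) (hz : ∀ m, ∀ l < 2 * N, z ≠ pole N m l) :
    HasSum (fun m => ∑ l ∈ Finset.range (2 * N), r m l / (z - pole N m l)) (F z) := by
  set R : ℕ → ℝ := fun m => ∑ l ∈ Finset.range (2 * N), ‖r m l‖ with hR
  have hRs : Summable R := summable_sum fun l hl => h.summable l (Finset.mem_range.1 hl)
  have hR0 : ∀ m, 0 ≤ R m := fun m => Finset.sum_nonneg fun _ _ => norm_nonneg _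
  obtain ⟨ε, hε, hb⟩ := h.decay
  have hB := hε.add (tendsto_sum_div_sub_zero hRs hR0)
  rw [add_zero] at hB
  have hsumm : Summable fun m => ∑ l ∈ Finset.range (2 * N), r m l / (z - pole N m l) := by
    refine Summable.of_norm_bounded_eventually_nat hRs ?_
    obtain ⟨n₀, hn₀⟩ := exists_nat_ge ‖z‖
    filter_upwards [eventually_ge_atTop n₀] with m hm
    refine (norm_sum_le _ _).trans (Finset.sum_le_sum fun l _ => ?_)
    rw [norm_div]
    refine div_le_self (norm_nonneg _) ?_
    have h1 := norm_sub_norm_le (pole N m l) z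
    rw [norm_pole, norm_sub_rev] at h1
    have : (n₀ : ℝ) ≤ m := by exact_mod_cast hm
    linarith
  refine (hsumm.hasSum_iff_tendsto_nat).2 ?_
  rw [tendsto_iff_norm_sub_tendsto_zero]
  refine squeeze_zero' (Eventually.of_forall fun _ => norm_nonneg _) ?_ hB
  obtain ⟨n₀, hn₀⟩ := exists_nat_ge ‖z‖
  filter_upwards [eventually_ge_atTop n₀] with n hn
  have hzn : ‖z‖ ≤ n := hn₀.trans (by exact_mod_cast hn)
  have hout : ∀ w ∈ Metric.ball (0 : ℂ) (n + 1),
      (∀ i ∈ Finset.range n ×ˢ Finset.range (2 * N), w ≠ pole N i.1 i.2) →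
      ∀ m, ∀ l < 2 * N, w ≠ pole N m l := by
    intro w hw hw' m l hl
    by_cases hm : m < n
    · exact hw' (m, l) (by simp [hm, hl])
    · rintro rfl
      rw [mem_ball_zero_iff, norm_pole] at hw
      have : (n : ℝ) ≤ m := by exact_mod_cast not_lt.1 hm
      linarith
  obtain ⟨H, hH, hFH⟩ := exists_holomorphic_add_principal_parts
    (Finset.range n ×ˢ Finset.range (2 * N)) (fun i => pole N i.1 i.2) (fun i => r i.1 i.2)
    (pole_injOn hN _) (U := Metric.ball 0 (n + 1)) Metric.isOpen_ball
    (fun i hi => by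
      rw [mem_ball_zero_iff, norm_pole]
      rw [Finset.mem_product, Finset.mem_range] at hi
      have : (i.1 : ℝ) < n := by exact_mod_cast hi.1
      linarith) F
    (fun w hw => (h.differentiableAt w (hout w hw.1 fun i hi he =>
      hw.2 ⟨i, hi, he.symm⟩)).differentiableWithinAt)
    (fun i hi => h.residue i.1 i.2 (by
      rw [Finset.mem_product, Finset.mem_range, Finset.mem_range] at hi
      exact hi.2))
  have hn1 : (n : ℝ) + 1 / 2 ≠ 0 := by positivity
  have hbound : ∀ w ∈ frontier (Metric.ball (0 : ℂ) (n + 1 / 2)), ‖H w‖ ≤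
      ε n + ∑ m ∈ Finset.range n, R m / (n - m - 1 / 2) := by
    intro w hw
    rw [frontier_ball _ hn1, mem_sphere_zero_iff_norm] at hw
    have h1 := hFH w (by rw [mem_ball_zero_iff]; linarith) (fun i _ he => by
      rw [he, norm_pole] at hw
      have h3 : ((2 * i.1 + 1 : ℕ) : ℝ) = ((2 * n : ℕ) : ℝ) := by push_cast; linarith
      have : 2 * i.1 + 1 = 2 * n := by exact_mod_cast h3
      omega)
    rw [← sub_eq_iff_eq_add] at h1
    rw [← h1, Finset.sum_product]
    refine (norm_sub_le _ _).trans (add_le_add (hb n w hw) ?_)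
    refine (norm_sum_le _ _).trans (Finset.sum_le_sum fun m hm => ?_)
    rw [hR, Finset.sum_div]
    refine (norm_sum_le _ _).trans (Finset.sum_le_sum fun l _ => ?_)
    have hm' : (m : ℝ) + 1 ≤ n := by exact_mod_cast Finset.mem_range.1 hm
    rw [norm_div]
    refine div_le_div_of_nonneg_left (norm_nonneg _) (by linarith) ?_
    have h2 := norm_sub_norm_le w (pole N m l)
    rw [norm_pole, hw] at h2
    linarith
  have hHz := norm_le_of_forall_mem_frontier_norm_le Metric.isBounded_ball
    (DifferentiableOn.diffContOnCl (hH.mono (by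
      rw [closure_ball _ hn1]
      exact Metric.closedBall_subset_ball (by linarith)))) hbound (z := z) (by
        rw [closure_ball _ hn1, mem_closedBall_zero_iff]
        linarith)
  have h1 := hFH z (by rw [mem_ball_zero_iff]; linarith) (fun i hi => hz i.1 i.2 (by
      rw [Finset.mem_product, Finset.mem_range, Finset.mem_range] at hi
      exact hi.2))
  rw [Finset.sum_product] at h1
  rw [h1, norm_sub_rev, add_sub_cancel_right]
  exact hHz

theorem HasSimplePoles.hasSum_zero {N : ℕ} (hN : N ≠ 0) {F : ℂ → ℂ} {r : ℕ → ℕ → ℂ}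
    (h : HasSimplePoles N F r) :
    HasSum (fun m => ∑ l ∈ Finset.range (2 * N), r m l / pole N m l) (-F 0) := by
  have := (h.hasSum hN 0 fun m l _ => (pole_ne_zero N m l).symm).neg
  simpa [div_neg, neg_neg] using this

theorem isOpen_compl_poles {N : ℕ} : IsOpen {z : ℂ | ∀ m, ∀ l < 2 * N, z ≠ pole N m l} := by
  rw [isOpen_iff_mem_nhds]
  intro z hz
  obtain ⟨n, hn⟩ := exists_nat_gt ‖z‖
  have h1 : (⋂ i ∈ Finset.range n ×ˢ Finset.range (2 * N), {w : ℂ | w ≠ pole N i.1 i.2}) ∈ 𝓝 z := by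
    refine (Filter.biInter_finset_mem _).2 fun i hi => isOpen_ne.mem_nhds (hz _ _ ?_)
    rw [Finset.mem_product, Finset.mem_range, Finset.mem_range] at hi
    exact hi.2
  have h2 : Metric.ball (0 : ℂ) n ∈ 𝓝 z :=
    Metric.isOpen_ball.mem_nhds (by rwa [mem_ball_zero_iff])
  filter_upwards [h1, h2] with w hw1 hw2 m l hl
  by_cases hm : m < n
  · rw [Set.mem_iInter₂] at hw1
    exact hw1 (m, l) (by simp [hm, hl])
  · rintro rfl
    rw [mem_ball_zero_iff, norm_pole] at hw2
    have : (n : ℝ) ≤ m := by exact_mod_cast not_lt.1 hm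
    linarith

/-- The quotient `(F(z) - F(0))/z` is regular at `0`, and division by `z` divides each residue by
its pole. Iterated `j` times and evaluated at `0`, it extracts the `j`-th Taylor coefficient. -/
theorem HasSimplePoles.dslope {N : ℕ} {F : ℂ → ℂ} {r : ℕ → ℕ → ℂ} (h : HasSimplePoles N F r) :
    HasSimplePoles N (dslope F 0) (fun m l => r m l / pole N m l) where
  differentiableAt z hz := by
    set U := {z : ℂ | ∀ m, ∀ l < 2 * N, z ≠ pole N m l} with hU
    have h0 : U ∈ 𝓝 (0 : ℂ) :=
      isOpen_compl_poles.mem_nhds fun m l _ => (pole_ne_zero N m l).symm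
    have hd : DifferentiableOn ℂ F U := fun w hw => (h.differentiableAt w hw).differentiableWithinAt
    exact ((differentiableOn_dslope h0).2 hd).differentiableAt (isOpen_compl_poles.mem_nhds hz)
  residue m l hl := by
    have hp := pole_ne_zero N m l
    have h1 := h.residue m l hl
    have h2 : Tendsto (fun z => (z - pole N m l) * F 0) (𝓝[≠] (pole N m l)) (𝓝 0) := by
      have : ContinuousAt (fun z => (z - pole N m l) * F 0) (pole N m l) :=
        (continuousAt_id.sub continuousAt_const).mul continuousAt_const
      have := this.tendsto
      rw [sub_self, zero_mul] at this
      exact this.mono_left nhdsWithin_le_nhds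
    have h3 : Tendsto (fun z : ℂ => z) (𝓝[≠] (pole N m l)) (𝓝 (pole N m l)) :=
      tendsto_id.mono_left nhdsWithin_le_nhds
    have h4 := (h1.sub h2).div h3 hp
    rw [sub_zero] at h4
    refine h4.congr' ?_
    have : ∀ᶠ z in 𝓝[≠] (pole N m l), z ≠ 0 := nhdsWithin_le_nhds (isOpen_ne.mem_nhds hp)
    filter_upwards [this] with z hz
    rw [dslope_of_ne _ hz, slope_def_field]
    simp only [Pi.div_apply, sub_zero]
    ring
  decay := by
    obtain ⟨ε, hε, hb⟩ := h.decay
    refine ⟨fun n => (ε n + ‖F 0‖) / (n + 1 / 2), ?_, fun n z hz => ?_⟩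
    · refine (hε.add_const ‖F 0‖).div_atTop ?_
      exact tendsto_atTop_add_const_right _ _ tendsto_natCast_atTop_atTop
    · have hz0 : z ≠ 0 := by
        rw [← norm_pos_iff, hz]
        positivity
      rw [dslope_of_ne _ hz0, slope_def_field, norm_div, sub_zero, hz]
      exact div_le_div_of_nonneg_right
        ((norm_sub_le _ _).trans (add_le_add (hb n z hz) le_rfl)) (by positivity)
  summable l hl := by
    refine Summable.of_nonneg_of_le (fun m => norm_nonneg _) (fun m => ?_) (h.summable l hl)
    rw [norm_div, norm_pole]
    exact div_le_self (norm_nonneg _) (by linarith [Nat.cast_nonneg (α := ℝ) m])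

theorem HasSimplePoles.pow_mul {N : ℕ} {F : ℂ → ℂ} {r : ℕ → ℕ → ℂ} (h : HasSimplePoles N F r)
    (j : ℕ)
    (hdecay : ∃ ε : ℕ → ℝ, Tendsto ε atTop (𝓝 0) ∧
      ∀ (n : ℕ) (z : ℂ), ‖z‖ = n + 1 / 2 → ‖z‖ ^ j * ‖F z‖ ≤ ε n)
    (hsumm : ∀ l < 2 * N, Summable fun m : ℕ => (m + 1 : ℝ) ^ j * ‖r m l‖) :
    HasSimplePoles N (fun z => z ^ j * F z) (fun m l => pole N m l ^ j * r m l) where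
  differentiableAt z hz := (differentiableAt_id.pow j).mul (h.differentiableAt z hz)
  residue m l hl := by
    have h3 : Tendsto (fun z : ℂ => z ^ j) (𝓝[≠] (pole N m l)) (𝓝 (pole N m l ^ j)) :=
      ((continuous_pow j).tendsto _).mono_left nhdsWithin_le_nhds
    exact (h3.mul (h.residue m l hl)).congr fun z => by ring
  decay := by
    obtain ⟨ε, hε, hb⟩ := hdecay
    exact ⟨ε, hε, fun n z hz => by simpa using hb n z hz⟩
  summable l hl := by
    simpa [norm_pole] using hsumm l hl

/-! ### The generating function -/

/-- The entire function `2i sin (π x z) / z` of `z`. -/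
noncomputable def sineQuotient (x z : ℂ) : ℂ :=
  2 * Real.pi * I * x * dslope sin 0 (Real.pi * x * z)

theorem sineQuotient_of_ne {x z : ℂ} (hx : x ≠ 0) (hz : z ≠ 0) :
    sineQuotient x z = 2 * I * sin (Real.pi * (z * x)) / z := by
  have hpi : (Real.pi : ℂ) ≠ 0 := by exact_mod_cast Real.pi_ne_zero
  rw [sineQuotient, dslope_of_ne _ (by simp [hx, hz, Real.pi_ne_zero]), slope_def_field, sin_zero,
    sub_zero, sub_zero, mul_assoc (Real.pi : ℂ) x z, mul_comm x z]
  field_simp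

theorem sineQuotient_zero (x : ℂ) : sineQuotient x 0 = 2 * Real.pi * I * x := by
  simp [sineQuotient]

theorem differentiable_dslope_sin : Differentiable ℂ (dslope sin 0) := by
  rw [← differentiableOn_univ]
  exact (differentiableOn_dslope Filter.univ_mem).2 differentiable_sin.differentiableOn

theorem differentiable_sineQuotient (x : ℂ) : Differentiable ℂ (sineQuotient x) :=
  (differentiable_dslope_sin.comp (differentiable_id.const_mul _)).const_mul _

theorem dslope_sin_neg (z : ℂ) : dslope sin 0 (-z) = dslope sin 0 z := by
  rcases eq_or_ne z 0 with rfl | hz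
  · simp
  · rw [dslope_of_ne _ hz, dslope_of_ne _ (neg_ne_zero.2 hz), slope_def_field, slope_def_field]
    simp [neg_div_neg_eq]

/-- The function `∏_{l < N} z / (2i sin (π z η^l))`, which generates the coefficients. -/
noncomputable def gen (N : ℕ) (z : ℂ) : ℂ :=
  ∏ l ∈ Finset.range N, (sineQuotient (eta N ^ l) z)⁻¹

theorem gen_of_ne (N : ℕ) {z : ℂ} (hz : z ≠ 0) :
    gen N z = ∏ l ∈ Finset.range N, z / (2 * I * sin (Real.pi * (z * eta N ^ l))) := by
  refine Finset.prod_congr rfl fun l _ => ?_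
  rw [sineQuotient_of_ne (pow_ne_zero l (eta_ne_zero N)) hz, inv_div]

theorem gen_zero (N : ℕ) : gen N 0 = ∏ l ∈ Finset.range N, (2 * Real.pi * I * eta N ^ l)⁻¹ := by
  simp [gen, sineQuotient_zero]

/-- Multiplying `z` by `η` shifts the index `l` by one. The wrap-around `η^N = -1` costs one sign,
and the `N` factors `η` pulled out of the product cost another. -/
theorem gen_eta_mul {N : ℕ} (hN : N ≠ 0) (z : ℂ) : gen N (eta N * z) = gen N z := by
  have hη := eta_ne_zero N
  have h1 : ∀ l, sineQuotient (eta N ^ l) (eta N * z) =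
      (eta N)⁻¹ * sineQuotient (eta N ^ (l + 1)) z := fun l => by
    rw [sineQuotient, sineQuotient, show (Real.pi * eta N ^ l * (eta N * z) : ℂ) =
      Real.pi * eta N ^ (l + 1) * z by ring, pow_succ]
    field_simp
  have h2 : sineQuotient (eta N ^ N) z = -sineQuotient (eta N ^ 0) z := by
    rw [eta_pow_self hN, sineQuotient, sineQuotient, pow_zero,
      show (Real.pi * -1 * z : ℂ) = -(Real.pi * 1 * z) by ring, dslope_sin_neg]
    ring
  have h3 : ∏ l ∈ Finset.range N, (sineQuotient (eta N ^ (l + 1)) z)⁻¹ =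
      -∏ l ∈ Finset.range N, (sineQuotient (eta N ^ l) z)⁻¹ := by
    obtain ⟨M, rfl⟩ := Nat.exists_eq_succ_of_ne_zero hN
    rw [Finset.prod_range_succ, Finset.prod_range_succ', h2, inv_neg, mul_neg]
  simp only [gen, h1, mul_inv, inv_inv, Finset.prod_mul_distrib, Finset.prod_const,
    Finset.card_range]
  rw [h3, eta_pow_self hN]
  ring

theorem gen_eta_pow_mul {N : ℕ} (hN : N ≠ 0) (l : ℕ) (z : ℂ) :
    gen N (eta N ^ l * z) = gen N z := by
  induction l with
  | zero => simp
  | succ l ih => rw [pow_succ', mul_assoc, gen_eta_mul hN, ih]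

theorem eta_pow_mul_eq_pole {N : ℕ} (hN : N ≠ 0) (a m : ℕ) :
    eta N ^ a * (m + 1) = pole N m (a % (2 * N)) := by
  rw [pole]
  conv_lhs => rw [← Nat.div_add_mod a (2 * N), pow_add, pow_mul,
      (isPrimitiveRoot_eta hN).pow_eq_one, one_pow, one_mul]

theorem sineQuotient_ne_zero {N : ℕ} {z : ℂ} (hz : ∀ m, ∀ l < 2 * N, z ≠ pole N m l)
    {l : ℕ} (hl : l < N) : sineQuotient (eta N ^ l) z ≠ 0 := by
  have hN : N ≠ 0 := by omega
  have hpi : (Real.pi : ℂ) ≠ 0 := by exact_mod_cast Real.pi_ne_zero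
  have hη := pow_ne_zero l (eta_ne_zero N)
  rcases eq_or_ne z 0 with rfl | hz0
  · rw [sineQuotient_zero]
    simp [Real.pi_ne_zero, hη]
  rw [sineQuotient_of_ne hη hz0]
  refine div_ne_zero (mul_ne_zero (mul_ne_zero two_ne_zero I_ne_zero) ?_) hz0
  intro hs
  obtain ⟨k, hk⟩ := Complex.sin_eq_zero_iff.1 hs
  have hk' : z * eta N ^ l = k := by
    rw [mul_comm (k : ℂ)] at hk
    exact mul_left_cancel₀ hpi hk
  have hk0 : k ≠ 0 := by
    rintro rfl
    rw [Int.cast_zero] at hk'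
    exact (mul_ne_zero hz0 hη) hk'
  obtain ⟨m, rfl | rfl⟩ : ∃ m : ℕ, k = m + 1 ∨ k = -(m + 1) := by
    rcases lt_or_gt_of_ne hk0 with h | h
    · exact ⟨(-k - 1).toNat, Or.inr (by omega)⟩
    · exact ⟨(k - 1).toNat, Or.inl (by omega)⟩
  -- If `zη^l = m + 1` then `z = η^(2N-l) (m + 1)`; in the negative case `-1 = η^N` gives the
  -- exponent `N - l`.
  · refine hz m ((2 * N - l) % (2 * N)) (Nat.mod_lt _ (by omega)) ?_
    rw [← eta_pow_mul_eq_pole hN]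
    apply mul_right_cancel₀ hη
    rw [hk', mul_right_comm, ← pow_add, Nat.sub_add_cancel (by omega),
      (isPrimitiveRoot_eta hN).pow_eq_one]
    push_cast
    ring
  · refine hz m ((N - l) % (2 * N)) (Nat.mod_lt _ (by omega)) ?_
    rw [← eta_pow_mul_eq_pole hN]
    apply mul_right_cancel₀ hη
    rw [hk', mul_right_comm, ← pow_add, Nat.sub_add_cancel hl.le, eta_pow_self hN]
    push_cast
    ring

theorem differentiableAt_gen {N : ℕ} {z : ℂ} (hz : ∀ m, ∀ l < 2 * N, z ≠ pole N m l) :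
    DifferentiableAt ℂ (gen N) z := by
  refine DifferentiableAt.fun_finsetProd fun l hl => ?_
  exact ((differentiable_sineQuotient _).differentiableAt).inv
    (sineQuotient_ne_zero hz (Finset.mem_range.1 hl))

/-- Only the factor `l = 0` is singular at `m + 1`, because `η^l` is non-real for `0 < l < N`. Its
sign `cos(π(m+1))` is the sign built into `coef`. -/
theorem tendsto_sub_mul_gen_nat {N : ℕ} (hN : N ≠ 0) (m : ℕ) :
    Tendsto (fun z => (z - (m + 1)) * gen N z) (𝓝[≠] ((m : ℂ) + 1))
      (𝓝 ((m + 1) ^ N * coef N (m + 1) / (2 * Real.pi * I))) := by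
  have hpi : (Real.pi : ℂ) ≠ 0 := by exact_mod_cast Real.pi_ne_zero
  set n : ℂ := (m : ℂ) + 1 with hn
  have hnc : n = ((m + 1 : ℕ) : ℂ) := by rw [hn]; push_cast; rfl
  have hn0 : n ≠ 0 := by rw [hnc]; exact_mod_cast Nat.succ_ne_zero m
  have hcos : cos (Real.pi * n) = (-1) ^ (m + 1) := by
    rw [hnc, mul_comm]
    exact_mod_cast congrArg ((↑) : ℝ → ℂ) (Real.cos_nat_mul_pi (m + 1))
  have hsin : sin (Real.pi * n) = 0 := by
    rw [hnc, mul_comm]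
    exact Complex.sin_nat_mul_pi (m + 1)
  have hd : HasDerivAt (fun z : ℂ => sin (Real.pi * z)) ((-1) ^ (m + 1) * Real.pi) n := by
    have := ((hasDerivAt_id n).const_mul (Real.pi : ℂ)).csin
    simpa [hcos] using this
  have h1 : Tendsto (fun z => (z - n) / sin (Real.pi * z)) (𝓝[≠] n)
      (𝓝 ((-1) ^ (m + 1) * Real.pi)⁻¹) := by
    have h2 := hd.tendsto_slope.inv₀ (mul_ne_zero (pow_ne_zero _ (by norm_num)) hpi)
    refine h2.congr fun z => ?_
    rw [slope_def_field, hsin, sub_zero, inv_div]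
  have h2 : Tendsto (fun z : ℂ => z / (2 * I) * ∏ l ∈ Finset.Icc 1 (N - 1),
      z / (2 * I * sin (Real.pi * (z * eta N ^ l)))) (𝓝[≠] n)
      (𝓝 (n / (2 * I) * ∏ l ∈ Finset.Icc 1 (N - 1),
      n / (2 * I * sin (Real.pi * (n * eta N ^ l))))) := by
    refine Tendsto.mono_left ?_ nhdsWithin_le_nhds
    refine (tendsto_id.div_const _).mul (tendsto_finsetProd _ fun l hl => ?_)
    rw [Finset.mem_Icc] at hl
    refine tendsto_id.div ?_ ?_
    · have : Continuous fun z : ℂ => 2 * I * sin (Real.pi * (z * eta N ^ l)) := by fun_prop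
      exact this.tendsto n
    · refine mul_ne_zero (mul_ne_zero two_ne_zero I_ne_zero) ?_
      rw [← norm_pos_iff]
      refine lt_of_lt_of_le (Real.sinh_pos_iff.2 ?_) (sinh_abs_im_le_norm_sin _)
      rw [abs_pos, hnc]
      have h3 := (eta_pow_im_pos hl.1 (by omega : l < N)).ne'
      simpa [Real.pi_ne_zero, h3] using (by exact_mod_cast Nat.succ_ne_zero m : ((m : ℝ) + 1) ≠ 0)
  have h3 := h1.mul h2
  have hval : (n ^ N * coef N (m + 1) / (2 * Real.pi * I)) = ((-1) ^ (m + 1) * (Real.pi : ℂ))⁻¹ *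
      (n / (2 * I) * ∏ l ∈ Finset.Icc 1 (N - 1), n / (2 * I * sin (Real.pi * (n * eta N ^ l)))) := by
    have hs : ((-1 : ℂ) ^ (m + 1))⁻¹ = (-1) ^ (m + 1) := by rw [← inv_pow]; norm_num
    obtain ⟨M, rfl⟩ := Nat.exists_eq_succ_of_ne_zero hN
    rw [coef, ← hnc, Finset.prod_div_distrib, Finset.prod_const, Nat.card_Icc, mul_inv, hs]
    simp only [Nat.succ_eq_add_one, Nat.add_sub_cancel, pow_succ n, div_eq_mul_inv, mul_inv]
    ring
  rw [hval]
  refine h3.congr' ?_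
  have : ∀ᶠ z in 𝓝[≠] n, z ≠ 0 := nhdsWithin_le_nhds (isOpen_ne.mem_nhds hn0)
  filter_upwards [this] with z hz
  rw [gen_of_ne N hz, range_eq_cons_Icc hN, pow_zero, mul_one]
  simp only [div_eq_mul_inv, mul_inv]
  ring

/-- Transported from `m + 1` by the invariance of `gen N`; the factor `η^l` is the derivative of the
rotation. -/
theorem tendsto_sub_mul_gen {N : ℕ} (hN : N ≠ 0) (m l : ℕ) :
    Tendsto (fun z => (z - pole N m l) * gen N z) (𝓝[≠] (pole N m l))
      (𝓝 (eta N ^ l * ((m + 1) ^ N * coef N (m + 1) / (2 * Real.pi * I)))) := by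
  have hη := pow_ne_zero l (eta_ne_zero N)
  have h1 : Tendsto (fun z => (eta N ^ l)⁻¹ * z) (𝓝[≠] (pole N m l)) (𝓝[≠] ((m : ℂ) + 1)) := by
    refine tendsto_nhdsWithin_iff.2 ⟨?_, ?_⟩
    · refine Tendsto.mono_left ?_ nhdsWithin_le_nhds
      have : Tendsto (fun z => (eta N ^ l)⁻¹ * z) (𝓝 (pole N m l))
          (𝓝 ((eta N ^ l)⁻¹ * pole N m l)) := (continuous_const.mul continuous_id).tendsto _
      rwa [pole, inv_mul_cancel_left₀ hη] at this
    · filter_upwards [self_mem_nhdsWithin] with z hz h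
      refine hz ?_
      rw [Set.mem_singleton_iff, pole, ← Set.mem_singleton_iff.1 h, mul_inv_cancel_left₀ hη]
  refine (((tendsto_sub_mul_gen_nat hN m).comp h1).const_mul (eta N ^ l)).congr fun z => ?_
  have h2 : gen N ((eta N ^ l)⁻¹ * z) = gen N z := by
    rw [← gen_eta_pow_mul hN l, mul_inv_cancel_left₀ hη]
  simp only [Function.comp, h2, pole]
  field_simp

/-- Every `zη^l` has modulus `n + 1/2`, so it stays at distance at least `1/2` from the integers and
the sine bound applies. The exponent uses only `l = 0, 1`: the imaginary parts of `z` and `zη`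
cannot both be small compared with `|z|`. -/
theorem norm_gen_le {N : ℕ} (hN : 2 ≤ N) (n : ℕ) {z : ℂ} (hz : ‖z‖ = n + 1 / 2) :
    ‖gen N z‖ ≤ 2 ^ N * (‖z‖ ^ N * Real.exp (-(Real.pi * ((eta N).im / 2) * ‖z‖))) := by
  have hz0 : z ≠ 0 := by
    rw [← norm_pos_iff, hz]
    positivity
  have hs : 0 < (eta N).im := by simpa using eta_pow_im_pos (N := N) (l := 1) le_rfl (by omega)
  have hnorm : |(eta N).re| ≤ 1 := by
    rw [← norm_eta N]
    exact abs_re_le_norm _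
  have hs1 : (eta N).im ≤ 1 := by
    rw [← norm_eta N]
    exact (le_abs_self _).trans (abs_im_le_norm _)
  have h1 : ∀ l, Real.exp (Real.pi * |(z * eta N ^ l).im|) / 2 ≤
      ‖2 * I * sin (Real.pi * (z * eta N ^ l))‖ := fun l => by
    have := exp_abs_im_le_norm_sin_pi (z := z * eta N ^ l) fun m => by
      have h2 := abs_norm_sub_norm_le (z * eta N ^ l) m
      rw [norm_mul, norm_eta_pow, mul_one, hz, norm_intCast] at h2
      refine le_trans ?_ h2
      have h3 : (1 : ℤ) ≤ |(2 * n + 1 - 2 * |m| : ℤ)| := Int.one_le_abs (by omega)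
      have h4 : (1 : ℝ) ≤ |(2 * n + 1 - 2 * abs (m : ℝ) : ℝ)| := by exact_mod_cast h3
      have h5 : (2 * n + 1 - 2 * abs (m : ℝ) : ℝ) = 2 * (n + 1 / 2 - abs (m : ℝ)) := by ring
      rw [h5, abs_mul, abs_two] at h4
      linarith
    simp only [norm_mul, norm_I, Complex.norm_ofNat, mul_one]
    linarith
  have h2 : (eta N).im / 2 * ‖z‖ ≤ ∑ l ∈ Finset.range N, |(z * eta N ^ l).im| := by
    have h3 : ∑ l ∈ Finset.range 2, |(z * eta N ^ l).im| ≤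
        ∑ l ∈ Finset.range N, |(z * eta N ^ l).im| :=
      Finset.sum_le_sum_of_subset_of_nonneg (Finset.range_mono hN) fun _ _ _ => abs_nonneg _
    refine le_trans ?_ h3
    rw [Finset.sum_range_succ, Finset.sum_range_one, pow_zero, mul_one, pow_one, mul_im]
    have h4 := norm_le_abs_re_add_abs_im z
    have h5 : |z.re| * (eta N).im ≤ |z.re * (eta N).im + z.im * (eta N).re| + |z.im| := by
      calc |z.re| * (eta N).im = |z.re * (eta N).im| := by rw [abs_mul, abs_of_pos hs]
        _ = |(z.re * (eta N).im + z.im * (eta N).re) - z.im * (eta N).re| := by ring_nf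
        _ ≤ |z.re * (eta N).im + z.im * (eta N).re| + |z.im * (eta N).re| := abs_sub _ _
        _ ≤ _ := by
          rw [abs_mul z.im]
          gcongr
          exact mul_le_of_le_one_right (abs_nonneg _) hnorm
    have h6 : ‖z‖ * (eta N).im ≤ (|z.re| + |z.im|) * (eta N).im := by gcongr
    have h7 : |z.im| * (eta N).im ≤ |z.im| := mul_le_of_le_one_right (abs_nonneg _) hs1
    have h8 := abs_nonneg (z.re * (eta N).im + z.im * (eta N).re)
    linarith
  have h3 : ∀ l, ‖z / (2 * I * sin (Real.pi * (z * eta N ^ l)))‖ ≤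
      ‖z‖ * (2 * Real.exp (-(Real.pi * |(z * eta N ^ l).im|))) := fun l => by
    rw [norm_div, div_eq_mul_inv]
    gcongr
    refine (inv_anti₀ (by positivity) (h1 l)).trans (le_of_eq ?_)
    rw [Real.exp_neg, inv_div, div_eq_mul_inv]
  rw [gen_of_ne N hz0, norm_prod]
  refine (Finset.prod_le_prod (fun _ _ => norm_nonneg _) fun l _ => h3 l).trans ?_
  rw [Finset.prod_mul_distrib, Finset.prod_mul_distrib, Finset.prod_const, Finset.prod_const,
    Finset.card_range, ← Real.exp_sum, Finset.sum_neg_distrib, ← Finset.mul_sum]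
  rw [mul_left_comm]
  refine mul_le_mul_of_nonneg_left (mul_le_mul_of_nonneg_left (Real.exp_le_exp.2 ?_) (by positivity))
    (by positivity)
  rw [mul_assoc]
  exact neg_le_neg (mul_le_mul_of_nonneg_left h2 Real.pi_pos.le)

theorem tendsto_pow_mul_exp_neg_half_integer (j : ℕ) {δ : ℝ} (hδ : 0 < δ) :
    Tendsto (fun n : ℕ => ((n : ℝ) + 1 / 2) ^ j * Real.exp (-(δ * (n + 1 / 2)))) atTop (𝓝 0) := by
  have h1 : Tendsto (fun x : ℝ => x ^ j * Real.exp (-(δ * x))) atTop (𝓝 0) := by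
    have h2 := (Real.tendsto_pow_mul_exp_neg_atTop_nhds_zero j).comp
      (tendsto_id.const_mul_atTop hδ)
    have h3 := h2.const_mul ((δ ^ j)⁻¹)
    rw [mul_zero] at h3
    refine h3.congr fun x => ?_
    simp only [Function.comp, id]
    rw [mul_pow]
    field_simp
  exact h1.comp (tendsto_atTop_add_const_right _ _ tendsto_natCast_atTop_atTop)

theorem gen_decay {N : ℕ} (hN : 2 ≤ N) (j : ℕ) :
    ∃ ε : ℕ → ℝ, Tendsto ε atTop (𝓝 0) ∧
      ∀ (n : ℕ) (z : ℂ), ‖z‖ = n + 1 / 2 → ‖z‖ ^ j * ‖gen N z‖ ≤ ε n := by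
  have hs : 0 < (eta N).im := by simpa using eta_pow_im_pos (N := N) (l := 1) le_rfl (by omega)
  have h := (tendsto_pow_mul_exp_neg_half_integer (j + N)
    (δ := Real.pi * ((eta N).im / 2)) (mul_pos Real.pi_pos (half_pos hs))).const_mul (2 ^ N)
  rw [mul_zero] at h
  refine ⟨_, h, fun n z hz => ?_⟩
  have h1 := norm_gen_le hN n hz
  calc ‖z‖ ^ j * ‖gen N z‖
      ≤ ‖z‖ ^ j * (2 ^ N * (‖z‖ ^ N * Real.exp (-(Real.pi * ((eta N).im / 2) * ‖z‖)))) := by gcongr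
    _ = _ := by rw [hz, pow_add]; ring

/-- The residues of `gen N` at `m + 1`. -/
noncomputable def genRes (N m : ℕ) : ℂ := (m + 1) ^ N * coef N (m + 1) / (2 * Real.pi * I)

theorem summable_pow_mul_norm_genRes {N : ℕ} (hN : 2 ≤ N) (j : ℕ) :
    Summable fun m : ℕ => (m + 1 : ℝ) ^ j * ‖genRes N m‖ := by
  have h := ((summable_nat_add_iff 1).2 (summable_pow_mul_norm_coef hN (j + N))).mul_right
    ((2 * Real.pi)⁻¹)
  refine h.congr fun m => ?_
  have h1 : ‖((m : ℂ) + 1)‖ = m + 1 := by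
    have : ((m : ℂ) + 1) = ((m + 1 : ℕ) : ℂ) := by push_cast; rfl
    rw [this, norm_natCast]
    push_cast
    rfl
  rw [genRes, norm_div, norm_mul, norm_pow, h1]
  simp only [norm_mul, norm_I, Complex.norm_ofNat, mul_one, norm_real, Real.norm_eq_abs,
    abs_of_pos Real.pi_pos]
  push_cast
  rw [pow_add]
  ring

theorem hasSimplePoles_gen {N : ℕ} (hN : 2 ≤ N) :
    HasSimplePoles N (gen N) (fun m l => eta N ^ l * genRes N m) where
  differentiableAt z hz := differentiableAt_gen hz
  residue m l _ := tendsto_sub_mul_gen (by omega) m l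
  decay := by simpa using gen_decay hN 0
  summable l _ := by
    simpa [norm_eta] using summable_pow_mul_norm_genRes hN 0

theorem hasSimplePoles_pow_mul_gen {N : ℕ} (hN : 2 ≤ N) (j : ℕ) :
    HasSimplePoles N (fun z => z ^ j * gen N z)
      (fun m l => pole N m l ^ j * (eta N ^ l * genRes N m)) := by
  refine (hasSimplePoles_gen hN).pow_mul j (gen_decay hN j) fun l _ => ?_
  simpa [norm_eta] using summable_pow_mul_norm_genRes hN j

theorem hasSimplePoles_iterate_dslope_gen {N : ℕ} (hN : 2 ≤ N) (j : ℕ) :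
    HasSimplePoles N ((fun f => dslope f 0)^[j] (gen N))
      (fun m l => eta N ^ l * genRes N m / pole N m l ^ j) := by
  induction j with
  | zero => simpa using hasSimplePoles_gen hN
  | succ j ih =>
    rw [Function.iterate_succ_apply']
    have := ih.dslope
    simpa only [div_div, ← pow_succ] using this

/-! ### Summation over the rotated poles and evaluation at `0`. -/

theorem _root_.HasSum.congr_of_eq {ι : Type*} {f g : ι → ℂ} {a b : ℂ} (h : HasSum f a)
    (hfg : ∀ i, g i = f i) (hab : b = a) : HasSum g b := by
  rw [funext hfg, hab]
  exact h

theorem geom_sum_eq_zero_of_pow_eq_one {x : ℂ} {M : ℕ} (hx : x ^ M = 1) (hx1 : x ≠ 1) :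
    ∑ l ∈ Finset.range M, x ^ l = 0 := by
  rw [geom_sum_eq hx1, hx, sub_self, zero_div]

/-- With the common denominator `z^M - n^M`, each numerator is a finite geometric sum, and summing
over the `M`-th roots of unity kills every power except `i = 0`. -/
theorem sum_root_div_sub {M : ℕ} (hM : M ≠ 0) {ω : ℂ} (hω : IsPrimitiveRoot ω M) {z n : ℂ}
    (h : z ^ M - n ^ M ≠ 0) :
    ∑ l ∈ Finset.range M, ω ^ l / (z - ω ^ l * n) = M * n ^ (M - 1) / (z ^ M - n ^ M) := by
  have h1 : ∀ l ∈ Finset.range M, ω ^ l / (z - ω ^ l * n) =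
      (∑ i ∈ Finset.range M, z ^ i * n ^ (M - 1 - i) * (ω ^ (M - i)) ^ l) / (z ^ M - n ^ M) := by
    intro l _
    have h2 : (ω ^ l * n) ^ M = n ^ M := by
      rw [mul_pow, ← pow_mul, mul_comm l, pow_mul, hω.pow_eq_one, one_pow, one_mul]
    have h3 := geom_sum₂_mul z (ω ^ l * n) M
    rw [h2] at h3
    have h4 : z - ω ^ l * n ≠ 0 := fun h0 => h (by rw [← h3, h0, mul_zero])
    have h5 : ∑ i ∈ Finset.range M, z ^ i * n ^ (M - 1 - i) * (ω ^ (M - i)) ^ l =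
        ω ^ l * ∑ i ∈ Finset.range M, z ^ i * (ω ^ l * n) ^ (M - 1 - i) := by
      rw [Finset.mul_sum]
      refine Finset.sum_congr rfl fun i hi => ?_
      have : M - i = (M - 1 - i) + 1 := by
        have := Finset.mem_range.1 hi
        omega
      rw [this, mul_pow]
      ring
    rw [h5, ← h3, div_eq_div_iff h4 (by rw [h3]; exact h)]
    ring
  rw [Finset.sum_congr rfl h1, ← Finset.sum_div, Finset.sum_comm]
  congr 1
  simp only [← Finset.mul_sum]
  rw [Finset.sum_eq_single 0]
  · simp [hω.pow_eq_one, mul_comm]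
  · intro i hi hi0
    rw [geom_sum_eq_zero_of_pow_eq_one, mul_zero]
    · rw [← pow_mul, mul_comm, pow_mul, hω.pow_eq_one, one_pow]
    · intro h0
      have := Nat.le_of_dvd (by have := Finset.mem_range.1 hi; omega) ((hω.pow_eq_one_iff_dvd _).1 h0)
      omega
  · intro h0
    exact absurd (Finset.mem_range.2 (Nat.pos_of_ne_zero hM)) h0

/-- As `2N ∣ j`, `η^(lj) = 1` and the `2N` poles of modulus `m + 1` contribute equally to the
expansion of `z^j gen N z` at `0`. The factor `0 ^ j` is `1` for `j = 0`, and for `j > 0` it is the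
source of the vanishing. -/
theorem hasSum_coef_mul_pow {N : ℕ} (hN : 2 ≤ N) {j : ℕ} (hj : 2 * N ∣ j) :
    HasSum (fun m : ℕ => coef N (m + 1) * ((m : ℂ) + 1) ^ ((N : ℤ) + j - 1))
      (-(2 * Real.pi * I) / (2 * N) * (0 ^ j * gen N 0)) := by
  have hN0 : N ≠ 0 := by omega
  have hNc : (N : ℂ) ≠ 0 := by exact_mod_cast hN0
  have hpi : (2 * Real.pi * I : ℂ) ≠ 0 := two_pi_I_ne_zero
  have h := ((hasSimplePoles_pow_mul_gen hN j).hasSum_zero hN0).mul_left (2 * Real.pi * I / (2 * N))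
  refine h.congr_of_eq (fun m => ?_) ?_
  · have hn : ((m : ℂ) + 1) ≠ 0 := by exact_mod_cast Nat.succ_ne_zero m
    have h1 : ∀ l, pole N m l ^ j * (eta N ^ l * genRes N m) / pole N m l =
        ((m : ℂ) + 1) ^ j * genRes N m / (m + 1) := fun l => by
      have hη := pow_ne_zero l (eta_ne_zero N)
      have h2 : (eta N ^ l) ^ j = 1 := by
        obtain ⟨c, rfl⟩ := hj
        rw [← pow_mul, mul_comm l, mul_assoc, pow_mul, (isPrimitiveRoot_eta hN0).pow_eq_one, one_pow]
      rw [pole, mul_pow, h2]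
      field_simp
    rw [Finset.sum_congr rfl fun l _ => h1 l, Finset.sum_const, Finset.card_range, nsmul_eq_mul,
      genRes]
    rw [zpow_sub₀ hn, zpow_add₀ hn, zpow_one, zpow_natCast, zpow_natCast]
    push_cast
    field_simp
  · ring

theorem hasSum_coef_mul_pow_neg {N : ℕ} (hN : 2 ≤ N) {j : ℕ} (hj : 2 * N ∣ j) :
    HasSum (fun m : ℕ => coef N (m + 1) * ((m : ℂ) + 1) ^ ((N : ℤ) - j - 1))
      (-(2 * Real.pi * I) / (2 * N) * ((fun f => dslope f 0)^[j] (gen N)) 0) := by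
  have hN0 : N ≠ 0 := by omega
  have hNc : (N : ℂ) ≠ 0 := by exact_mod_cast hN0
  have hpi : (2 * Real.pi * I : ℂ) ≠ 0 := two_pi_I_ne_zero
  have h := ((hasSimplePoles_iterate_dslope_gen hN j).hasSum_zero hN0).mul_left
    (2 * Real.pi * I / (2 * N))
  refine h.congr_of_eq (fun m => ?_) ?_
  · have hn : ((m : ℂ) + 1) ≠ 0 := by exact_mod_cast Nat.succ_ne_zero m
    have h1 : ∀ l, eta N ^ l * genRes N m / pole N m l ^ j / pole N m l =
        genRes N m / (m + 1) ^ j / (m + 1) := fun l => by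
      have hη := pow_ne_zero l (eta_ne_zero N)
      have h2 : (eta N ^ l) ^ j = 1 := by
        obtain ⟨c, rfl⟩ := hj
        rw [← pow_mul, mul_comm l, mul_assoc, pow_mul, (isPrimitiveRoot_eta hN0).pow_eq_one, one_pow]
      rw [pole, mul_pow, h2]
      field_simp
    rw [Finset.sum_congr rfl fun l _ => h1 l, Finset.sum_const, Finset.card_range, nsmul_eq_mul,
      genRes]
    rw [zpow_sub₀ hn, zpow_sub₀ hn, zpow_one, zpow_natCast, zpow_natCast]
    push_cast
    field_simp
  · ring

/-- The partial fraction expansion of `gen N`. -/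
theorem hasSum_gen {N : ℕ} (hN : 2 ≤ N) {z : ℂ} (hz : ∀ m, ∀ l < 2 * N, z ≠ pole N m l) :
    HasSum (fun m : ℕ => genRes N m * (2 * N * ((m : ℂ) + 1) ^ (2 * N - 1) /
      (z ^ (2 * N) - (m + 1) ^ (2 * N)))) (gen N z) := by
  have hN0 : N ≠ 0 := by omega
  have h := (hasSimplePoles_gen hN).hasSum hN0 z hz
  refine h.congr_of_eq (fun m => ?_) rfl
  have hM : 2 * N ≠ 0 := by omega
  have hn : ((m : ℂ) + 1) ≠ 0 := by exact_mod_cast Nat.succ_ne_zero m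
  have hne : z ^ (2 * N) - ((m : ℂ) + 1) ^ (2 * N) ≠ 0 := by
    intro h0
    have h1 : (z / (m + 1)) ^ (2 * N) = 1 := by
      rw [div_pow, sub_eq_zero.1 h0, div_self (pow_ne_zero _ hn)]
    have : NeZero (2 * N) := ⟨hM⟩
    obtain ⟨l, hl, h2⟩ := (isPrimitiveRoot_eta hN0).eq_pow_of_pow_eq_one h1
    exact hz m l hl (by rw [pole, h2, div_mul_cancel₀ _ hn])
  have h1 := sum_root_div_sub hM (isPrimitiveRoot_eta hN0) hne
  push_cast at h1
  rw [← h1, Finset.mul_sum]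
  refine Finset.sum_congr rfl fun l _ => ?_
  rw [pole]
  ring

/-! ### Rationality of Taylor coefficients -/

/-- `f` is analytic at `0` with all derivatives there in the subfield `K`. -/
def HasCoeffsIn (K : Subfield ℂ) (f : ℂ → ℂ) : Prop :=
  AnalyticAt ℂ f 0 ∧ ∀ j, iteratedDeriv j f 0 ∈ K

namespace HasCoeffsIn

variable {K : Subfield ℂ} {f g : ℂ → ℂ}

theorem apply_zero (hf : HasCoeffsIn K f) : f 0 ∈ K := by simpa using hf.2 0

theorem mul (hf : HasCoeffsIn K f) (hg : HasCoeffsIn K g) : HasCoeffsIn K fun z => f z * g z := by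
  refine ⟨hf.1.mul hg.1, fun j => ?_⟩
  rw [iteratedDeriv_fun_mul hf.1.contDiffAt hg.1.contDiffAt]
  exact sum_mem fun i _ => mul_mem (mul_mem (natCast_mem K _) (hf.2 i)) (hg.2 _)

theorem deriv (hf : HasCoeffsIn K f) : HasCoeffsIn K (deriv f) :=
  ⟨hf.1.deriv, fun j => by rw [← iteratedDeriv_succ']; exact hf.2 _⟩

/-- By Leibniz, `f' = g f` is a recursion for the derivatives of `f` with coefficients in `K`. It
lets rationality pass from a logarithmic derivative to the function. -/
theorem of_deriv_eq_mul (hf : AnalyticAt ℂ f 0) (h0 : f 0 ∈ K) (hg : HasCoeffsIn K g)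
    (h : _root_.deriv f =ᶠ[𝓝 0] fun z => g z * f z) : HasCoeffsIn K f := by
  refine ⟨hf, fun j => ?_⟩
  induction j using Nat.strong_induction_on with
  | _ j ih =>
    cases j with
    | zero => simpa using h0
    | succ j =>
      rw [iteratedDeriv_succ', h.iteratedDeriv_eq,
        iteratedDeriv_fun_mul hg.1.contDiffAt hf.contDiffAt]
      exact sum_mem fun i _ => mul_mem (mul_mem (natCast_mem K _) (hg.2 i)) (ih _ (by omega))

theorem inv (hf : HasCoeffsIn K f) (h0 : f 0 ≠ 0) : HasCoeffsIn K fun z => (f z)⁻¹ := by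
  have ha : AnalyticAt ℂ (fun z => (f z)⁻¹) 0 := hf.1.inv h0
  refine ⟨ha, fun j => ?_⟩
  induction j using Nat.strong_induction_on with
  | _ j ih =>
    rcases eq_or_ne j 0 with rfl | hj
    · simpa using inv_mem hf.apply_zero
    · have h1 : (fun z => f z * (f z)⁻¹) =ᶠ[𝓝 0] fun _ => 1 := by
        filter_upwards [hf.1.continuousAt.eventually_ne h0] with z hz
        exact mul_inv_cancel₀ hz
      have h2 := h1.iteratedDeriv_eq j
      rw [iteratedDeriv_fun_mul hf.1.contDiffAt ha.contDiffAt, iteratedDeriv_const, if_neg hj,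
        Finset.sum_range_succ'] at h2
      simp only [Nat.choose_zero_right, Nat.cast_one, one_mul, iteratedDeriv_zero, Nat.sub_zero] at h2
      have h3 : iteratedDeriv j (fun z => (f z)⁻¹) 0 = -((f 0)⁻¹ * ∑ i ∈ Finset.range j,
          (j.choose (i + 1) : ℂ) * iteratedDeriv (i + 1) f 0 *
            iteratedDeriv (j - (i + 1)) (fun z => (f z)⁻¹) 0) := by
        apply mul_left_cancel₀ h0
        rw [mul_neg, mul_inv_cancel_left₀ h0]
        exact eq_neg_of_add_eq_zero_right h2
      rw [h3]
      refine neg_mem (mul_mem (inv_mem hf.apply_zero) (sum_mem fun i hi => ?_))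
      exact mul_mem (mul_mem (natCast_mem K _) (hf.2 _)) (ih _ (by omega))

/-- From `f(z) = f(0) + z · dslope f 0 z`, the derivative of order `j + 1` of `f` at `0` is `j + 1`
times that of order `j` of the quotient. -/
theorem dslope (hf : HasCoeffsIn K f) : HasCoeffsIn K (dslope f 0) := by
  have ha : AnalyticAt ℂ (_root_.dslope f 0) 0 := by
    obtain ⟨p, hp⟩ := hf.1
    exact hp.has_fpower_series_dslope_fslope.analyticAt
  refine ⟨ha, fun j => ?_⟩
  have h1 : ∀ z, f z = f 0 + z * _root_.dslope f 0 z := fun z => by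
    have := sub_smul_dslope f 0 z
    rw [sub_zero, smul_eq_mul] at this
    rw [this]
    ring
  have h2 : iteratedDeriv (j + 1) f 0 = (j + 1) * iteratedDeriv j (_root_.dslope f 0) 0 := by
    have h3 : iteratedDeriv (j + 1) (fun z => f 0 + z * _root_.dslope f 0 z) 0 =
        iteratedDeriv (j + 1) (fun z => z * _root_.dslope f 0 z) 0 := by
      rw [iteratedDeriv_const_add (Nat.succ_pos j)]
    conv_lhs => rw [funext h1]
    rw [h3, iteratedDeriv_fun_mul (f := fun z => z) contDiffAt_id ha.contDiffAt, Finset.sum_eq_single 1]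
    · simp
    · intro i _ hi
      have : iteratedDeriv i (fun z : ℂ => z) 0 = 0 := by
        have : iteratedDeriv i (fun z : ℂ => z) 0 = _ := iteratedDeriv_id (x := (0 : ℂ))
        rcases i with _ | _ | i
        · simp
        · exact absurd rfl hi
        · simpa using this
      rw [this]
      simp
    · intro h
      simp at h
  have h4 : ((j : ℂ) + 1) ≠ 0 := by exact_mod_cast Nat.succ_ne_zero j
  rw [← mul_div_cancel_left₀ (iteratedDeriv j (_root_.dslope f 0) 0) h4, ← h2]
  exact div_mem (hf.2 _) (add_mem (natCast_mem K j) (one_mem K))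

theorem iterate_dslope (hf : HasCoeffsIn K f) (j : ℕ) :
    HasCoeffsIn K ((fun f => _root_.dslope f 0)^[j] f) := by
  induction j with
  | zero => exact hf
  | succ j ih =>
    rw [Function.iterate_succ_apply']
    exact ih.dslope

end HasCoeffsIn

theorem iteratedDeriv_comp_mul (f : ℂ → ℂ) (c : ℂ) (j : ℕ) :
    iteratedDeriv j (fun z => f (c * z)) = fun z => c ^ j * iteratedDeriv j f (c * z) := by
  induction j with
  | zero => simp
  | succ j ih =>
    funext z
    rw [iteratedDeriv_succ, ih, deriv_const_mul_field, deriv_comp_mul_left, iteratedDeriv_succ,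
      smul_eq_mul]
    ring

theorem hasCoeffsIn_sin (K : Subfield ℂ) : HasCoeffsIn K sin := by
  refine ⟨Complex.analyticAt_sin, fun j => ?_⟩
  suffices h : iteratedDeriv j sin 0 ∈ K ∧ iteratedDeriv j cos 0 ∈ K from h.1
  induction j with
  | zero => simp
  | succ j ih =>
    rw [iteratedDeriv_succ', iteratedDeriv_succ', Complex.deriv_sin, Complex.deriv_cos']
    refine ⟨ih.2, ?_⟩
    have : iteratedDeriv j (fun z => -sin z) 0 = -iteratedDeriv j sin 0 := iteratedDeriv_fun_neg j sin 0
    rw [this]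
    exact neg_mem ih.1

/-- Rescaling the variable by `a` multiplies the `j`-th Taylor coefficient by `a^j`; with `a = π`
this isolates the transcendental part. -/
theorem iterate_dslope_const_mul_comp_mul (f : ℂ → ℂ) (c : ℂ) {a : ℂ} (ha : a ≠ 0) (j : ℕ) :
    (fun f => dslope f 0)^[j] (fun z => c * f (a * z)) =
      fun z => c * a ^ j * ((fun f => dslope f 0)^[j] f) (a * z) := by
  induction j with
  | zero => simp
  | succ j ih =>
    rw [Function.iterate_succ_apply', ih, Function.iterate_succ_apply']
    funext z
    rcases eq_or_ne z 0 with rfl | hz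
    · rw [mul_zero, dslope_same, dslope_same, deriv_const_mul_field, deriv_comp_mul_left, mul_zero,
        smul_eq_mul]
      ring
    · rw [dslope_of_ne _ hz, dslope_of_ne _ (mul_ne_zero ha hz), slope_def_field, slope_def_field,
        mul_zero, sub_zero, sub_zero, pow_succ]
      field_simp

/-- `∏_{l < N} z η^l / sin (z η^l)`. -/
noncomputable def sincInvProd (N : ℕ) (z : ℂ) : ℂ :=
  ∏ l ∈ Finset.range N, (dslope sin 0 (eta N ^ l * z))⁻¹

theorem gen_eq_sincInvProd (N : ℕ) :
    gen N = fun z => gen N 0 * sincInvProd N (Real.pi * z) := by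
  funext z
  rw [gen_zero, sincInvProd, gen, ← Finset.prod_mul_distrib]
  refine Finset.prod_congr rfl fun l _ => ?_
  rw [sineQuotient, mul_inv, show (Real.pi * eta N ^ l * z : ℂ) = eta N ^ l * (Real.pi * z) by ring]

/-- With `u = z / sin z` and `v = u'/u`, the logarithmic derivative of the product is `∑ η^l v(η^l
z)`, whose `j`-th derivative at `0` is that of `v` times `∑_{l < N} η^((j+1)l)`. This leaves any
subfield only if `j` is even, and then the derivative of the odd function `v` vanishes. -/
theorem hasCoeffsIn_sincInvProd {N : ℕ} (hN : N ≠ 0) (K : Subfield ℂ) :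
    HasCoeffsIn K (sincInvProd N) := by
  set s : ℂ → ℂ := dslope sin 0 with hs
  set u : ℂ → ℂ := fun z => (s z)⁻¹ with hu
  set v : ℂ → ℂ := fun z => deriv u z * s z with hv
  have hs0 : s 0 = 1 := by simp [hs]
  have hsK : HasCoeffsIn K s := (hasCoeffsIn_sin K).dslope
  have huK : HasCoeffsIn K u := hsK.inv (by rw [hs0]; exact one_ne_zero)
  have hvK : HasCoeffsIn K v := huK.deriv.mul hsK
  have hcomp : ∀ l, AnalyticAt ℂ (fun z => u (eta N ^ l * z)) 0 := fun l => by
    have h1 : AnalyticAt ℂ u (eta N ^ l * 0) := by rw [mul_zero]; exact huK.1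
    exact h1.fun_comp (analyticAt_const.mul analyticAt_id)
  have hsodd : ∀ z, v (-z) = -v z := fun z => by
    have h1 : ∀ z, u (-z) = u z := fun z => by simp only [hu, hs, dslope_sin_neg]
    have h2 : deriv u (-z) = -deriv u z := by
      have := deriv_comp_neg (f := u) (-z)
      rw [neg_neg] at this
      rw [← this]
      congr 1
      funext w
      exact (h1 w).symm
    simp only [hv, h2, hs, dslope_sin_neg]
    ring
  set L : ℂ → ℂ := fun z => ∑ l ∈ Finset.range N, eta N ^ l * v (eta N ^ l * z) with hL
  have hvl : ∀ l, AnalyticAt ℂ (fun z => eta N ^ l * v (eta N ^ l * z)) 0 := fun l => by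
    have h1 : AnalyticAt ℂ v (eta N ^ l * 0) := by rw [mul_zero]; exact hvK.1
    exact analyticAt_const.mul (h1.fun_comp (analyticAt_const.mul analyticAt_id))
  have hLK : HasCoeffsIn K L := by
    refine ⟨Finset.analyticAt_fun_sum _ fun l _ => hvl l, fun j => ?_⟩
    have h1 : iteratedDeriv j L 0 =
        (∑ l ∈ Finset.range N, (eta N ^ (j + 1)) ^ l) * iteratedDeriv j v 0 := by
      rw [hL, iteratedDeriv_fun_sum fun l _ => (hvl l).contDiffAt, Finset.sum_mul]
      refine Finset.sum_congr rfl fun l _ => ?_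
      have h2 : iteratedDeriv j (fun z => eta N ^ l * v (eta N ^ l * z)) 0 =
          eta N ^ l * iteratedDeriv j (fun z => v (eta N ^ l * z)) 0 := by
        rw [iteratedDeriv_const_mul_field]
      rw [h2, iteratedDeriv_comp_mul]
      simp only [mul_zero]
      ring
    rw [h1]
    rcases Nat.even_or_odd j with hj | hj
    · have h2 : iteratedDeriv j v 0 = 0 := by
        have h3 := congrFun (iteratedDeriv_comp_mul v (-1) j) 0
        have h4 : (fun z => v (-1 * z)) = fun z => -v z := by
          funext z
          rw [neg_one_mul, hsodd]
        have h5 : iteratedDeriv j (fun z => -v z) 0 = -iteratedDeriv j v 0 :=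
          iteratedDeriv_fun_neg j v 0
        rw [h4, h5, hj.neg_one_pow, mul_zero, one_mul] at h3
        exact self_eq_neg.1 h3.symm
      rw [h2, mul_zero]
      exact zero_mem K
    -- For odd `j`, `η^(j+1)` is an `N`-th root of unity, so the sum over `l` is `N` or `0`.
    · refine mul_mem ?_ (hvK.2 j)
      by_cases h2 : eta N ^ (j + 1) = 1
      · simp [h2]
      · rw [geom_sum_eq_zero_of_pow_eq_one _ h2]
        · exact zero_mem K
        · obtain ⟨i, hi⟩ : 2 ∣ j + 1 := (hj.add_one).two_dvd
          rw [hi, ← pow_mul, show 2 * i * N = 2 * N * i by ring, pow_mul,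
            (isPrimitiveRoot_eta hN).pow_eq_one, one_pow]
  refine HasCoeffsIn.of_deriv_eq_mul (Finset.analyticAt_fun_prod _ fun l _ => hcomp l) ?_ hLK ?_
  · simp [sincInvProd]
  · have hev : ∀ᶠ z in 𝓝 (0 : ℂ), ∀ l ∈ Finset.range N,
        s (eta N ^ l * z) ≠ 0 ∧ DifferentiableAt ℂ (fun z => u (eta N ^ l * z)) z ∧
          deriv (fun z => u (eta N ^ l * z)) z = eta N ^ l * deriv u (eta N ^ l * z) := by
      refine (Filter.eventually_all_finset _).2 fun l _ => ?_
      have h1 : ContinuousAt (fun z => s (eta N ^ l * z)) 0 := by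
        refine ContinuousAt.comp ?_ (continuousAt_const.mul continuousAt_id)
        rw [mul_zero]
        exact hsK.1.continuousAt
      have h2 := h1.eventually_ne (y := 0) (by rw [mul_zero, hs0]; exact one_ne_zero)
      filter_upwards [h2, (hcomp l).eventually_analyticAt] with z hz hz2
      exact ⟨hz, hz2.differentiableAt, by rw [deriv_comp_mul_left, smul_eq_mul]⟩
    filter_upwards [hev] with z hz
    have hne : ∀ l ∈ Finset.range N, u (eta N ^ l * z) ≠ 0 := fun l hl => inv_ne_zero (hz l hl).1
    have h1 : logDeriv (sincInvProd N) z = L z := by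
      have : sincInvProd N = fun z => ∏ l ∈ Finset.range N, u (eta N ^ l * z) := rfl
      rw [this, logDeriv_prod hne fun l hl => (hz l hl).2.1]
      refine Finset.sum_congr rfl fun l hl => ?_
      rw [logDeriv_apply, (hz l hl).2.2]
      simp only [hv, hu, div_inv_eq_mul]
      ring
    rw [← h1, logDeriv_apply, div_mul_cancel₀]
    exact Finset.prod_ne_zero_iff.2 hne

/-! ### The sums of the coefficients against powers -/

theorem hasSum_pnat_of_hasSum_nat_succ {f : ℕ → ℂ} {a : ℂ} (h : HasSum (fun m : ℕ => f (m + 1)) a) :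
    HasSum (fun m : ℕ+ => f m) a := by
  rw [← Equiv.pnatEquivNat.symm.hasSum_iff]
  refine h.congr_of_eq (fun m => ?_) rfl
  simp [Equiv.pnatEquivNat]

theorem summable_norm_mul_zpow {f : ℕ → ℂ} (hf : ∀ k : ℕ, Summable fun m : ℕ => (m : ℝ) ^ k * ‖f m‖)
    (k : ℤ) : Summable fun m : ℕ+ => f m * (m : ℂ) ^ k := by
  have h1 : Summable fun m : ℕ+ => ((m : ℕ) : ℝ) ^ k.natAbs * ‖f m‖ :=
    (hf k.natAbs).comp_injective PNat.coe_injective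
  refine Summable.of_norm_bounded h1 fun m => ?_
  have hm : (1 : ℝ) ≤ (m : ℕ) := by exact_mod_cast m.pos
  rw [norm_mul, norm_zpow, mul_comm]
  have : ‖((m : ℕ) : ℂ)‖ = (m : ℕ) := Complex.norm_natCast _
  rw [this, ← zpow_natCast]
  gcongr
  exact Int.le_natAbs

theorem prod_eta_pow_range (N : ℕ) : ∏ l ∈ Finset.range N, (2 * Real.pi * I * eta N ^ l)⁻¹ =
    ((2 * Real.pi * I) ^ N)⁻¹ * (eta N ^ (∑ l ∈ Finset.range N, l))⁻¹ := by
  rw [Finset.prod_inv_distrib, Finset.prod_mul_distrib, Finset.prod_const, Finset.card_range,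
    Finset.prod_pow_eq_pow_sum, mul_inv]

theorem tsum_coef_mul_zpow_eq_zero {N : ℕ} (hN : 2 ≤ N) {k : ℤ} (hk : k ≡ N [ZMOD 2 * N])
    (hkN : (N : ℤ) < k) : HasSum (fun m : ℕ+ => coef N m * (m : ℂ) ^ (k - 1)) 0 := by
  obtain ⟨j, rfl⟩ : ∃ j : ℕ, k = N + j := ⟨(k - N).toNat, by omega⟩
  have hj : 2 * N ∣ j := by
    have h1 : (2 * N : ℤ) ∣ j := by simpa using hk.symm.dvd
    exact_mod_cast h1
  have h := hasSum_coef_mul_pow hN hj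
  rw [zero_pow (by omega), zero_mul, mul_zero] at h
  refine hasSum_pnat_of_hasSum_nat_succ (f := fun m => coef N m * (m : ℂ) ^ ((N : ℤ) + j - 1)) ?_
  exact_mod_cast h

theorem exists_rat_tsum_coef_mul_zpow {N : ℕ} (hN : 2 ≤ N) {k : ℤ} (hk : k ≡ N [ZMOD 2 * N]) :
    ∃ q : ℚ, (2 * Real.pi * I) ^ (k - 1) * ∑' m : ℕ+, coef N m * (m : ℂ) ^ (k - 1) =
      q * (eta N ^ (∑ l ∈ Finset.range N, l))⁻¹ := by
  have hN0 : N ≠ 0 := by omega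
  rcases lt_or_ge (N : ℤ) k with hkN | hkN
  · exact ⟨0, by rw [(tsum_coef_mul_zpow_eq_zero hN hk hkN).tsum_eq]; simp⟩
  obtain ⟨j, rfl⟩ : ∃ j : ℕ, k = N - j := ⟨(N - k).toNat, by omega⟩
  have hj : 2 * N ∣ j := by
    have h1 : (2 * N : ℤ) ∣ j := by simpa using hk.dvd
    exact_mod_cast h1
  have h := hasSum_coef_mul_pow_neg hN hj
  have h' : HasSum (fun m : ℕ+ => coef N m * (m : ℂ) ^ ((N : ℤ) - j - 1)) _ :=
    hasSum_pnat_of_hasSum_nat_succ (f := fun m => coef N m * (m : ℂ) ^ ((N : ℤ) - j - 1))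
      (by exact_mod_cast h)
  obtain ⟨q, hq⟩ := ((hasCoeffsIn_sincInvProd hN0 (algebraMap ℚ ℂ).fieldRange).iterate_dslope
    j).apply_zero
  have hpi : (Real.pi : ℂ) ≠ 0 := by exact_mod_cast Real.pi_ne_zero
  have h2pi : (2 * Real.pi * I : ℂ) ≠ 0 := two_pi_I_ne_zero
  have hNc : (N : ℂ) ≠ 0 := by exact_mod_cast hN0
  have hval : ((fun f => dslope f 0)^[j] (gen N)) 0 = gen N 0 * Real.pi ^ j * q := by
    rw [gen_eq_sincInvProd, iterate_dslope_const_mul_comp_mul _ _ hpi, ← gen_eq_sincInvProd]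
    simp only [mul_zero]
    rw [← hq]
    rfl
  obtain ⟨c, rfl⟩ := hj
  -- For `j = 2Nc` one has `(2πi)^j = (-4)^(Nc) π^j`, so the `π^j` of the Taylor coefficient
  -- cancels; `(2πi)^N` cancels against `gen N 0`, whose power of `η` remains.
  refine ⟨-(1 / (2 * N)) * ((-4) ^ (N * c))⁻¹ * q, ?_⟩
  have h4 : (2 * Real.pi * I : ℂ) ^ (2 * N * c) = (-4) ^ (N * c) * Real.pi ^ (2 * N * c) := by
    rw [mul_assoc 2 N c, pow_mul, pow_mul (Real.pi : ℂ), ← mul_pow]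
    congr 1
    linear_combination (4 * Real.pi ^ 2 : ℂ) * I_sq
  have hp1 : (Real.pi : ℂ) ^ (2 * N * c) ≠ 0 := pow_ne_zero _ hpi
  have hp2 : (2 * Real.pi * I : ℂ) ^ N ≠ 0 := pow_ne_zero _ h2pi
  rw [h'.tsum_eq, hval, gen_zero, prod_eta_pow_range, zpow_sub₀ h2pi, zpow_sub₀ h2pi, zpow_one,
    zpow_natCast, zpow_natCast, h4]
  push_cast
  generalize (eta N ^ (∑ l ∈ Finset.range N, l))⁻¹ = x
  generalize (2 * Real.pi * I : ℂ) ^ N = y at *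
  generalize (2 * Real.pi * I : ℂ) = t at *
  field_simp

theorem tsum_coef_mul_zpow_mem_adjoin {N : ℕ} (hN : 2 ≤ N) {k : ℤ} (hk : k ≡ N [ZMOD 2 * N]) :
    (2 * Real.pi * I) ^ (k - 1) * ∑' m : ℕ+, coef N m * (m : ℂ) ^ (k - 1) ∈
      IntermediateField.adjoin ℚ {eta N} := by
  obtain ⟨q, hq⟩ := exists_rat_tsum_coef_mul_zpow hN hk
  rw [hq]
  refine mul_mem ?_ (inv_mem (pow_mem (IntermediateField.mem_adjoin_simple_self ℚ _) _))
  exact (IntermediateField.adjoin ℚ {eta N}).algebraMap_mem q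

/-- For `N = 2M + 1` the leftover exponent of `η` is `N(N-1)/2 = NM`, and `η^(NM) = (-1)^M`. -/
theorem tsum_coef_mul_zpow_rat {N : ℕ} (hN : 2 ≤ N) (hodd : Odd N) {k : ℤ}
    (hk : k ≡ N [ZMOD 2 * N]) :
    ∃ q : ℚ, (2 * Real.pi * I) ^ (k - 1) * ∑' m : ℕ+, coef N m * (m : ℂ) ^ (k - 1) = q := by
  obtain ⟨q, hq⟩ := exists_rat_tsum_coef_mul_zpow hN hk
  obtain ⟨M, hM⟩ := hodd
  have h1 : ∑ l ∈ Finset.range N, l = N * M := by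
    rw [Finset.sum_range_id, hM, Nat.add_sub_cancel, mul_left_comm, Nat.mul_div_cancel_left _ two_pos]
  refine ⟨q * ((-1) ^ M)⁻¹, ?_⟩
  rw [hq, h1, pow_mul, eta_pow_self (by omega)]
  push_cast
  rfl

/-! ### The sums over all nonzero integers -/

theorem prod_one_sub_e_neg_of_sum {ι : Type*} (s : Finset ι) (x : ι → ℂ) (hx : ∑ i ∈ s, x i = -1)
    (m : ℤ) : ∏ i ∈ s, (1 - e (-(m * x i))) =
      (-1) ^ m * ∏ i ∈ s, (2 * I * sin (Real.pi * (m * x i))) := by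
  simp only [one_sub_e_neg, Finset.prod_mul_distrib]
  rw [← e_sum, Finset.sum_neg_distrib, ← Finset.sum_div, ← Finset.mul_sum, hx,
    show (-((m : ℂ) * -1 / 2)) = m / 2 by ring, e_int_div_two]

/-- A real `η^(2l)` forces `N ∣ 2l`, hence `N ∣ l` as `N` is odd. For even `N` the index `l = N/2`
would violate this. -/
theorem eta_pow_two_mul_im_ne_zero {N l : ℕ} (hodd : Odd N) (h1 : 1 ≤ l) (h2 : l < N) :
    (eta N ^ (2 * l)).im ≠ 0 := by
  have hN : (0 : ℝ) < N := by exact_mod_cast (by omega : 0 < N)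
  rw [eta_pow_im]
  intro h
  obtain ⟨n, hn⟩ := Real.sin_eq_zero_iff.1 h
  have h3 : (n : ℝ) * N = (2 * l : ℕ) := by
    rw [eq_div_iff hN.ne'] at hn
    have := Real.pi_pos
    nlinarith
  have h4 : n * N = 2 * l := by exact_mod_cast h3
  have h5 : (N : ℤ) ∣ 2 * l := ⟨n, by rw [← h4]; ring⟩
  have h6 : N ∣ 2 * l := by exact_mod_cast h5
  have h7 := Nat.le_of_dvd (by omega) ((Nat.Coprime.dvd_mul_left
    (Nat.Coprime.symm (Nat.coprime_two_left.2 hodd))).1 h6)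
  omega

theorem sum_eta_pow_two_mul {N : ℕ} (hN : 2 ≤ N) :
    ∑ l ∈ Finset.Icc 1 (N - 1), eta N ^ (2 * l) = -1 := by
  have h1 : ∑ l ∈ Finset.range N, (eta N ^ 2) ^ l = 0 := by
    refine geom_sum_eq_zero_of_pow_eq_one ?_ ?_
    · rw [← pow_mul, (isPrimitiveRoot_eta (by omega)).pow_eq_one]
    · exact (isPrimitiveRoot_eta (N := N) (by omega)).pow_ne_one_of_pos_of_lt two_ne_zero (by omega)
  obtain ⟨M, rfl⟩ := Nat.exists_eq_succ_of_ne_zero (by omega : N ≠ 0)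
  rw [Finset.sum_range_succ', pow_zero, Finset.range_eq_Ico,
    Finset.sum_Ico_add' (fun l => (eta (M + 1) ^ 2) ^ l) 0 M 1] at h1
  simp only [← pow_mul] at h1
  exact eq_neg_of_add_eq_zero_left h1

theorem summable_and_tsum_int_eq_zero {N : ℕ} (hN : 2 ≤ N) (hodd : Odd N) {k : ℤ}
    (hk : 2 * (N : ℤ) ∣ k) :
    Summable (fun m : {m : ℤ // m ≠ 0} => ((m : ℤ) : ℂ) ^ (k - 1) /
      ∏ l ∈ Finset.Icc 1 (N - 1), (1 - e (-(((m : ℤ) : ℂ) * eta N ^ (2 * l))))) ∧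
    ∑' m : {m : ℤ // m ≠ 0}, ((m : ℤ) : ℂ) ^ (k - 1) /
      ∏ l ∈ Finset.Icc 1 (N - 1), (1 - e (-(((m : ℤ) : ℂ) * eta N ^ (2 * l)))) = 0 := by
  simp only [prod_one_sub_e_neg_of_sum _ _ (sum_eta_pow_two_mul hN)]
  set P : ℤ → ℂ := fun m => ∏ l ∈ Finset.Icc 1 (N - 1),
    (2 * I * sin (Real.pi * (m * eta N ^ (2 * l)))) with hP
  set f : ℤ → ℂ := fun m => (m : ℂ) ^ (k - 1) / ((-1) ^ m * P m) with hf
  change Summable (fun m : {m : ℤ // m ≠ 0} => f m) ∧ ∑' m : {m : ℤ // m ≠ 0}, f m = 0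
  -- An even number of sines makes the product even in `m`, while `k - 1` is odd; so the summand is
  -- odd and its sum over `m ≠ 0` is its own negative.
  have hcard : Even (N - 1) := by
    obtain ⟨M, hM⟩ := hodd
    exact ⟨M, by omega⟩
  have hkeven : Odd (k - 1) := by
    obtain ⟨c, rfl⟩ := hk
    exact ⟨N * c - 1, by ring⟩
  have hPeven : ∀ m, P (-m) = P m := fun m => by
    have : ∀ l, (2 * I * sin (Real.pi * (((-m : ℤ) : ℂ) * eta N ^ (2 * l)))) =
        -1 * (2 * I * sin (Real.pi * (m * eta N ^ (2 * l)))) := fun l => by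
      rw [Int.cast_neg, neg_mul, mul_neg, sin_neg]
      ring
    simp only [hP, this]
    rw [Finset.prod_mul_distrib, Finset.prod_const, Nat.card_Icc, Nat.add_sub_cancel,
      hcard.neg_one_pow, one_mul]
  have hfodd : ∀ m, f (-m) = -f m := fun m => by
    simp only [hf, hPeven, Int.cast_neg, hkeven.neg_zpow]
    have : ((-1 : ℂ) ^ (-m)) = (-1) ^ m := by rw [zpow_neg, ← inv_zpow]; norm_num
    rw [this]
    ring
  obtain ⟨K, δ, hK, hδ, hb⟩ := exists_norm_prod_sin_inv_le (Finset.Icc 1 (N - 1))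
    ⟨1, by simp; omega⟩ (fun l => eta N ^ (2 * l)) fun l hl => by
      rw [Finset.mem_Icc] at hl
      exact eta_pow_two_mul_im_ne_zero hodd hl.1 (by omega)
  have hnat : Summable fun m : ℕ+ => f ((m : ℕ) : ℤ) := by
    have h1 := summable_pow_mul_of_norm_le_exp (f := fun m : ℕ => ((-1) ^ (m : ℤ) * P m)⁻¹)
      (K := K) hδ fun m hm => by
        have := hb m (by exact_mod_cast hm)
        rw [mul_inv, norm_mul, norm_inv, norm_zpow, norm_neg, norm_one, one_zpow, inv_one, one_mul]
        rw [hP]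
        simpa only [Int.cast_natCast, Nat.abs_cast] using this
    refine (summable_norm_mul_zpow h1 (k - 1)).congr fun m => ?_
    simp only [hf]
    rw [div_eq_mul_inv, mul_comm]
    push_cast
    rfl
  have hint : Summable fun m : {m : ℤ // m ≠ 0} => f m := by
    have h0 : Summable fun m : ℕ => f m := by
      rw [← summable_nat_add_iff 1]
      have := (Equiv.pnatEquivNat.symm.summable_iff).2 hnat
      refine this.congr fun m => ?_
      simp [Equiv.pnatEquivNat]
    have h1 : Summable f := by
      refine Summable.of_nat_of_neg h0 ?_
      simpa only [hfodd] using h0.neg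
    exact h1.subtype _
  refine ⟨hint, ?_⟩
  set σ : {m : ℤ // m ≠ 0} ≃ {m : ℤ // m ≠ 0} :=
    (Equiv.neg ℤ).subtypeEquiv fun m => by simp with hσ
  have h1 := σ.tsum_eq fun m : {m : ℤ // m ≠ 0} => f m
  have h2 : ∀ m, f (σ m : ℤ) = -f m := fun m => hfodd m
  simp only [h2, tsum_neg] at h1
  exact self_eq_neg.1 h1.symm

/-! ### Sums over `ℕ^M` of products, and the infinite product -/

theorem hasSum_pi_prod {M : ℕ} (f : Fin M → ℕ → ℂ) (a : Fin M → ℂ)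
    (hf : ∀ j, Summable fun n => ‖f j n‖) (ha : ∀ j, HasSum (f j) (a j)) :
    (Summable fun n : Fin M → ℕ => ‖∏ j, f j (n j)‖) ∧
      HasSum (fun n : Fin M → ℕ => ∏ j, f j (n j)) (∏ j, a j) := by
  induction M with
  | zero =>
    exact ⟨(hasSum_fintype _).summable, by simp⟩
  | succ M ih =>
    obtain ⟨h1, h2⟩ := ih (fun j => f j.succ) (fun j => a j.succ) (fun j => hf _) (fun j => ha _)
    have hn : Summable fun p : ℕ × (Fin M → ℕ) => ‖f 0 p.1‖ * ‖∏ j : Fin M, f j.succ (p.2 j)‖ :=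
      Summable.mul_of_nonneg (f := fun n => ‖f 0 n‖)
        (g := fun n : Fin M → ℕ => ‖∏ j : Fin M, f j.succ (n j)‖) (hf 0) h1
        (fun _ => norm_nonneg _) (fun _ => norm_nonneg _)
    refine ⟨?_, ?_⟩
    · rw [← (Fin.consEquiv fun _ => ℕ).summable_iff]
      refine hn.congr fun p => ?_
      simp [Fin.prod_univ_succ, Fin.consEquiv]
    · rw [← (Fin.consEquiv fun _ => ℕ).hasSum_iff, Fin.prod_univ_succ]
      have h3 := (ha 0).mul h2 (Summable.of_norm (by simpa only [norm_mul] using hn))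
      refine h3.congr_of_eq (fun p => ?_) rfl
      simp [Fin.prod_univ_succ, Fin.consEquiv]

theorem hasSum_pi_prod_pow {M : ℕ} (x : Fin M → ℂ) (hx : ∀ j, ‖x j‖ < 1) :
    (Summable fun n : Fin M → ℕ => ‖∏ j, x j ^ n j‖) ∧
      HasSum (fun n : Fin M → ℕ => ∏ j, x j ^ n j) (∏ j, (1 - x j)⁻¹) :=
  hasSum_pi_prod (fun j n => x j ^ n) _
    (fun j => by simpa using summable_geometric_of_lt_one (norm_nonneg _) (hx j))
    (fun j => hasSum_geometric_of_norm_lt_one (hx j))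

theorem prod_fin_eq_prod_Icc (M : ℕ) (f : ℕ → ℂ) :
    ∏ j : Fin M, f ((j : ℕ) + 1) = ∏ l ∈ Finset.Icc 1 M, f l := by
  rw [Fin.prod_univ_eq_prod_range (fun j => f (j + 1)), Finset.range_eq_Ico,
    Finset.prod_Ico_add' f 0 M 1]
  congr 1

theorem one_sub_eta_inv_im_pos {N : ℕ} (hN : 2 ≤ N) : 0 < ((1 - eta N)⁻¹).im := by
  have h1 : 0 < (eta N).im := by simpa using eta_pow_im_pos (N := N) (l := 1) le_rfl (by omega)
  have h2 : 1 - eta N ≠ 0 := sub_ne_zero.2 (eta_ne_one (by omega)).symm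
  rw [inv_im, sub_im, one_im, zero_sub, neg_neg]
  exact div_pos h1 (normSq_pos.2 h2)

/-- The expansion `-log(1 - q) = ∑ q^m / m` makes the logarithm of the product an absolutely
convergent double sum. Summing over `n` first gives a product of geometric series, which is
`(-1)^(N-1) coef N m`. -/
theorem hasProd_one_sub_cpow {N : ℕ} (hN : 2 ≤ N) :
    HasProd (fun n : Fin (N - 1) → ℕ =>
      (1 - e (-(1 - eta N)⁻¹) * e (∑ j, (1 + (n j : ℂ)) * eta N ^ ((j : ℕ) + 1))) ^ (-(1 / 2) : ℂ))
      (exp ((-1) ^ (N - 1) / 2 * ∑' m : ℕ, coef N (m + 1) / (m + 1))) := by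
  have hN0 : N ≠ 0 := by omega
  set w := (1 - eta N)⁻¹ with hw
  set c := e (-w) with hc
  set x : Fin (N - 1) → ℂ := fun j => e (eta N ^ ((j : ℕ) + 1)) with hxdef
  have hx : ∀ j, ‖x j‖ < 1 := fun j => by
    rw [norm_e, Real.exp_lt_one_iff, neg_neg_iff_pos]
    have := eta_pow_im_pos (N := N) (l := (j : ℕ) + 1) (by omega) (by omega)
    have := Real.pi_pos
    positivity
  set q : (Fin (N - 1) → ℕ) → ℂ := fun n => c * ∏ j, (x j * x j ^ n j) with hq
  have hqe : ∀ n : Fin (N - 1) → ℕ,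
      c * e (∑ j, (1 + (n j : ℂ)) * eta N ^ ((j : ℕ) + 1)) = q n := fun n => by
    simp only [hq, hxdef, e_sum, add_mul, one_mul, e_add, e_nat_mul]
  simp only [hqe]
  have hqnorm : Summable fun n => ‖q n‖ := by
    have := ((hasSum_pi_prod_pow x hx).1.mul_left (‖c‖ * ‖∏ j, x j‖))
    refine this.congr fun n => ?_
    simp only [hq, Finset.prod_mul_distrib, norm_mul]
    ring
  -- The largest `q n`, at `n = 0`, equals `e(w - 1)`, of modulus below `1` because `Im w > 0`; the
  -- factor `c = e(-w)` alone has modulus above `1`.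
  have hr : ‖c * ∏ j, x j‖ < 1 := by
    have h1 : c * ∏ j, x j = e (w - 1) := by
      rw [hc, hxdef, prod_fin_eq_prod_Icc (N - 1) (fun l => e (eta N ^ l)), ← e_sum, ← e_add]
      congr 1
      have h := sum_eta_pow hN0
      obtain ⟨M, hM⟩ := Nat.exists_eq_succ_of_ne_zero hN0
      have h2 : ∑ l ∈ Finset.Icc 1 (N - 1), eta N ^ l = ∑ l ∈ Finset.range M, eta N ^ (l + 1) := by
        rw [Finset.range_eq_Ico, Finset.sum_Ico_add' (fun l => eta N ^ l) 0 M 1, hM]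
        congr 1
      have h3 : ∑ l ∈ Finset.range N, eta N ^ l = ∑ l ∈ Finset.range M, eta N ^ (l + 1) + 1 := by
        conv_lhs => rw [show Finset.range N = Finset.range (M + 1) by rw [hM]]
        rw [Finset.sum_range_succ', pow_zero]
      rw [h2]
      linear_combination h - h3
    rw [h1, norm_e, Real.exp_lt_one_iff, neg_neg_iff_pos, sub_im, one_im, sub_zero]
    have := one_sub_eta_inv_im_pos hN
    have := Real.pi_pos
    positivity
  have hqr : ∀ n, ‖q n‖ ≤ ‖c * ∏ j, x j‖ := fun n => by
    simp only [hq, Finset.prod_mul_distrib, norm_mul, ← mul_assoc]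
    refine mul_le_of_le_one_right (by positivity) ?_
    rw [norm_prod]
    refine Finset.prod_le_one (fun _ _ => norm_nonneg _) fun j _ => ?_
    rw [norm_pow]
    exact pow_le_one₀ (norm_nonneg _) (hx j).le
  have hm0 : ∀ m : ℕ, ((m : ℂ) + 1) ≠ 0 := fun m => by exact_mod_cast Nat.succ_ne_zero m
  have hF : Summable fun p : (Fin (N - 1) → ℕ) × ℕ => q p.1 ^ (p.2 + 1) / ((p.2 : ℂ) + 1) := by
    refine Summable.of_norm_bounded (Summable.mul_of_nonneg hqnorm
      (summable_geometric_of_lt_one (norm_nonneg _) hr) (fun _ => norm_nonneg _)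
      (fun _ => by positivity)) ?_
    rintro ⟨n, m⟩
    dsimp only
    have h1 : (1 : ℝ) ≤ ‖((m : ℂ) + 1)‖ := by
      have : ((m : ℂ) + 1) = ((m + 1 : ℕ) : ℂ) := by push_cast; rfl
      rw [this, Complex.norm_natCast]
      exact_mod_cast Nat.succ_pos m
    rw [norm_div, norm_pow, pow_succ']
    refine (div_le_self (by positivity) h1).trans ?_
    gcongr
    exact hqr n
  have h1 : HasSum (fun n => -log (1 - q n)) (∑' p : (Fin (N - 1) → ℕ) × ℕ,
      q p.1 ^ (p.2 + 1) / ((p.2 : ℂ) + 1)) := by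
    refine hF.hasSum.prod_fiberwise fun n => ?_
    have h2 := hasSum_taylorSeries_neg_log ((hqr n).trans_lt hr)
    rw [← hasSum_nat_add_iff' 1] at h2
    simpa using h2
  have h2 : HasSum (fun m : ℕ => (-1) ^ (N - 1) * (coef N (m + 1) / (m + 1)))
      (∑' p : (Fin (N - 1) → ℕ) × ℕ, q p.1 ^ (p.2 + 1) / ((p.2 : ℂ) + 1)) := by
    have h3 := (Equiv.prodComm ℕ (Fin (N - 1) → ℕ)).hasSum_iff.2 hF.hasSum
    refine h3.prod_fiberwise fun m => ?_
    have h4 := (hasSum_pi_prod_pow (fun j => x j ^ (m + 1)) fun j => by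
      rw [norm_pow]
      exact pow_lt_one₀ (norm_nonneg _) (hx j) (by omega)).2
    have h5 := h4.mul_left ((c * ∏ j, x j) ^ (m + 1) / (m + 1))
    refine h5.congr_of_eq (fun n => ?_) ?_
    · simp only [Function.comp, Equiv.prodComm_apply, Prod.swap_prod_mk, hq,
        Finset.prod_mul_distrib, mul_pow, ← Finset.prod_pow]
      simp only [← pow_mul, mul_comm (m + 1)]
      ring
    · rw [← e_neg_div_prod_eq_coef hN0, ← hw, mul_pow, ← Finset.prod_pow,
        show (-(((m + 1 : ℕ) : ℂ) * w)) = ((m + 1 : ℕ) : ℂ) * -w by ring, e_nat_mul, ← hc,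
        ← prod_fin_eq_prod_Icc (N - 1) (fun l => 1 - e (-(((m + 1 : ℕ) : ℂ) * eta N ^ l)))]
      -- Here `x/(1 - x) = -1/(1 - x⁻¹)`; the `N - 1` signs produce `(-1)^(N-1)`.
      have h6 : ∀ j : Fin (N - 1), (x j ^ (m + 1)) * (1 - x j ^ (m + 1))⁻¹ =
          -(1 - e (-(((m + 1 : ℕ) : ℂ) * eta N ^ ((j : ℕ) + 1))))⁻¹ := fun j => by
        have h7 : e (-(((m + 1 : ℕ) : ℂ) * eta N ^ ((j : ℕ) + 1))) = (x j ^ (m + 1))⁻¹ := by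
          rw [hxdef, ← e_nat_mul, e, e, mul_neg, Complex.exp_neg]
        have h8 : x j ^ (m + 1) ≠ 0 := pow_ne_zero _ (e_ne_zero _)
        have h9 : 1 - x j ^ (m + 1) ≠ 0 := by
          intro h0
          have : ‖x j ^ (m + 1)‖ < 1 := by
            rw [norm_pow]
            exact pow_lt_one₀ (norm_nonneg _) (hx j) (by omega)
          rw [← sub_eq_zero.1 h0, norm_one] at this
          exact lt_irrefl _ this
        have h10 : 1 - (x j ^ (m + 1))⁻¹ = -((1 - x j ^ (m + 1)) / x j ^ (m + 1)) := by
          field_simp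
          ring
        rw [h7, h10, inv_neg, neg_neg, inv_div, div_eq_mul_inv]
      have h11 : (∏ j, x j ^ (m + 1)) * ∏ j, (1 - x j ^ (m + 1))⁻¹ = (-1) ^ (N - 1) *
          ∏ j : Fin (N - 1), (1 - e (-(((m + 1 : ℕ) : ℂ) * eta N ^ ((j : ℕ) + 1))))⁻¹ := by
        rw [← Finset.prod_mul_distrib, Finset.prod_congr rfl fun j _ => h6 j]
        simp only [neg_eq_neg_one_mul ((1 - e _)⁻¹), Finset.prod_mul_distrib, Finset.prod_const,
          Finset.card_univ, Fintype.card_fin]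
      rw [Finset.prod_inv_distrib (f := fun j : Fin (N - 1) =>
        1 - e (-(((m + 1 : ℕ) : ℂ) * eta N ^ ((j : ℕ) + 1))))] at h11
      rw [div_eq_mul_inv (c ^ (m + 1))]
      linear_combination -(c ^ (m + 1) / (m + 1)) * h11
  have h3 : HasSum (fun n => log (1 - q n) * (-(1 / 2)))
      ((-1) ^ (N - 1) / 2 * ∑' m : ℕ, coef N (m + 1) / (m + 1)) := by
    refine (h1.mul_left (1 / 2)).congr_of_eq (fun n => by ring) ?_
    rw [← h2.tsum_eq, tsum_mul_left]
    ring
  have h4 := h3.cexp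
  refine h4.congr_fun fun n => ?_
  rw [Function.comp, cpow_def_of_ne_zero]
  intro h0
  have := (hqr n).trans_lt hr
  rw [← sub_eq_zero.1 h0, norm_one] at this
  exact lt_irrefl _ this

open MeasureTheory

/-! ### The Mellin transform of `1 / (1 + x)` -/

theorem mellinConvergent_one_add_inv {a : ℂ} (h0 : 0 < a.re) (h1 : a.re < 1) :
    MellinConvergent (fun x : ℝ => ((1 + x : ℝ) : ℂ)⁻¹) a := by
  have hc : ContinuousOn (fun x : ℝ => ((1 + x : ℝ) : ℂ)⁻¹) (Set.Ioi 0) := by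
    refine ContinuousOn.inv₀ (by fun_prop) fun x hx => ?_
    have : (0 : ℝ) < x := hx
    exact_mod_cast (by positivity : (1 + x : ℝ) ≠ 0)
  refine mellinConvergent_of_isBigO_rpow (a := 1) (b := 0)
    (hc.locallyIntegrableOn measurableSet_Ioi) ?_ h1 ?_ h0
  · refine Asymptotics.IsBigO.of_bound 1 ?_
    filter_upwards [eventually_gt_atTop 0] with x hx
    rw [norm_inv, norm_real, Real.rpow_neg_one, norm_inv, one_mul, Real.norm_of_nonneg (by positivity),
      Real.norm_of_nonneg hx.le]
    exact inv_anti₀ hx (by linarith)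
  · refine Asymptotics.IsBigO.of_bound 1 ?_
    filter_upwards [self_mem_nhdsWithin] with x hx
    have : (0 : ℝ) < x := hx
    rw [norm_inv, norm_real, neg_zero, Real.rpow_zero, norm_one, one_mul,
      Real.norm_of_nonneg (by positivity)]
    exact inv_le_one_of_one_le₀ (by linarith)

/-- Writing `1/(1+x) = ∫ e^(-(1+x)y) dy` and applying Fubini turns the transform into `Γ(a) Γ(1 -
a)`, and the reflection formula concludes. -/
theorem mellin_one_add_inv {a : ℂ} (h0 : 0 < a.re) (h1 : a.re < 1) :
    mellin (fun x : ℝ => ((1 + x : ℝ) : ℂ)⁻¹) a = Real.pi / sin (Real.pi * a) := by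
  set F : ℝ → ℝ → ℂ := fun x y => (x : ℂ) ^ (a - 1) * (Real.exp (-((1 + x) * y)) : ℂ) with hF
  set μ := (volume : Measure ℝ).restrict (Set.Ioi 0) with hμ
  have hconv := mellinConvergent_one_add_inv h0 h1
  have hexp : ∀ x ∈ Set.Ioi (0 : ℝ), ∫ y, Real.exp (-((1 + x) * y)) ∂μ = (1 + x)⁻¹ := fun x hx => by
    have hx' : (0 : ℝ) < 1 + x := by have : (0 : ℝ) < x := hx; linarith
    have := integral_exp_mul_Ioi (a := -(1 + x)) (by linarith) 0
    simp only [mul_zero, Real.exp_zero, neg_mul, neg_div_neg_eq, one_div] at this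
    exact this
  have hexpi : ∀ x ∈ Set.Ioi (0 : ℝ), Integrable (fun y => Real.exp (-((1 + x) * y))) μ :=
    fun x hx => by
      have hx' : (0 : ℝ) < 1 + x := by have : (0 : ℝ) < x := hx; linarith
      have := integrableOn_exp_mul_Ioi (a := -(1 + x)) (by linarith) 0
      simp only [neg_mul] at this
      exact this
  have hmeas : AEStronglyMeasurable (Function.uncurry F) (μ.prod μ) := by
    refine Measurable.aestronglyMeasurable ?_
    simp only [hF]
    fun_prop
  have hint : Integrable (Function.uncurry F) (μ.prod μ) := by
    rw [integrable_prod_iff hmeas]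
    refine ⟨?_, ?_⟩
    · filter_upwards [ae_restrict_mem measurableSet_Ioi] with x hx
      have := ((hexpi x hx).ofReal (𝕜 := ℂ)).const_mul ((x : ℂ) ^ (a - 1))
      exact this
    · refine hconv.norm.congr ?_
      filter_upwards [ae_restrict_mem measurableSet_Ioi] with x hx
      have hx' : (0 : ℝ) < 1 + x := by have : (0 : ℝ) < x := hx; linarith
      simp only [Function.uncurry, hF, norm_mul, norm_real, Real.norm_eq_abs, Real.abs_exp]
      rw [integral_const_mul, hexp x hx, norm_smul, norm_inv, norm_real, Real.norm_of_nonneg hx'.le]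
  have hswap := integral_integral_swap hint
  have hleft : ∫ x, ∫ y, F x y ∂μ ∂μ = mellin (fun x : ℝ => ((1 + x : ℝ) : ℂ)⁻¹) a := by
    refine setIntegral_congr_fun measurableSet_Ioi fun x hx => ?_
    simp only [hF]
    rw [integral_const_mul, integral_complex_ofReal, hexp x hx, ofReal_inv, smul_eq_mul]
  have hright : ∫ y, ∫ x, F x y ∂μ ∂μ = Complex.Gamma a * Complex.Gamma (1 - a) := by
    rw [Complex.Gamma_eq_integral (by simpa using h1 : 0 < (1 - a).re), GammaIntegral, ← integral_const_mul]
    refine setIntegral_congr_fun measurableSet_Ioi fun y hy => ?_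
    have hy' : (0 : ℝ) < y := hy
    have h2 : ∀ x : ℝ, F x y = (Real.exp (-y) : ℂ) * ((x : ℂ) ^ (a - 1) * exp (-(y * x))) := fun x => by
      simp only [hF]
      rw [show -((1 + x) * y) = -y + -(y * x) by ring, Real.exp_add]
      push_cast
      ring
    simp only [h2]
    rw [integral_const_mul, integral_cpow_mul_exp_neg_mul_Ioi h0 (by simpa using hy')]
    have h3 : (1 / (y : ℂ)) ^ a = (y : ℂ) ^ (1 - a - 1) := by
      rw [one_div, inv_cpow _ _ (by rw [arg_ofReal_of_nonneg hy'.le]; exact Real.pi_pos.ne),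
        show 1 - a - 1 = -a by ring, cpow_neg]
    rw [h3]
    ring
  rw [← hleft, hswap, hright, Complex.Gamma_mul_Gamma_one_sub]

/-- Reduces to `1/(1 + x)` by scaling by `n` and substituting `x ↦ x^M`. -/
theorem mellin_pow_add_inv {M : ℕ} (hM : M ≠ 0) {n : ℝ} (hn : 0 < n) {s : ℂ} (h0 : 0 < s.re)
    (h1 : s.re < M) :
    MellinConvergent (fun x : ℝ => ((x ^ M + n ^ M : ℝ) : ℂ)⁻¹) s ∧
    mellin (fun x : ℝ => ((x ^ M + n ^ M : ℝ) : ℂ)⁻¹) s =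
      (n : ℂ) ^ (s - M) * (Real.pi / (M * sin (Real.pi * s / M))) := by
  have hM0 : (0 : ℝ) < M := by exact_mod_cast Nat.pos_of_ne_zero hM
  have hre : (s / (M : ℝ)).re = s.re / M := by rw [div_ofReal_re]
  have ha0 : 0 < (s / (M : ℝ)).re := by rw [hre]; positivity
  have ha1 : (s / (M : ℝ)).re < 1 := by rw [hre, div_lt_one hM0]; exact h1
  set h : ℝ → ℂ := fun x => ((1 + x : ℝ) : ℂ)⁻¹ with hh
  set k : ℝ → ℂ := fun x => h (x ^ (M : ℝ)) with hk
  have heq : (fun x : ℝ => ((x ^ M + n ^ M : ℝ) : ℂ)⁻¹) =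
      fun x => ((n : ℂ) ^ M)⁻¹ • k (n⁻¹ * x) := by
    funext x
    simp only [hk, hh, Real.rpow_natCast, smul_eq_mul]
    rw [← mul_inv]
    congr 1
    have : (n : ℂ) ≠ 0 := by exact_mod_cast hn.ne'
    push_cast
    rw [mul_add, mul_one, mul_pow, ← mul_assoc, ← mul_pow, mul_inv_cancel₀ this, one_pow, one_mul,
      add_comm]
  have hkc : MellinConvergent k s := by
    rw [hk, MellinConvergent.comp_rpow hM0.ne']
    exact mellinConvergent_one_add_inv ha0 ha1
  have hkm : mellin k s = (M : ℂ)⁻¹ * (Real.pi / sin (Real.pi * s / M)) := by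
    rw [hk, mellin_comp_rpow, mellin_one_add_inv ha0 ha1, abs_of_pos hM0, real_smul]
    push_cast
    rw [mul_div_assoc]
  have hinv : (0 : ℝ) < n⁻¹ := inv_pos.2 hn
  rw [heq]
  refine ⟨((MellinConvergent.comp_mul_left hinv).2 hkc).const_smul _, ?_⟩
  rw [mellin_const_smul, mellin_comp_mul_left _ _ hinv, hkm]
  have hnc : (n : ℂ) ≠ 0 := by exact_mod_cast hn.ne'
  have h2 : ((n⁻¹ : ℝ) : ℂ) ^ (-s) = (n : ℂ) ^ s := by
    rw [ofReal_inv, inv_cpow _ _ (by rw [arg_ofReal_of_nonneg hn.le]; exact Real.pi_pos.ne),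
      cpow_neg, inv_inv]
  rw [h2, cpow_sub _ _ hnc, cpow_natCast, smul_eq_mul, smul_eq_mul]
  field_simp

/-! ### The kernel of the Mellin integral -/

/-- The points `exp (π i (2j + 1) / 2N)`, halfway between consecutive powers of `eta N`. -/
noncomputable def theta (N j : ℕ) : ℂ := exp ((Real.pi * (2 * j + 1) / (2 * N) : ℝ) * I)

theorem theta_eq_mul {N : ℕ} (hN : N ≠ 0) (j : ℕ) : theta N j = theta N 0 * eta N ^ j := by
  have : (N : ℂ) ≠ 0 := by exact_mod_cast hN
  rw [eta_pow, theta, theta, ← Complex.exp_add]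
  congr 1
  push_cast
  field_simp
  ring

theorem theta_ne_zero (N j : ℕ) : theta N j ≠ 0 := exp_ne_zero _

theorem theta_zero_pow {N : ℕ} (hN : N ≠ 0) : theta N 0 ^ N = I := by
  have : (N : ℂ) ≠ 0 := by exact_mod_cast hN
  rw [theta, ← exp_nat_mul]
  have h : (N * ((Real.pi * (2 * (0 : ℕ) + 1) / (2 * N) : ℝ) * I) : ℂ) = Real.pi / 2 * I := by
    push_cast
    field_simp
    ring
  rw [h, exp_pi_div_two_mul_I]

theorem theta_im_pos {N j : ℕ} (hj : j < N) : 0 < (theta N j).im := by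
  have hN : (0 : ℝ) < N := by exact_mod_cast (by omega : 0 < N)
  have hj' : (j : ℝ) + 1 ≤ N := by exact_mod_cast hj
  rw [theta, exp_ofReal_mul_I_im]
  have := Real.pi_pos
  apply Real.sin_pos_of_pos_of_lt_pi
  · positivity
  · rw [mul_div_assoc]
    exact mul_lt_of_lt_one_right Real.pi_pos ((div_lt_one (by positivity)).2 (by linarith))

theorem norm_e_mul_theta_lt_one {N j : ℕ} (hj : j < N) {T : ℝ} (hT : 0 < T) :
    ‖e (T * theta N j)‖ < 1 := by
  rw [norm_e, Real.exp_lt_one_iff, neg_neg_iff_pos, im_ofReal_mul]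
  have := theta_im_pos hj
  have := Real.pi_pos
  positivity

theorem one_sub_ne_zero_of_norm_lt_one {z : ℂ} (hz : ‖z‖ < 1) : 1 - z ≠ 0 := by
  intro h
  rw [← sub_eq_zero.1 h, norm_one] at hz
  exact lt_irrefl _ hz

/-- The function `∏_j 1 / (2 sinh (π β_j T))` with `β_j = -i theta_j`. -/
noncomputable def kernel (N : ℕ) (T : ℝ) : ℂ :=
  ∏ j : Fin N, (e (T * theta N j / 2) * (1 - e (T * theta N j))⁻¹)

/-- The points `∑ (1 / 2 + m_j) β_j` with `β_j = -i theta_j`. -/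
noncomputable def latticePoint (N : ℕ) (m : Fin N → ℕ) : ℂ :=
  ∑ j : Fin N, (1 / 2 + (m j : ℂ)) * (-I * theta N j)

theorem hasSum_kernel (N : ℕ) {T : ℝ} (hT : 0 < T) :
    HasSum (fun m : Fin N → ℕ => exp (-(2 * Real.pi * latticePoint N m * T))) (kernel N T) := by
  have h := (hasSum_pi_prod_pow (fun j : Fin N => e (T * theta N j))
    fun j => norm_e_mul_theta_lt_one j.2 hT).2.mul_left (∏ j : Fin N, e (T * theta N j / 2))
  refine h.congr_of_eq (fun m => ?_) ?_
  · rw [← Finset.prod_mul_distrib]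
    simp only [← e_nat_mul, ← e_add]
    rw [← e_sum, e, latticePoint]
    congr 1
    simp only [Finset.mul_sum, Finset.sum_mul, ← Finset.sum_neg_distrib]
    exact Finset.sum_congr rfl fun j _ => by ring
  · rw [kernel, Finset.prod_mul_distrib]

/-- Since `θ_j = θ_0 η^j`, the kernel is the sine product of `gen N` on the ray through `θ_0`,
without its numerators `(θ_0 T)^N = i T^N`. -/
theorem kernel_eq_gen {N : ℕ} (hN : N ≠ 0) {T : ℝ} (hT : 0 < T) :
    kernel N T = ((-1) ^ N * I⁻¹) • ((T : ℂ) ^ (-(N : ℂ)) • gen N (theta N 0 * T)) := by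
  have hTc : (T : ℂ) ≠ 0 := by exact_mod_cast hT.ne'
  have h1 : ∀ j : Fin N, e (T * theta N j / 2) * (1 - e (T * theta N j))⁻¹ =
      -1 * (theta N 0 * T)⁻¹ * ((theta N 0 * T) /
        (2 * I * sin (Real.pi * ((theta N 0 * T) * eta N ^ (j : ℕ))))) := fun j => by
    have h2 := one_sub_e_neg (-(T * theta N j))
    rw [neg_neg, neg_div, neg_neg] at h2
    have h3 : e (T * theta N j / 2) ≠ 0 := e_ne_zero _
    have h4 : theta N 0 ≠ 0 := theta_ne_zero N 0
    rw [h2, mul_inv, mul_inv_cancel_left₀ h3, theta_eq_mul hN,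
      show (Real.pi * -(T * (theta N 0 * eta N ^ (j : ℕ)))) =
      -(Real.pi * ((theta N 0 * T) * eta N ^ (j : ℕ))) by ring, sin_neg, mul_neg, inv_neg,
      mul_assoc (-1), div_eq_mul_inv, inv_mul_cancel_left₀ (mul_ne_zero h4 hTc), neg_one_mul]
  rw [kernel, Finset.prod_congr rfl fun j _ => h1 j, Finset.prod_mul_distrib, Finset.prod_const,
    Finset.card_univ, Fintype.card_fin, Fin.prod_univ_eq_prod_range (fun j : ℕ => (theta N 0 * T) /
        (2 * I * sin (Real.pi * ((theta N 0 * T) * eta N ^ j)))),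
    ← gen_of_ne N (mul_ne_zero (theta_ne_zero N 0) hTc), mul_pow, inv_pow, mul_pow,
    theta_zero_pow hN, cpow_neg, cpow_natCast, smul_eq_mul, smul_eq_mul, mul_inv]
  ring

theorem continuousOn_kernel (N : ℕ) : ContinuousOn (kernel N) (Set.Ioi 0) := by
  refine continuousOn_finsetProd _ fun j _ => ?_
  have he : Continuous e := by unfold e; fun_prop
  refine ContinuousOn.mul (by fun_prop) (ContinuousOn.inv₀ (by fun_prop) fun T hT => ?_)
  exact one_sub_ne_zero_of_norm_lt_one (norm_e_mul_theta_lt_one j.2 hT)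

theorem kernel_isBigO_atTop {N : ℕ} (hN : N ≠ 0) :
    ∃ a > 0, kernel N =O[atTop] fun T => Real.exp (-a * T) := by
  set y : Fin N → ℝ := fun j => Real.pi * (theta N j).im with hy
  have hy0 : ∀ j, 0 < y j := fun j => mul_pos Real.pi_pos (theta_im_pos j.2)
  have : Nonempty (Fin N) := ⟨⟨0, Nat.pos_of_ne_zero hN⟩⟩
  refine ⟨∑ j, y j, Finset.sum_pos (fun j _ => hy0 j) Finset.univ_nonempty,
    Asymptotics.IsBigO.of_bound (∏ j, (1 - Real.exp (-(2 * y j)))⁻¹) ?_⟩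
  filter_upwards [eventually_ge_atTop 1] with T hT
  have hT0 : 0 < T := by linarith
  have h1 : Real.exp (-(∑ j, y j) * T) = ∏ j, Real.exp (-(y j) * T) := by
    rw [← Real.exp_sum, ← Finset.sum_mul, Finset.sum_neg_distrib]
  rw [Real.norm_of_nonneg (Real.exp_pos _).le, h1, kernel, norm_prod, ← Finset.prod_mul_distrib]
  refine Finset.prod_le_prod (fun _ _ => norm_nonneg _) fun j _ => ?_
  have h2 : ‖e (T * theta N j / 2)‖ = Real.exp (-(y j) * T) := by
    rw [norm_e]
    congr 1
    have : (T * theta N j / 2 : ℂ).im = T * (theta N j).im / 2 := by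
      rw [show (T * theta N j / 2 : ℂ) = ((T / 2 : ℝ) : ℂ) * theta N j by push_cast; ring,
        im_ofReal_mul]
      ring
    rw [this, hy]
    ring
  have h3 : 1 - Real.exp (-(2 * y j)) ≤ ‖1 - e (T * theta N j)‖ := by
    have h4 := norm_sub_norm_le 1 (e (T * theta N j))
    rw [norm_one, norm_e, im_ofReal_mul] at h4
    refine le_trans (sub_le_sub_left (Real.exp_le_exp.2 ?_) 1) h4
    have : y j * 1 ≤ y j * T := mul_le_mul_of_nonneg_left hT (hy0 j).le
    have h5 : 2 * Real.pi * (T * (theta N j).im) = 2 * (y j * T) := by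
      simp only [hy]
      ring
    rw [h5]
    linarith
  have h5 : 0 < 1 - Real.exp (-(2 * y j)) := by
    have := hy0 j
    rw [sub_pos, Real.exp_lt_one_iff]
    linarith
  rw [norm_mul, h2, norm_inv, mul_comm]
  exact mul_le_mul_of_nonneg_right (inv_anti₀ h5 h3) (Real.exp_pos _).le

theorem continuousAt_gen_zero (N : ℕ) : ContinuousAt (gen N) 0 :=
  (differentiableAt_gen fun m l _ => (pole_ne_zero N m l).symm).continuousAt

theorem kernel_isBigO_zero {N : ℕ} (hN : N ≠ 0) :
    kernel N =O[𝓝[>] 0] fun T => T ^ (-(N : ℝ)) := by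
  have h1 : (fun T : ℝ => gen N (theta N 0 * T)) =O[𝓝[>] 0] fun _ => (1 : ℝ) := by
    have h2 : ContinuousAt (fun T : ℝ => gen N (theta N 0 * T)) 0 := by
      refine ContinuousAt.comp (g := gen N) ?_ (by fun_prop)
      simpa using continuousAt_gen_zero N
    exact (h2.tendsto.isBigO_one ℝ).mono nhdsWithin_le_nhds
  have h3 : (fun T : ℝ => (T : ℂ) ^ (-(N : ℂ))) =O[𝓝[>] 0] fun T => T ^ (-(N : ℝ)) := by
    refine Asymptotics.IsBigO.of_bound 1 ?_
    filter_upwards [self_mem_nhdsWithin] with T hT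
    rw [norm_cpow_eq_rpow_re_of_pos hT, one_mul, Real.norm_of_nonneg (Real.rpow_nonneg (le_of_lt hT) _)]
    simp
  have h4 := (h3.smul h1).const_smul_left ((-1 : ℂ) ^ N * I⁻¹)
  refine (h4.congr' ?_ ?_)
  · filter_upwards [self_mem_nhdsWithin] with T hT
    exact (kernel_eq_gen hN hT).symm
  · exact Eventually.of_forall fun T => by simp

theorem differentiableAt_mellin_kernel {N : ℕ} (hN : N ≠ 0) {s : ℂ} (hs : (N : ℝ) < s.re) :
    DifferentiableAt ℂ (mellin (kernel N)) s := by
  obtain ⟨a, ha, h⟩ := kernel_isBigO_atTop hN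
  exact mellin_differentiableAt_of_isBigO_rpow_exp ha
    ((continuousOn_kernel N).locallyIntegrableOn measurableSet_Ioi) h (kernel_isBigO_zero hN) hs

/-! ### The Mellin transform as a sum over the lattice -/

theorem latticePoint_re (N : ℕ) (m : Fin N → ℕ) :
    (latticePoint N m).re = ∑ j : Fin N, (1 / 2 + (m j : ℝ)) * (theta N j).im := by
  rw [latticePoint, re_sum]
  refine Finset.sum_congr rfl fun j _ => ?_
  rw [show (1 / 2 + (m j : ℂ)) = ((1 / 2 + (m j : ℝ) : ℝ) : ℂ) by push_cast; rfl, re_ofReal_mul]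
  congr 1
  simp

theorem latticePoint_re_pos {N : ℕ} (hN : N ≠ 0) (m : Fin N → ℕ) : 0 < (latticePoint N m).re := by
  have : Nonempty (Fin N) := ⟨⟨0, Nat.pos_of_ne_zero hN⟩⟩
  rw [latticePoint_re]
  refine Finset.sum_pos (fun j _ => mul_pos (by positivity) (theta_im_pos j.2)) Finset.univ_nonempty

/-- The real part dominates `y_j (m_j + 1)` for every `j`. Splitting the exponent `-σ` equally among
the `N` coordinates bounds the term by a product of one-variable series with exponent `σ/N > 1`. -/
theorem summable_latticePoint_re_rpow {N : ℕ} (hN : N ≠ 0) {σ : ℝ} (hσ : (N : ℝ) < σ) :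
    Summable fun m : Fin N → ℕ => (latticePoint N m).re ^ (-σ) := by
  have hN0 : (0 : ℝ) < N := by exact_mod_cast Nat.pos_of_ne_zero hN
  have hσN : 1 < σ / N := (one_lt_div hN0).2 hσ
  set y : Fin N → ℝ := fun j => (theta N j).im / 2 with hy
  have hy0 : ∀ j, 0 < y j := fun j => half_pos (theta_im_pos j.2)
  have h1 : ∀ j : Fin N, Summable fun n : ℕ => (y j * (n + 1)) ^ (-(σ / N)) := fun j => by
    have h2 := (summable_nat_add_iff 1).2 (Real.summable_nat_rpow.2 (by linarith : -(σ / N) < -1))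
    refine (h2.mul_left (y j ^ (-(σ / N)))).congr fun n => ?_
    rw [Real.mul_rpow (hy0 j).le (by positivity)]
    push_cast
    rfl
  have h2 := (hasSum_pi_prod (fun j n => (((y j * (n + 1)) ^ (-(σ / N)) : ℝ) : ℂ)) _ (fun j => by
    have := (h1 j).norm
    simpa only [norm_real] using this) (fun j => by
      have := Complex.hasSum_ofReal.2 (h1 j).hasSum
      exact this)).1
  refine Summable.of_nonneg_of_le (fun m => Real.rpow_nonneg (latticePoint_re_pos hN m).le _)
    (fun m => ?_) h2
  have hpos := latticePoint_re_pos hN m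
  have h3 : ∀ j, y j * (m j + 1) ≤ (latticePoint N m).re := fun j => by
    rw [latticePoint_re]
    refine le_trans ?_ (Finset.single_le_sum (f := fun j : Fin N =>
      (1 / 2 + (m j : ℝ)) * (theta N j).im) (fun j _ => ?_) (Finset.mem_univ j))
    · simp only [hy]
      have h4 := theta_im_pos j.2
      have h5 : (0 : ℝ) ≤ m j := Nat.cast_nonneg _
      nlinarith
    · exact mul_nonneg (by positivity) (theta_im_pos j.2).le
  rw [norm_prod]
  have h4 : (latticePoint N m).re ^ (-σ) =
      ∏ _j : Fin N, (latticePoint N m).re ^ (-(σ / N)) := by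
    rw [Finset.prod_const, Finset.card_univ, Fintype.card_fin, ← Real.rpow_natCast,
      ← Real.rpow_mul hpos.le, neg_mul, div_mul_cancel₀ _ hN0.ne']
  rw [h4]
  refine Finset.prod_le_prod (fun _ _ => Real.rpow_nonneg hpos.le _) fun j _ => ?_
  have h5 : 0 < y j * ((m j : ℝ) + 1) := mul_pos (hy0 j) (by positivity)
  rw [norm_real, Real.norm_of_nonneg (Real.rpow_nonneg h5.le _)]
  exact Real.rpow_le_rpow_of_nonpos h5 (h3 j) (by linarith)

theorem integrableOn_cpow_mul_exp {s r : ℂ} (hs : 0 < s.re) (hr : 0 < r.re) :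
    IntegrableOn (fun t : ℝ => (t : ℂ) ^ (s - 1) * exp (-(r * t))) (Set.Ioi 0) ∧
    ∫ t in Set.Ioi (0 : ℝ), ‖(t : ℂ) ^ (s - 1) * exp (-(r * t))‖ =
      (1 / r.re) ^ s.re * Real.Gamma s.re := by
  have h1 : ∀ t ∈ Set.Ioi (0 : ℝ), ‖(t : ℂ) ^ (s - 1) * exp (-(r * t))‖ =
      t ^ (s.re - 1) * Real.exp (-(r.re * t)) := fun t ht => by
    rw [norm_mul, norm_cpow_eq_rpow_re_of_pos ht, norm_exp]
    simp
  have h2 : IntegrableOn (fun t : ℝ => t ^ (s.re - 1) * Real.exp (-(r.re * t))) (Set.Ioi 0) := by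
    have := integrableOn_rpow_mul_exp_neg_mul_rpow (s := s.re - 1) (p := 1) (b := r.re)
      (by linarith) one_pos hr
    simpa only [Real.rpow_one, neg_mul] using this
  refine ⟨?_, ?_⟩
  · refine h2.mono' ?_ ?_
    · refine Measurable.aestronglyMeasurable ?_
      fun_prop
    · filter_upwards [ae_restrict_mem measurableSet_Ioi] with t ht
      rw [h1 t ht]
  · rw [setIntegral_congr_fun measurableSet_Ioi h1]
    exact Real.integral_rpow_mul_exp_neg_mul_Ioi hs hr

theorem differentiableAt_integral_cpow_mul_exp {s r : ℂ} (hs : 0 < s.re) (hr : 0 < r.re) :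
    DifferentiableAt ℂ
      (fun r : ℂ => ∫ t in Set.Ioi (0 : ℝ), (t : ℂ) ^ (s - 1) * exp (-(r * t))) r := by
  have hs1 : 0 < (s + 1).re := by
    rw [add_re, one_re]
    linarith
  have hr2 : 0 < ((r.re / 2 : ℝ) : ℂ).re := by
    rw [ofReal_re]
    linarith
  have hnhds : {z : ℂ | r.re / 2 < z.re} ∈ 𝓝 r :=
    (isOpen_lt continuous_const continuous_re).mem_nhds (by simpa using hr)
  have hmeas : ∀ z : ℂ, AEStronglyMeasurable (fun t : ℝ => (t : ℂ) ^ (s - 1) * exp (-(z * t)))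
      (volume.restrict (Set.Ioi 0)) := fun z => by
    refine Measurable.aestronglyMeasurable ?_
    fun_prop
  -- On `Re z > Re r / 2` the factor `t` created by differentiation is absorbed by replacing `s`
  -- with `s + 1`, and the rate is halved.
  have h := hasDerivAt_integral_of_dominated_loc_of_deriv_le
    (μ := (volume : Measure ℝ).restrict (Set.Ioi 0)) (x₀ := r)
    (F := fun (z : ℂ) (t : ℝ) => (t : ℂ) ^ (s - 1) * exp (-(z * t)))
    (F' := fun (z : ℂ) (t : ℝ) => (t : ℂ) ^ (s - 1) * (exp (-(z * t)) * -t))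
    (bound := fun t : ℝ => ‖(t : ℂ) ^ (s + 1 - 1) * exp (-(((r.re / 2 : ℝ) : ℂ) * t))‖)
    hnhds (Eventually.of_forall hmeas) (integrableOn_cpow_mul_exp hs hr).1 ?_ ?_
    (integrableOn_cpow_mul_exp hs1 hr2).1.norm ?_
  · exact h.2.differentiableAt
  · refine Measurable.aestronglyMeasurable ?_
    fun_prop
  · filter_upwards [ae_restrict_mem measurableSet_Ioi] with t ht z hz
    have ht0 : (0 : ℝ) < t := ht
    rw [norm_mul, norm_mul, norm_mul, norm_cpow_eq_rpow_re_of_pos ht0,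
      norm_cpow_eq_rpow_re_of_pos ht0, norm_exp, norm_exp, norm_neg, norm_real,
      Real.norm_of_nonneg ht0.le]
    have h1 : t ^ (s + 1 - 1).re = t ^ (s - 1).re * t := by
      rw [show (s + 1 - 1).re = (s - 1).re + 1 by simp, Real.rpow_add_one ht0.ne']
    rw [h1, mul_assoc, mul_comm t]
    refine mul_le_mul_of_nonneg_left (mul_le_mul_of_nonneg_right (Real.exp_le_exp.2 ?_) ht0.le)
      (Real.rpow_nonneg ht0.le _)
    simp only [neg_re, re_mul_ofReal, ofReal_re]
    have hz' : r.re / 2 < z.re := hz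
    nlinarith
  · filter_upwards [ae_restrict_mem measurableSet_Ioi] with t ht z hz
    have h1 : HasDerivAt (fun z : ℂ => -(z * t)) (-(1 * (t : ℂ))) z :=
      ((hasDerivAt_id z).mul_const (t : ℂ)).neg
    rw [one_mul] at h1
    exact h1.cexp.const_mul _

/-- The Gamma integral along a complex direction. -/
theorem integral_cpow_mul_exp_neg_mul_complex {s r : ℂ} (hs : 0 < s.re) (hr : 0 < r.re) :
    ∫ t in Set.Ioi (0 : ℝ), (t : ℂ) ^ (s - 1) * exp (-(r * t)) = r ^ (-s) * Complex.Gamma s := by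
  set U : Set ℂ := {z | 0 < z.re} with hU
  have hUo : IsOpen U := isOpen_lt continuous_const continuous_re
  have hUc : IsPreconnected U := (convex_halfSpace_re_gt 0).isPreconnected
  have h1 : AnalyticOnNhd ℂ
      (fun r : ℂ => ∫ t in Set.Ioi (0 : ℝ), (t : ℂ) ^ (s - 1) * exp (-(r * t))) U :=
    DifferentiableOn.analyticOnNhd
      (fun z hz => (differentiableAt_integral_cpow_mul_exp hs hz).differentiableWithinAt) hUo
  have h2 : AnalyticOnNhd ℂ (fun r : ℂ => r ^ (-s) * Complex.Gamma s) U :=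
    DifferentiableOn.analyticOnNhd (fun z hz => by
      refine DifferentiableAt.differentiableWithinAt ?_
      exact (differentiableAt_id.cpow_const (Or.inl hz)).mul_const _) hUo
  have h3 : ∀ x : ℝ, 0 < x →
      ∫ t in Set.Ioi (0 : ℝ), (t : ℂ) ^ (s - 1) * exp (-((x : ℂ) * t)) =
        (x : ℂ) ^ (-s) * Complex.Gamma s := fun x hx => by
    rw [integral_cpow_mul_exp_neg_mul_Ioi hs hx, one_div, inv_cpow _ _ (by
      rw [arg_ofReal_of_nonneg hx.le]; exact Real.pi_pos.ne), cpow_neg]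
  -- Identity theorem on the right half-plane: both sides agree at positive reals, which accumulate
  -- at `1`.
  refine h1.eqOn_of_preconnected_of_frequently_eq h2 hUc (z₀ := 1) (by simp [hU]) ?_ hr
  have h4 : Tendsto (fun x : ℝ => (x : ℂ)) (𝓝[≠] 1) (𝓝[≠] 1) := by
    refine tendsto_nhdsWithin_iff.2 ⟨?_, ?_⟩
    · have : Tendsto (fun x : ℝ => (x : ℂ)) (𝓝 1) (𝓝 ((1 : ℝ) : ℂ)) := continuous_ofReal.tendsto 1
      rw [ofReal_one] at this
      exact this.mono_left nhdsWithin_le_nhds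
    · filter_upwards [self_mem_nhdsWithin] with x hx
      have : x ≠ 1 := hx
      simpa using this
  refine h4.frequently (Eventually.frequently ?_)
  have h5 : ∀ᶠ x : ℝ in 𝓝[≠] 1, 0 < x := nhdsWithin_le_nhds (lt_mem_nhds one_pos)
  filter_upwards [h5] with x hx
  exact h3 x hx

/-- As `arg x` lies strictly between `-π/2` and `π/2`, adding `θ` stays in `(-π, π]`, so principal
logarithms add. -/
theorem exp_mul_I_mul_cpow {x : ℂ} (hx : 0 < x.re) {θ : ℝ} (h0 : -(Real.pi / 2) < θ)
    (h1 : θ ≤ Real.pi / 2) (s : ℂ) : (exp (θ * I) * x) ^ s = exp (θ * I * s) * x ^ s := by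
  have hx0 : x ≠ 0 := by
    rintro rfl
    simp at hx
  have hθ : log (exp (θ * I)) = θ * I := by
    rw [log_exp] <;> simp <;> linarith [Real.pi_pos]
  have harg : arg (exp (θ * I)) = θ := by
    rw [arg_exp_mul_I, toIocMod_eq_self]
    constructor <;> linarith [Real.pi_pos]
  have h2 := abs_lt.1 (abs_arg_lt_pi_div_two_iff.2 (Or.inl hx))
  have hlog : log (exp (θ * I) * x) = θ * I + log x := by
    rw [(log_mul_eq_add_log_iff (exp_ne_zero _) hx0).2, hθ]
    rw [harg]
    constructor <;> linarith
  rw [cpow_def_of_ne_zero (mul_ne_zero (exp_ne_zero _) hx0), cpow_def_of_ne_zero hx0, hlog, add_mul,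
    Complex.exp_add]

/-- Each power is a Gamma integral over `t`; summing under the integral sign collects the
exponentials into the kernel. -/
theorem hasSum_latticePoint_cpow {N : ℕ} (hN : N ≠ 0) {s : ℂ} (hs : (N : ℝ) < s.re) :
    HasSum (fun m : Fin N → ℕ => latticePoint N m ^ (-s))
      ((2 * Real.pi : ℂ) ^ s * mellin (kernel N) s / Complex.Gamma s) := by
  have hN0 : (0 : ℝ) < N := by exact_mod_cast Nat.pos_of_ne_zero hN
  have hs0 : 0 < s.re := hN0.trans hs
  have h2pi : (0 : ℝ) < 2 * Real.pi := Real.two_pi_pos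
  have hre : ∀ m : Fin N → ℕ, (2 * Real.pi * latticePoint N m : ℂ).re =
      2 * Real.pi * (latticePoint N m).re := fun m => by
    rw [show (2 * Real.pi : ℂ) = ((2 * Real.pi : ℝ) : ℂ) by push_cast; rfl, re_ofReal_mul]
  have hpos : ∀ m : Fin N → ℕ, 0 < (2 * Real.pi * latticePoint N m : ℂ).re := fun m => by
    rw [hre]
    exact mul_pos h2pi (latticePoint_re_pos hN m)
  have h1 := hasSum_integral_of_summable_integral_norm
    (μ := (volume : Measure ℝ).restrict (Set.Ioi 0))
    (F := fun (m : Fin N → ℕ) (t : ℝ) =>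
      (t : ℂ) ^ (s - 1) * exp (-(2 * Real.pi * latticePoint N m * t)))
    (fun m => (integrableOn_cpow_mul_exp hs0 (hpos m)).1) (by
      have h2 := ((summable_latticePoint_re_rpow hN hs).mul_left ((2 * Real.pi) ^ (-s.re))).mul_right
        (Real.Gamma s.re)
      refine h2.congr fun m => ?_
      rw [(integrableOn_cpow_mul_exp hs0 (hpos m)).2, hre, one_div, Real.inv_rpow, ← Real.rpow_neg,
        Real.mul_rpow h2pi.le (latticePoint_re_pos hN m).le]
      · exact (mul_pos h2pi (latticePoint_re_pos hN m)).le
      · exact (mul_pos h2pi (latticePoint_re_pos hN m)).le)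
  have h3 : ∫ t in Set.Ioi (0 : ℝ), ∑' m : Fin N → ℕ,
      (t : ℂ) ^ (s - 1) * exp (-(2 * Real.pi * latticePoint N m * t)) = mellin (kernel N) s := by
    refine setIntegral_congr_fun measurableSet_Ioi fun t ht => ?_
    simp only [tsum_mul_left, (hasSum_kernel N ht).tsum_eq, smul_eq_mul]
  rw [h3] at h1
  have hG := Complex.Gamma_ne_zero_of_re_pos hs0
  have h4 := (h1.mul_left ((2 * Real.pi : ℂ) ^ s)).div_const (Complex.Gamma s)
  refine h4.congr_of_eq (fun m => ?_) rfl
  have h5 : ((2 * Real.pi : ℝ) : ℂ) ^ s ≠ 0 := by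
    rw [Ne, cpow_eq_zero_iff]
    simp [Real.pi_ne_zero]
  have hl0 : latticePoint N m ≠ 0 := fun h => by
    have := latticePoint_re_pos hN m
    rw [h] at this
    exact lt_irrefl _ this
  have h6 : (((2 * Real.pi : ℝ) : ℂ) * latticePoint N m) ^ (-s) =
      (((2 * Real.pi : ℝ) : ℂ) ^ s)⁻¹ * latticePoint N m ^ (-s) := by
    have h2c : ((2 * Real.pi : ℝ) : ℂ) ≠ 0 := by exact_mod_cast h2pi.ne'
    rw [← cpow_neg, cpow_def_of_ne_zero (mul_ne_zero h2c hl0), log_ofReal_mul h2pi hl0,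
      cpow_def_of_ne_zero h2c, cpow_def_of_ne_zero hl0, ← Complex.exp_add, ofReal_log h2pi.le]
    congr 1
    ring
  rw [integral_cpow_mul_exp_neg_mul_complex hs0 (hpos m),
    show (2 * Real.pi : ℂ) = ((2 * Real.pi : ℝ) : ℂ) by push_cast; rfl, h6, mul_assoc,
    mul_inv_cancel_left₀ h5, mul_div_cancel_right₀ _ hG]

/-! ### The Mellin transform through the partial fraction expansion -/

/-- The entire function `∑ coef m m^{s - 1}`. -/
noncomputable def coefSeries (N : ℕ) (s : ℂ) : ℂ :=
  ∑' m : ℕ, coef N (m + 1) * ((m : ℂ) + 1) ^ (s - 1)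

theorem norm_natCast_succ_cpow (m : ℕ) (s : ℂ) :
    ‖((m : ℂ) + 1) ^ s‖ = ((m : ℝ) + 1) ^ s.re := by
  have h : ((m : ℂ) + 1) = (((m : ℝ) + 1 : ℝ) : ℂ) := by push_cast; rfl
  rw [h, norm_cpow_eq_rpow_re_of_pos (by positivity)]

theorem differentiable_coefSeries {N : ℕ} (hN : 2 ≤ N) : Differentiable ℂ (coefSeries N) := by
  intro s
  obtain ⟨K, hK⟩ := exists_nat_gt s.re
  have hopen : IsOpen {z : ℂ | z.re < K} := isOpen_lt continuous_re continuous_const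
  have h := differentiableOn_tsum_of_summable_norm
    (F := fun (m : ℕ) (s : ℂ) => coef N (m + 1) * ((m : ℂ) + 1) ^ (s - 1))
    (U := {z : ℂ | z.re < K}) ((summable_nat_add_iff 1).2 (summable_pow_mul_norm_coef hN K))
    (fun m => ?_) hopen fun m z hz => ?_
  · exact h.differentiableAt (hopen.mem_nhds hK)
  · have hn : ((m : ℂ) + 1) ≠ 0 := by exact_mod_cast Nat.succ_ne_zero m
    refine Differentiable.differentiableOn fun z => ?_
    refine ((differentiableAt_id.sub_const (1 : ℂ)).const_cpow (Or.inl hn)).const_mul _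
  · have hz' : z.re < K := hz
    rw [norm_mul, norm_natCast_succ_cpow, mul_comm]
    refine mul_le_mul_of_nonneg_right ?_ (norm_nonneg _)
    push_cast
    rw [← Real.rpow_natCast]
    exact Real.rpow_le_rpow_of_exponent_le (by linarith [Nat.cast_nonneg (α := ℝ) m])
      (by rw [sub_re, one_re]; linarith)

/-- The `2N`-th power of a pole is positive, whereas `θ_0^(2N) = -1`. -/
theorem theta_zero_mul_ne_pole {N : ℕ} (hN : N ≠ 0) {T : ℝ} (hT : 0 < T) (m l : ℕ) :
    theta N 0 * T ≠ pole N m l := by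
  intro h
  have h1 := congrArg (fun z => z ^ (2 * N)) h
  simp only [pole, mul_pow] at h1
  rw [← pow_mul (eta N), mul_comm l, pow_mul (eta N), (isPrimitiveRoot_eta hN).pow_eq_one, one_pow,
    mul_comm 2 N, pow_mul (theta N 0), theta_zero_pow hN, I_sq] at h1
  have h2 : -T ^ (N * 2) = ((m : ℝ) + 1) ^ (N * 2) := by
    have : ((-T ^ (N * 2) : ℝ) : ℂ) = ((((m : ℝ) + 1) ^ (N * 2) : ℝ) : ℂ) := by
      push_cast
      linear_combination h1
    exact_mod_cast this
  have h3 : 0 < T ^ (N * 2) := by positivity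
  have h4 : 0 < ((m : ℝ) + 1) ^ (N * 2) := by positivity
  linarith

theorem hasSum_gen_theta {N : ℕ} (hN : 2 ≤ N) {T : ℝ} (hT : 0 < T) :
    HasSum (fun m : ℕ => -(genRes N m * (2 * N * ((m : ℂ) + 1) ^ (2 * N - 1))) *
      ((T ^ (2 * N) + ((m : ℝ) + 1) ^ (2 * N) : ℝ) : ℂ)⁻¹) (gen N (theta N 0 * T)) := by
  have hN0 : N ≠ 0 := by omega
  refine (hasSum_gen hN fun m l _ => theta_zero_mul_ne_pole hN0 hT m l).congr_of_eq (fun m => ?_) rfl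
  have h1 : (theta N 0 * T) ^ (2 * N) = -(T : ℂ) ^ (2 * N) := by
    rw [mul_pow, mul_comm 2 N, pow_mul (theta N 0), theta_zero_pow hN0, I_sq, neg_one_mul]
  have h2 : (theta N 0 * T) ^ (2 * N) - ((m : ℂ) + 1) ^ (2 * N) =
      -((T ^ (2 * N) + ((m : ℝ) + 1) ^ (2 * N) : ℝ) : ℂ) := by
    rw [h1]
    push_cast
    ring
  rw [h2, div_neg, div_eq_mul_inv]
  ring

/-- The Mellin transform of the partial fraction expansion, taken term by term at `σ = s - N`. Each
`1/(T^(2N) + n^(2N))` has the strip `0 < Re σ < 2N`, whence the bounds on `s`. -/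
theorem mellin_kernel {N : ℕ} (hN : 2 ≤ N) {s : ℂ} (h0 : (N : ℝ) < s.re) (h1 : s.re < 3 * N) :
    mellin (kernel N) s =
      (-1) ^ N / 2 * coefSeries N s / sin (Real.pi * (s - N) / (2 * N)) := by
  have hN0 : N ≠ 0 := by omega
  set σ := s - N with hσ
  have hσre : σ.re = s.re - N := by simp [hσ]
  have hσ0 : 0 < σ.re := by linarith
  have hσ1 : σ.re < (2 * N : ℕ) := by
    push_cast
    linarith
  have hM : 2 * N ≠ 0 := by omega
  have hstep : mellin (kernel N) s =
      ((-1) ^ N * I⁻¹) * mellin (fun T : ℝ => gen N (theta N 0 * T)) σ := by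
    have h2 : mellin (kernel N) s = mellin (fun T : ℝ => ((-1) ^ N * I⁻¹ : ℂ) •
        ((T : ℂ) ^ (-(N : ℂ)) • gen N (theta N 0 * T))) s :=
      setIntegral_congr_fun measurableSet_Ioi fun T hT => by
        simp only
        rw [kernel_eq_gen hN0 hT]
    rw [h2, mellin_const_smul, mellin_cpow_smul, smul_eq_mul, ← sub_eq_add_neg]
  set c : ℕ → ℂ := fun m => -(genRes N m * (2 * N * ((m : ℂ) + 1) ^ (2 * N - 1))) with hc
  set g : ℕ → ℝ → ℂ := fun m T => ((T ^ (2 * N) + ((m : ℝ) + 1) ^ (2 * N) : ℝ) : ℂ)⁻¹ with hg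
  have hgm : ∀ m, _ := fun m : ℕ => mellin_pow_add_inv hM (n := (m : ℝ) + 1) (by positivity) hσ0 hσ1
  have hint : ∀ m, Integrable (fun T : ℝ => c m * ((T : ℂ) ^ (σ - 1) • g m T))
      (volume.restrict (Set.Ioi 0)) := fun m => (hgm m).1.const_mul _
  have hnorm : Summable fun m =>
      ∫ T in Set.Ioi (0 : ℝ), ‖c m * ((T : ℂ) ^ (σ - 1) • g m T)‖ := by
    set D := ∫ T in Set.Ioi (0 : ℝ), ‖(T : ℂ) ^ (σ - 1) • g 0 T‖ with hD
    have h2 := ((summable_pow_mul_norm_genRes hN (2 * N - 1)).mul_left (2 * N * D : ℝ))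
    refine Summable.of_nonneg_of_le (fun m => integral_nonneg fun _ => norm_nonneg _) (fun m => ?_) h2
    simp only [norm_mul]
    rw [integral_const_mul]
    -- All terms are compared with the one for `n = 1`; the exponential decay of the residues does
    -- the rest.
    have h3 : ∫ T in Set.Ioi (0 : ℝ), ‖(T : ℂ) ^ (σ - 1) • g m T‖ ≤ D := by
      refine setIntegral_mono_on (hgm m).1.norm (hgm 0).1.norm measurableSet_Ioi fun T hT => ?_
      have hT0 : (0 : ℝ) < T := hT
      rw [norm_smul, norm_smul]
      refine mul_le_mul_of_nonneg_left ?_ (norm_nonneg _)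
      simp only [hg, norm_inv, norm_real]
      rw [Real.norm_of_nonneg (by positivity), Real.norm_of_nonneg (by positivity)]
      refine inv_anti₀ (by positivity) ?_
      gcongr
      simp
    have h4 : ‖c m‖ = 2 * N * (((m : ℝ) + 1) ^ (2 * N - 1) * ‖genRes N m‖) := by
      have h5 := norm_natCast_succ_cpow m 1
      rw [cpow_one, one_re, Real.rpow_one] at h5
      simp only [hc, norm_neg, norm_mul, norm_pow, h5, Complex.norm_ofNat, Complex.norm_natCast]
      ring
    calc ‖c m‖ * _ ≤ ‖c m‖ * D := mul_le_mul_of_nonneg_left h3 (norm_nonneg _)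
      _ = _ := by rw [h4]; ring
  have hsum := hasSum_integral_of_summable_integral_norm hint hnorm
  have htot : ∫ T in Set.Ioi (0 : ℝ), ∑' m, c m * ((T : ℂ) ^ (σ - 1) • g m T) =
      mellin (fun T : ℝ => gen N (theta N 0 * T)) σ := by
    refine setIntegral_congr_fun measurableSet_Ioi fun T hT => ?_
    have h2 := ((hasSum_gen_theta hN hT).mul_left ((T : ℂ) ^ (σ - 1))).tsum_eq
    simp only [smul_eq_mul]
    rw [← h2]
    refine tsum_congr fun m => ?_
    simp only [hc, hg]
    ring
  rw [htot] at hsum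
  have hval : ∀ m : ℕ, ∫ T in Set.Ioi (0 : ℝ), c m * ((T : ℂ) ^ (σ - 1) • g m T) =
      -(2 * I)⁻¹ / sin (Real.pi * σ / (2 * N)) * (coef N (m + 1) * ((m : ℂ) + 1) ^ (s - 1)) := by
    intro m
    have hn : ((m : ℂ) + 1) ≠ 0 := by exact_mod_cast Nat.succ_ne_zero m
    have hNc : (N : ℂ) ≠ 0 := by exact_mod_cast hN0
    have hpi : (Real.pi : ℂ) ≠ 0 := by exact_mod_cast Real.pi_ne_zero
    rw [integral_const_mul]
    have h2 : ∫ T in Set.Ioi (0 : ℝ), (T : ℂ) ^ (σ - 1) • g m T = _ := (hgm m).2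
    -- With `n = m + 1`, the powers combine to `n^N · n^(2N-1) · n^(s-3N) = n^(s-1)`.
    have h3 : (((m : ℝ) + 1 : ℝ) : ℂ) ^ (σ - (2 * N : ℕ)) =
        ((m : ℂ) + 1) ^ (s - 1) / (((m : ℂ) + 1) ^ N * ((m : ℂ) + 1) ^ (2 * N - 1)) := by
      rw [← cpow_natCast, ← cpow_natCast, ← cpow_add _ _ hn, ← cpow_sub _ _ hn]
      have : ((2 * N - 1 : ℕ) : ℂ) = 2 * N - 1 := by
        rw [Nat.cast_sub (by omega)]
        push_cast
        rfl
      rw [this]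
      push_cast
      congr 1
      rw [hσ]
      ring
    rw [h2, h3]
    simp only [hc, genRes]
    have hn1 := pow_ne_zero N hn
    have hn2 := pow_ne_zero (2 * N - 1) hn
    push_cast
    field_simp
  have hfin := hsum.congr_of_eq (fun m => (hval m).symm) rfl
  rw [hstep, ← hfin.tsum_eq, tsum_mul_left, ← coefSeries]
  have hI : I⁻¹ * -(2 * I)⁻¹ = (1 / 2 : ℂ) := by
    rw [mul_inv, inv_I]
    linear_combination (-1 / 2 : ℂ) * I_sq
  linear_combination ((-1) ^ N / sin (Real.pi * σ / (2 * N)) * coefSeries N s) * hI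

/-! ### The analytic continuation -/

/-- The entire continuation of `sin (π s) / (π sin (π (s - N) / 2N))` times `Γ (1 - s)`. -/
noncomputable def reflectedFactor (N : ℕ) (s : ℂ) : ℂ :=
  Complex.Gamma (1 - s) * ((-1) ^ N / Real.pi *
    (Polynomial.Chebyshev.U ℂ (2 * N - 1 : ℤ)).eval (cos (Real.pi * (s - N) / (2 * N))))

/-- With `x = π(s - N)/2N`, `sin(πs) = (-1)^N sin(2Nx)`, and `sin(2Nx)/sin x` is the Chebyshev
polynomial `U_(2N-1)` at `cos x`. The reflection formula then trades `1/Γ(s)` for `Γ(1 - s)`. -/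
theorem reflectedFactor_eq {N : ℕ} (hN : N ≠ 0) {s : ℂ}
    (h : sin (Real.pi * (s - N) / (2 * N)) ≠ 0) (hs : sin (Real.pi * s) ≠ 0 ∨ s = 0) :
    reflectedFactor N s = (Complex.Gamma s)⁻¹ / sin (Real.pi * (s - N) / (2 * N)) := by
  have hNc : (N : ℂ) ≠ 0 := by exact_mod_cast hN
  have hpi : (Real.pi : ℂ) ≠ 0 := by exact_mod_cast Real.pi_ne_zero
  set x := Real.pi * (s - N) / (2 * N) with hx
  have hU := Polynomial.Chebyshev.U_complex_cos x (2 * N - 1 : ℤ)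
  have h1 : sin (((2 * N - 1 : ℤ) + 1 : ℂ) * x) = (-1) ^ N * sin (Real.pi * s) := by
    have : (((2 * N - 1 : ℤ) + 1 : ℂ) * x) = Real.pi * s - N * Real.pi := by
      rw [hx]
      push_cast
      field_simp
      ring
    rw [this]
    exact Complex.sin_antiperiodic.sub_nat_mul_eq N
  rw [h1] at hU
  rw [reflectedFactor, eq_div_iff h, mul_assoc, mul_assoc, hU]
  have h2 : ((-1 : ℂ) ^ N) * (-1) ^ N = 1 := by rw [← mul_pow]; norm_num
  rcases hs with hs | rfl
  · have h3 := Complex.Gamma_mul_Gamma_one_sub s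
    have h4 : Complex.Gamma s ≠ 0 := by
      intro h0
      rw [h0, zero_mul] at h3
      exact div_ne_zero hpi hs h3.symm
    rw [eq_div_iff hs] at h3
    refine eq_inv_of_mul_eq_one_left ?_
    calc _ = ((-1) ^ N * (-1) ^ N) * (Complex.Gamma s * Complex.Gamma (1 - s) *
          sin (Real.pi * s)) / Real.pi := by ring
      _ = 1 := by rw [h2, h3, one_mul, div_self hpi]
  -- At `s = 0` both sides vanish, since `Complex.Gamma 0 = 0` by convention and its inverse is the
  -- correct value of `1/Γ`.
  · simp

theorem differentiableAt_reflectedFactor (N : ℕ) {s : ℂ} (hs : ∀ m : ℕ, s ≠ m + 1) :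
    DifferentiableAt ℂ (reflectedFactor N) s := by
  refine DifferentiableAt.mul ?_ ?_
  · refine DifferentiableAt.comp s (g := Complex.Gamma) (Complex.differentiableAt_Gamma _ fun m h => ?_)
      (by fun_prop)
    refine hs m ?_
    linear_combination -h
  · refine DifferentiableAt.const_mul ?_ _
    exact DifferentiableAt.comp s
      (g := fun x => (Polynomial.Chebyshev.U ℂ (2 * N - 1 : ℤ)).eval x)
      (f := fun s : ℂ => cos (Real.pi * (s - N) / (2 * N)))
      (Polynomial.differentiable _).differentiableAt (by fun_prop)

/-- The formula for the continued zeta function to the left of `re s = N + 1`. -/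
noncomputable def zetaLeft (N : ℕ) (s : ℂ) : ℂ :=
  (2 * Real.pi : ℂ) ^ s * ((-1) ^ N / 2 * coefSeries N s) * reflectedFactor N s

open Classical in
/-- The continued zeta function of the points `latticePoint N m`. -/
noncomputable def latticeZeta (N : ℕ) (s : ℂ) : ℂ :=
  if (N : ℝ) < s.re then (2 * Real.pi : ℂ) ^ s * mellin (kernel N) s / Complex.Gamma s
  else zetaLeft N s

theorem sin_ne_zero_of_not_int {s : ℂ} (hs : ∀ k : ℤ, s ≠ k) : sin (Real.pi * s) ≠ 0 := by
  intro h
  obtain ⟨k, hk⟩ := Complex.sin_eq_zero_iff.1 h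
  have hpi : (Real.pi : ℂ) ≠ 0 := by exact_mod_cast Real.pi_ne_zero
  rw [mul_comm (k : ℂ)] at hk
  exact hs k (mul_left_cancel₀ hpi hk)

theorem sin_shift_ne_zero {N : ℕ} (hN : N ≠ 0) {s : ℂ} (h : ∀ k : ℤ, s ≠ N + 2 * N * k) :
    sin (Real.pi * (s - N) / (2 * N)) ≠ 0 := by
  have hNc : (N : ℂ) ≠ 0 := by exact_mod_cast hN
  rw [mul_div_assoc]
  refine sin_ne_zero_of_not_int fun k hk => h k ?_
  rw [div_eq_iff (by simp [hNc])] at hk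
  linear_combination hk

/-- The overlap `N < Re s < N + 1` contains no integer, so none of the sines in the formulas
vanishes there. -/
theorem latticeZeta_eq_zetaLeft {N : ℕ} (hN : 2 ≤ N) {s : ℂ} (hs : s.re < N + 1) :
    latticeZeta N s = zetaLeft N s := by
  have hN0 : N ≠ 0 := by omega
  have hN1 : (2 : ℝ) ≤ N := by exact_mod_cast hN
  rw [latticeZeta]
  split_ifs with h
  · have h1 : ∀ k : ℤ, s ≠ k := fun k hk => by
      rw [hk, intCast_re] at h hs
      have h2 : (N : ℤ) < k := by exact_mod_cast h
      have h3 : k < N + 1 := by exact_mod_cast hs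
      omega
    have h4 := sin_shift_ne_zero hN0 (s := s) fun k => by
      have := h1 (N + 2 * N * k)
      push_cast at this
      exact this
    rw [zetaLeft, reflectedFactor_eq hN0 h4 (Or.inl (sin_ne_zero_of_not_int h1)),
      mellin_kernel hN h (by linarith)]
    ring
  · rfl

theorem isOpen_ne_Icc (N : ℕ) : IsOpen {s : ℂ | ∀ j ∈ Finset.Icc 1 N, s ≠ (j : ℂ)} := by
  have : {s : ℂ | ∀ j ∈ Finset.Icc 1 N, s ≠ (j : ℂ)} =
      ⋂ j ∈ Finset.Icc 1 N, {s : ℂ | s ≠ (j : ℂ)} := by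
    ext s
    simp
  rw [this]
  exact isOpen_biInter_finset fun j _ => isOpen_ne

theorem differentiableAt_latticeZeta {N : ℕ} (hN : 2 ≤ N) {s : ℂ}
    (hsN : ∀ j ∈ Finset.Icc 1 N, s ≠ (j : ℂ)) : DifferentiableAt ℂ (latticeZeta N) s := by
  have hN0 : N ≠ 0 := by omega
  have h2pi : (2 * Real.pi : ℂ) ≠ 0 := by simp [Real.pi_ne_zero]
  have hpow : DifferentiableAt ℂ (fun s : ℂ => (2 * Real.pi : ℂ) ^ s) s :=
    differentiableAt_id.const_cpow (Or.inl h2pi)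
  rcases lt_or_ge (N : ℝ) s.re with h | h
  · have h1 : latticeZeta N =ᶠ[𝓝 s]
        fun s => (2 * Real.pi : ℂ) ^ s * mellin (kernel N) s * (Complex.Gamma s)⁻¹ := by
      filter_upwards [(isOpen_lt continuous_const continuous_re).mem_nhds h] with z hz
      have hz' : (N : ℝ) < z.re := hz
      rw [latticeZeta, if_pos hz', div_eq_mul_inv]
    refine DifferentiableAt.congr_of_eventuallyEq ?_ h1
    exact (hpow.mul (differentiableAt_mellin_kernel hN0 h)).mul
      (Complex.differentiable_one_div_Gamma s)
  · have h1 : latticeZeta N =ᶠ[𝓝 s] zetaLeft N := by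
      have h2 : s.re < N + 1 := by linarith
      filter_upwards [(isOpen_lt continuous_re continuous_const).mem_nhds h2] with z hz
      exact latticeZeta_eq_zetaLeft hN hz
    refine DifferentiableAt.congr_of_eventuallyEq ?_ h1
    refine (hpow.mul ((differentiable_coefSeries hN s).const_mul _)).mul
      (differentiableAt_reflectedFactor N fun m hm => ?_)
    -- The poles of `Γ(1 - s)` are the positive integers; those beyond `N` lie outside the region
    -- `Re s ≤ N` treated here.
    by_cases hmN : m + 1 ≤ N
    · exact hsN (m + 1) (Finset.mem_Icc.2 ⟨by omega, hmN⟩) (by rw [hm]; push_cast; rfl)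
    · rw [hm] at h
      have : ((m : ℂ) + 1).re = ((m + 1 : ℕ) : ℝ) := by simp
      rw [this] at h
      exact hmN (by exact_mod_cast h)

theorem hasDerivAt_one_div_Gamma_zero : HasDerivAt (fun s => (Complex.Gamma s)⁻¹) 1 0 := by
  have h1 : (fun s : ℂ => (Complex.Gamma s)⁻¹) = fun s => s * (Complex.Gamma (s + 1))⁻¹ :=
    funext fun s => Complex.one_div_Gamma_eq_self_mul_one_div_Gamma_add_one s
  rw [h1]
  have h2 : DifferentiableAt ℂ (fun s : ℂ => (Complex.Gamma (s + 1))⁻¹) 0 :=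
    (Complex.differentiable_one_div_Gamma.comp (differentiable_id.add_const (1 : ℂ))) 0
  have h3 : HasDerivAt (fun s : ℂ => s * (Complex.Gamma (s + 1))⁻¹) _ 0 :=
    (hasDerivAt_id (0 : ℂ)).mul h2.hasDerivAt
  simpa using h3

/-- Near `0` the function is `f(s)/Γ(s)` with `f` differentiable at `0`. As `1/Γ` vanishes there
with derivative `1`, the derivative is `f(0)`, where the sine equals `sin(-π/2) = -1`. -/
theorem hasDerivAt_latticeZeta_zero {N : ℕ} (hN : 2 ≤ N) :
    latticeZeta N 0 = 0 ∧
      HasDerivAt (latticeZeta N) ((-1) ^ (N - 1) / 2 * coefSeries N 0) 0 := by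
  have hN0 : N ≠ 0 := by omega
  have hNc : (N : ℂ) ≠ 0 := by exact_mod_cast hN0
  have h2pi : (2 * Real.pi : ℂ) ≠ 0 := by simp [Real.pi_ne_zero]
  have hx0 : (Real.pi * ((0 : ℂ) - N) / (2 * N)) = -(Real.pi / 2) := by
    field_simp
    ring
  have hsin0 : sin (Real.pi * ((0 : ℂ) - N) / (2 * N)) = -1 := by
    rw [hx0, sin_neg, sin_pi_div_two]
  set f : ℂ → ℂ := fun s => (2 * Real.pi : ℂ) ^ s * ((-1) ^ N / 2 * coefSeries N s) /
    sin (Real.pi * (s - N) / (2 * N)) with hf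
  have h1 : latticeZeta N =ᶠ[𝓝 0] fun s => f s * (Complex.Gamma s)⁻¹ := by
    have hball : Metric.ball (0 : ℂ) 1 ∈ 𝓝 (0 : ℂ) := Metric.ball_mem_nhds _ one_pos
    filter_upwards [hball] with s hs
    rw [mem_ball_zero_iff] at hs
    have hre : s.re < 1 := (le_abs_self _).trans_lt ((abs_re_le_norm s).trans_lt hs)
    have hint : ∀ k : ℤ, k ≠ 0 → s ≠ k := fun k hk h => by
      rw [h, norm_intCast] at hs
      have : |k| < 1 := by exact_mod_cast hs
      exact hk (Int.abs_lt_one_iff.1 this)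
    have hN1 : (2 : ℝ) ≤ N := by exact_mod_cast hN
    rw [latticeZeta_eq_zetaLeft hN (by linarith), zetaLeft, reflectedFactor_eq hN0]
    · simp only [hf]
      ring
    · refine sin_shift_ne_zero hN0 fun k => ?_
      have h3 : (N : ℤ) + 2 * N * k ≠ 0 := fun h => by
        have h4 : (N : ℤ) * (1 + 2 * k) = 0 := by linear_combination h
        rcases mul_eq_zero.1 h4 with h5 | h5 <;> omega
      have := hint _ h3
      push_cast at this
      exact this
    · by_cases h0 : s = 0
      · exact Or.inr h0
      · refine Or.inl (sin_ne_zero_of_not_int fun k => ?_)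
        by_cases hk : k = 0
        · rwa [hk, Int.cast_zero]
        · exact hint k hk
  have hfd : DifferentiableAt ℂ f 0 := by
    refine DifferentiableAt.div ?_ (by fun_prop) (by rw [hsin0]; norm_num)
    exact (differentiableAt_id.const_cpow (Or.inl h2pi)).mul
      ((differentiable_coefSeries hN 0).const_mul _)
  refine ⟨by rw [h1.eq_of_nhds]; simp, ?_⟩
  have h2 := hfd.hasDerivAt.mul hasDerivAt_one_div_Gamma_zero
  have h3 : deriv f 0 * (Complex.Gamma 0)⁻¹ + f 0 * 1 = (-1) ^ (N - 1) / 2 * coefSeries N 0 := by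
    simp only [hf, hsin0, cpow_zero]
    obtain ⟨M, rfl⟩ := Nat.exists_eq_succ_of_ne_zero hN0
    simp only [Complex.Gamma_zero, inv_zero, Nat.succ_eq_add_one, Nat.add_sub_cancel, pow_succ]
    ring
  rw [← h3]
  exact h2.congr_of_eventuallyEq h1

/-! ### Rotated lattices -/

/-- The rotation that carries the points `latticePoint N m` to the points `v + m ⬝ b`. -/
noncomputable def rotationAngle (N : ℕ) : ℝ :=
  Real.pi / (2 * N) * (2 * (N / 2 : ℕ) - N + 1)

/-- The factor `2⌊N/2⌋ - N + 1` is `0` for odd `N` and `1` for even `N`. -/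
theorem rotationAngle_nonneg (N : ℕ) : 0 ≤ rotationAngle N := by
  have h : (N : ℝ) ≤ 2 * (N / 2 : ℕ) + 1 := by exact_mod_cast (by omega : N ≤ 2 * (N / 2) + 1)
  have := Real.pi_pos
  exact mul_nonneg (by positivity) (by linarith)

theorem rotationAngle_le {N : ℕ} (hN : N ≠ 0) : rotationAngle N ≤ Real.pi / 2 := by
  have h : 2 * (N / 2 : ℕ) ≤ (N : ℝ) := by exact_mod_cast (by omega : 2 * (N / 2) ≤ N)
  have h1 : (1 : ℝ) ≤ N := by exact_mod_cast Nat.one_le_iff_ne_zero.2 hN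
  have := Real.pi_pos
  calc rotationAngle N ≤ Real.pi / (2 * N) * N :=
        mul_le_mul_of_nonneg_left (by linarith) (by positivity)
    _ = Real.pi / 2 := by field_simp

theorem e_one_div_two_mul (N : ℕ) : e (1 / (2 * (N : ℂ))) = eta N := by
  rw [e, eta]
  congr 1
  ring

theorem eta_zpow_eq_rotation {N : ℕ} (hN : N ≠ 0) (j : ℕ) :
    eta N ^ (((N / 2 : ℕ) : ℤ) + 1 - (N : ℤ) + (j : ℤ)) =
      exp (rotationAngle N * I) * (-I * theta N j) := by
  have hNc : (N : ℂ) ≠ 0 := by exact_mod_cast hN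
  have hI : -I = exp (-(Real.pi / 2) * I) := by
    rw [neg_mul, exp_neg, exp_pi_div_two_mul_I, inv_I]
  rw [eta, ← exp_int_mul, hI, theta, ← exp_add, ← exp_add, rotationAngle]
  generalize N / 2 = q
  congr 1
  push_cast
  field_simp
  ring

theorem add_sum_mul_eq_rotation {N : ℕ} (hN : N ≠ 0) {v : ℂ} {b : Fin N → ℂ}
    (hb : ∀ j : Fin N, b j = eta N ^ (((N / 2 : ℕ) : ℤ) + 1 - (N : ℤ) + ((j : ℕ) : ℤ)))
    (hv : v = (∑ j, b j) / 2) (m : Fin N → ℕ) :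
    v + ∑ l, (m l : ℂ) * b l = exp (rotationAngle N * I) * latticePoint N m := by
  rw [hv, latticePoint, Finset.sum_div, ← Finset.sum_add_distrib, Finset.mul_sum]
  refine Finset.sum_congr rfl fun j _ => ?_
  rw [hb, eta_zpow_eq_rotation hN]
  ring

/-- The continued Barnes zeta function of the rotated lattice. -/
noncomputable def rotatedZeta (N : ℕ) (s : ℂ) : ℂ :=
  exp (rotationAngle N * I * -s) * latticeZeta N s

theorem isZeta_rotatedZeta {N : ℕ} (hN : 2 ≤ N) {v : ℂ} {b : Fin N → ℂ}
    (hb : ∀ j : Fin N, b j = eta N ^ (((N / 2 : ℕ) : ℤ) + 1 - (N : ℤ) + ((j : ℕ) : ℤ)))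
    (hv : v = (∑ j, b j) / 2) : IsZeta v b (rotatedZeta N) := by
  have hN0 : N ≠ 0 := by omega
  refine ⟨fun s hs => ?_, fun s hs => ?_⟩
  · refine DifferentiableAt.differentiableWithinAt ?_
    exact DifferentiableAt.mul (by fun_prop) (differentiableAt_latticeZeta hN hs)
  · have h := (hasSum_latticePoint_cpow hN0 hs).mul_left (exp (rotationAngle N * I * -s))
    refine h.congr_of_eq (fun m => ?_) ?_
    · rw [add_sum_mul_eq_rotation hN0 hb hv, exp_mul_I_mul_cpow (latticePoint_re_pos hN0 m)
        (by linarith [rotationAngle_nonneg N, Real.pi_pos]) (rotationAngle_le hN0)]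
    · rw [rotatedZeta, latticeZeta, if_pos hs]

theorem coefSeries_zero (N : ℕ) :
    coefSeries N 0 = ∑' m : ℕ, coef N (m + 1) / ((m : ℂ) + 1) :=
  tsum_congr fun m => by rw [zero_sub, cpow_neg_one, div_eq_mul_inv]

/-- The rotation multiplies the zeta function by `exp(-iφs)`, which is `1` at `s = 0`; as the zeta
function vanishes there, its derivative is unaffected. Uniqueness of the continuation identifies the
chosen `zeta` with this one near `0`. -/
theorem Gamma_eq_exp {N : ℕ} (hN : 2 ≤ N) {v : ℂ} {b : Fin N → ℂ}
    (hb : ∀ j : Fin N, b j = eta N ^ (((N / 2 : ℕ) : ℤ) + 1 - (N : ℤ) + ((j : ℕ) : ℤ)))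
    (hv : v = (∑ j, b j) / 2) :
    Gamma v b = exp ((-1) ^ (N - 1) / 2 * ∑' m : ℕ, coef N (m + 1) / ((m : ℂ) + 1)) := by
  have hZ := isZeta_rotatedZeta hN hb hv
  have hzeta : IsZeta v b (zeta v b) := Classical.epsilon_spec ⟨_, hZ⟩
  have h0 : (0 : ℂ) ∈ {s : ℂ | ∀ j ∈ Finset.Icc 1 N, s ≠ (j : ℂ)} := fun j hj h => by
    have h1 := (Finset.mem_Icc.1 hj).1
    have h2 : j = 0 := by exact_mod_cast h.symm
    omega
  have heq : zeta v b =ᶠ[𝓝 0] rotatedZeta N :=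
    (hzeta.eqOn hZ).eventuallyEq_of_mem ((isOpen_ne_Icc N).mem_nhds h0)
  obtain ⟨h1, h2⟩ := hasDerivAt_latticeZeta_zero hN
  have h3 : HasDerivAt (fun s : ℂ => exp (rotationAngle N * I * -s)) _ 0 :=
    (show DifferentiableAt ℂ (fun s : ℂ => exp (rotationAngle N * I * -s)) 0 by
      fun_prop).hasDerivAt
  have h4 : HasDerivAt (rotatedZeta N) _ 0 := h3.mul h2
  rw [Gamma, heq.deriv_eq, h4.deriv, h1, ← coefSeries_zero]
  simp

end Barnes

/-! ### Assembly of the three statements. -/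

theorem corollary4 (N : ℕ) (hN : 2 ≤ N) (η w v : ℂ) (b : Fin N → ℂ)
    (hη : η = Barnes.e (1 / (2 * (N : ℂ)))) (hw : w = (1 - η)⁻¹)
    (hb : ∀ j : Fin N, b j = η ^ (((N / 2 : ℕ) : ℤ) + 1 - (N : ℤ) + ((j : ℕ) : ℤ)))
    (hv : v = (∑ j, b j) / 2) :
    (∀ k : ℤ, k ≡ (N : ℤ) [ZMOD 2 * (N : ℤ)] →
      Summable (fun m : ℕ+ =>
        Barnes.e (-((m : ℂ) * w)) / (∏ l ∈ Finset.Icc 1 (N - 1), (1 - Barnes.e (-((m : ℂ) * η ^ l)))) *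
          (m : ℂ) ^ (k - 1)) ∧
      (Even N →
        (2 * (Real.pi : ℂ) * Complex.I) ^ (k - 1) * ∑' m : ℕ+,
          Barnes.e (-((m : ℂ) * w)) / (∏ l ∈ Finset.Icc 1 (N - 1), (1 - Barnes.e (-((m : ℂ) * η ^ l)))) *
            (m : ℂ) ^ (k - 1) ∈ IntermediateField.adjoin ℚ {η}) ∧
      (Odd N →
        ∃ q : ℚ, (2 * (Real.pi : ℂ) * Complex.I) ^ (k - 1) * ∑' m : ℕ+,
          Barnes.e (-((m : ℂ) * w)) / (∏ l ∈ Finset.Icc 1 (N - 1), (1 - Barnes.e (-((m : ℂ) * η ^ l)))) *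
            (m : ℂ) ^ (k - 1) = (q : ℂ)) ∧
      ((N : ℤ) < k →
        ∑' m : ℕ+,
          Barnes.e (-((m : ℂ) * w)) / (∏ l ∈ Finset.Icc 1 (N - 1), (1 - Barnes.e (-((m : ℂ) * η ^ l)))) *
            (m : ℂ) ^ (k - 1) = 0)) ∧
    (Odd N → ∀ k : ℤ, 2 * (N : ℤ) ∣ k →
      Summable (fun m : {m : ℤ // m ≠ 0} =>
        ((m : ℤ) : ℂ) ^ (k - 1) /
          ∏ l ∈ Finset.Icc 1 (N - 1), (1 - Barnes.e (-(((m : ℤ) : ℂ) * η ^ (2 * l))))) ∧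
      ∑' m : {m : ℤ // m ≠ 0},
        ((m : ℤ) : ℂ) ^ (k - 1) /
          ∏ l ∈ Finset.Icc 1 (N - 1), (1 - Barnes.e (-(((m : ℤ) : ℂ) * η ^ (2 * l)))) = 0) ∧
    (∃ Z : ℂ → ℂ, Barnes.IsZeta v b Z) ∧
    HasProd (fun n : Fin (N - 1) → ℕ =>
        (1 - Barnes.e (-w) * Barnes.e (∑ j, (1 + (n j : ℂ)) * η ^ ((j : ℕ) + 1))) ^ (-(1 / 2) : ℂ))
      (Barnes.Gamma v b) := by
  have hη' : η = Barnes.eta N := hη.trans (Barnes.e_one_div_two_mul N)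
  subst hη'
  subst hw
  have hN0 : N ≠ 0 := by omega
  refine ⟨fun k hk => ?_, fun hodd k hk => Barnes.summable_and_tsum_int_eq_zero hN hodd hk,
    ⟨_, Barnes.isZeta_rotatedZeta hN hb hv⟩, ?_⟩
  · have h : ∀ m : ℕ+, Barnes.e (-((m : ℂ) * (1 - Barnes.eta N)⁻¹)) /
        (∏ l ∈ Finset.Icc 1 (N - 1), (1 - Barnes.e (-((m : ℂ) * Barnes.eta N ^ l)))) =
          Barnes.coef N m := fun m => Barnes.e_neg_div_prod_eq_coef hN0 (m : ℕ)
    simp only [h]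
    exact ⟨Barnes.summable_norm_mul_zpow (Barnes.summable_pow_mul_norm_coef hN) (k - 1),
      fun _ => Barnes.tsum_coef_mul_zpow_mem_adjoin hN hk,
      fun hodd => Barnes.tsum_coef_mul_zpow_rat hN hodd hk,
      fun hkN => (Barnes.tsum_coef_mul_zpow_eq_zero hN hk hkN).tsum_eq⟩
  · rw [Barnes.Gamma_eq_exp hN hb hv]
    exact Barnes.hasProd_one_sub_cpow hN
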